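/- Let $d\in\{2,3\}$, $\gamma\ge 1$, $T>0$, $\mathbb T^d=(\mathbb R/\mathbb Z)^d$, $p(\varrho)=\varrho^\gamma$, $E(\varrho)=\int_0^\varrho p(s)\,ds$ and $Q(\varrho)=\int_0^\varrho\sqrt s\,p'(s)\,ds$. Consider the multi-dimensional Aw--Rascle system $$\partial_t\varrho+\operatorname{div}(\varrho\mathbf u)=0,\qquad \partial_t(\varrho\mathbf w)+\operatorname{div}(\varrho\mathbf u\otimes\mathbf w)=0,\qquad \mathbf u=\mathbf w-\nabla p(\varrho)\qquad\text{on }(0,T)\times\mathbb T^d ,$$ where $(\operatorname{div}(\varrho\mathbf u\otimes\mathbf w))_i=\sum_j\partial_j(\varrho u_jw_i)$. **Measure-valued solutions.** Let $\mathcal F=[0,\infty)\times\mathbb R^d\times\mathbb R^d$ with dummy variables $(r,z,q)$, standing for $(\varrho,\sqrt\varrho\,\mathbf w,\nabla Q(\varrho))$. Let $\mathcal V_0=(\mathcal V_{0,x})_{x\in\mathbb T^d}$ be a weakly-* measurable family of probability measures on $[0,\infty)\times\mathbb R^d$ (variables $(r,z)$) with $\int_{\mathbb T^d}\langle\mathcal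 V_{0,x};\tfrac12|z|^2+E(r)\rangle\,dx<\infty$. A pair $(\mathcal V,\mathcal D)$, where $\mathcal V=(\mathcal V_{t,x})_{(t,x)\in(0,T)\times\mathbb T^d}$ is a weakly-* measurable family of probability measures on $\mathcal F$, and $\mathcal D\in L^\infty(0,T)$, $\mathcal D\ge0$, is a measure-valued solution with initial datum $\mathcal V_0$ if $\langle\mathcal V;|z|^2\rangle$, $\langle\mathcal V;E(r)\rangle$, $\langle\mathcal V;|q|^2\rangle$ are integrable on $(0,T)\times\mathbb T^d$ and, with $\varrho:=\langle\mathcal V_{t,x};r\rangle$, the following hold. 1. (Regularity) $\varrho\in C_{\rm weak}([0,T];L^{\gamma+1}(\mathbb T^d))$; for all $0<\alpha<\gamma+1$, $\varrho^\alpha=\langle\mathcal V_{t,x};r^\alpha\rangle$ a.e., and it belongs to $C_{\rm weak}([0,T];L^{(\gamma+1)/\alpha}(\mathbb T^d))$; $\langle\mathcal V_{t,x};z\rangle\in L^\infty(0,T;L^2(\mathbb T^d))$ and $\sqrt\varrho\,\langle\mathcal V_{t,x};z\rangle=\langle\mathcal V_{t,x};\sqrt r\,z\rangle$ a.e.; $Q(\varrho)=\langle\mathcal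 V_{t,x};Q(r)\rangle\in L^2(0,T;W^{1,2}(\mathbb T^d))$ with $\nabla_xQ(\varrho)=\langle\mathcal V_{t,x};q\rangle$. 2. (Continuity equation) For a.e. $\tau\in(0,T)$ and all $\psi\in C^1([0,T]\times\mathbb T^d)$, $$\int_{\mathbb T^d}\varrho(\tau)\psi(\tau)\,dx-\int_{\mathbb T^d}\langle\mathcal V_{0,x};r\rangle\psi(0)\,dx=\int_0^\tau\!\!\int_{\mathbb T^d}\big[\varrho\,\partial_t\psi+\sqrt\varrho\,\langle\mathcal V_{t,x};z\rangle\cdot\nabla\psi-\sqrt\varrho\,\nabla Q(\varrho)\cdot\nabla\psi\big]\,dx\,dt.$$ 3. (Momentum equation) There are a measure $r^M\in L^\infty_{\text{weak-(*)}}(0,T;\mathcal M(\mathbb T^d;\mathbb R^{d\times d}))+\mathcal M([0,T]\times\mathbb T^d;\mathbb R^{d\times d})$ and $\xi\in L^1(0,T)$ such that for a.e. $\tau\in(0,T)$ and all $\boldsymbol\phi\in C^1([0,T]\times\mathbb T^d;\mathbb R^d)$, $$\int_{\mathbb T^d}\sqrt\varrho\,\langle\mathcal V_{\tau,x};z\rangle\cdot\boldsymbol\phi(\tau)\,dx-\int_{\mathbb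 T^d}\langle\mathcal V_{0,x};\sqrt r\,z\rangle\cdot\boldsymbol\phi(0)\,dx=\int_0^\tau\!\!\int_{\mathbb T^d}\big[\sqrt\varrho\,\langle\mathcal V_{t,x};z\rangle\cdot\partial_t\boldsymbol\phi+\langle\mathcal V_{t,x};z\otimes z\rangle:\nabla\boldsymbol\phi-\langle\mathcal V_{t,x};z\otimes q\rangle:\nabla\boldsymbol\phi\big]\,dx\,dt+\langle r^M;\nabla\boldsymbol\phi\rangle_{[0,\tau]\times\mathbb T^d},$$ where $(\nabla\boldsymbol\phi)_{ij}=\partial_j\phi_i$, and for all $\epsilon>0$ $$\big|\langle r^M;\nabla\boldsymbol\phi\rangle_{[0,\tau]\times\mathbb T^d}\big|\le\Big(1+\frac1{4\epsilon}\Big)\int_0^\tau\xi(t)\mathcal D(t)\|\boldsymbol\phi(t)\|_{C^1(\mathbb T^d)}\,dt+\epsilon\,\|\boldsymbol\phi\|_{C^1([0,\tau]\times\mathbb T^d)}\,\mathcal D(\tau).$$ 4. (Energy inequality) There are a measure $\mathcal R\in L^\infty_{\text{weak-(*)}}(0,T;\mathcal M(\mathbb T^d))+\mathcal M([0,T]\times\mathbb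 T^d)$ and a constant $C>0$ such that for a.e. $\tau\in(0,T)$ $$\int_{\mathbb T^d}\langle\mathcal V_{\tau,x};\tfrac12|z|^2+E(r)\rangle\,dx+\int_0^\tau\!\!\int_{\mathbb T^d}\langle\mathcal V_{t,x};|q|^2\rangle\,dx\,dt+\mathcal D(\tau)\le\int_{\mathbb T^d}\langle\mathcal V_{0,x};\tfrac12|z|^2+E(r)\rangle\,dx+\int_0^\tau\!\!\int_{\mathbb T^d}\langle\mathcal V_{t,x};z\cdot q\rangle\,dx\,dt+\int_{(0,\tau)\times\mathbb T^d}d\mathcal R,$$ and, for all $\epsilon>0$, $\big|\int_{(0,\tau)\times\mathbb T^d}d\mathcal R\big|\le C\big(1+\frac1{4\epsilon}\big)\int_0^\tau\mathcal D(t)\,dt+\epsilon\,\mathcal D(\tau)$. **Theorem.** Let $(\mathcal V,\mathcal D)$ be a measure-valued solution with initial datum $\mathcal V_0$, and let $(\bar\varrho,\bar{\mathbf w})$, with $\bar\varrho>0$, be a strong solution of the system, of class $\bar\varrho\in C^1([0,T);C^2(\mathbb T^d))$, $\bar{\mathbf w}\in C^1([0,T);C^2(\mathbb T^d;\mathbb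 R^d))$. Assume that the initial states coincide: $\mathcal V_{0,x}=\delta_{(\bar\varrho(0,x),\,\sqrt{\bar\varrho(0,x)}\,\bar{\mathbf w}(0,x))}$ for a.e. $x\in\mathbb T^d$. Then $\mathcal D=0$ a.e. in $(0,T)$, and $$\mathcal V_{t,x}=\delta_{\left(\bar\varrho(t,x),\ \sqrt{\bar\varrho(t,x)}\,\bar{\mathbf w}(t,x),\ \nabla_xQ(\bar\varrho)(t,x)\right)}\qquad\text{for a.e. }(t,x)\in(0,T)\times\mathbb T^d .$$ -/

import Mathlib

open MeasureTheory ProbabilityTheory Set Filter Topology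
open scoped NNReal ENNReal

noncomputable section

namespace AwRascle

/-! ### The flat torus and calculus on it -/

/-- The flat torus `𝕋ᵈ = (ℝ/ℤ)ᵈ`, with its normalised Haar (Lebesgue) measure. -/
abbrev Torus (d : ℕ) : Type := UnitAddTorus (Fin d)

/-- `ℝᵈ` with the Euclidean norm. -/
abbrev Vec (d : ℕ) : Type := EuclideanSpace ℝ (Fin d)

/-- The quotient map `ℝᵈ → 𝕋ᵈ`. -/
def proj {d : ℕ} (y : Vec d) : Torus d := fun i => ((y i : ℝ) : UnitAddCircle)

/-- The periodic function on `ℝᵈ` that corresponds to a function on the torus. -/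
def lift {d : ℕ} {F : Type*} (f : Torus d → F) : Vec d → F := fun y => f (proj y)

/-- The partial derivative `∂_j f` of a function on the torus. -/
def pd {d : ℕ} {F : Type*} [NormedAddCommGroup F] [NormedSpace ℝ F]
    (j : Fin d) (f : Torus d → F) (x : Torus d) : F :=
  deriv (fun s : ℝ => f (x + Pi.single j (s : UnitAddCircle))) 0

/-- Iterated partial derivatives `∂_{j₁} ⋯ ∂_{jₖ} f`. -/
def iterPd {d : ℕ} : List (Fin d) → (Torus d → ℝ) → Torus d → ℝ
  | [], f => f
  | j :: l, f => pd j (iterPd l f)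

/-- The gradient `∇f`. -/
def grad {d : ℕ} (f : Torus d → ℝ) (x : Torus d) : Vec d :=
  WithLp.toLp 2 (fun j => pd j f x)

/-- `φ ∈ C¹([0,T] × 𝕋ᵈ; F)`. -/
def IsC1 {d : ℕ} {F : Type*} [NormedAddCommGroup F] [NormedSpace ℝ F]
    (T : ℝ) (φ : ℝ → Torus d → F) : Prop :=
  ContDiffOn ℝ 1 (fun q : ℝ × Vec d => φ q.1 (proj q.2)) (Icc 0 T ×ˢ univ)

/-- The time derivative. -/
def dt {d : ℕ} {F : Type*} [NormedAddCommGroup F] [NormedSpace ℝ F]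
    (φ : ℝ → Torus d → F) (t : ℝ) (x : Torus d) : F :=
  deriv (fun s => φ s x) t

/-- The norm of `C¹(𝕋ᵈ)`. -/
def c1Norm {d : ℕ} (φ : Torus d → Vec d) : ℝ :=
  (⨆ x, ‖φ x‖) + ∑ j, ⨆ x, ‖pd j φ x‖

/-- The norm of `C¹([0,τ] × 𝕋ᵈ)`; the time derivative is one-sided at `0` and `τ`. -/
def c1NormST {d : ℕ} (τ : ℝ) (φ : ℝ → Torus d → Vec d) : ℝ :=
  (⨆ q : Icc 0 τ × Torus d, ‖φ q.1 q.2‖)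
    + (⨆ q : Icc 0 τ × Torus d, ‖derivWithin (fun s => φ s q.2) (Icc 0 τ) q.1‖)
    + ∑ j, ⨆ q : Icc 0 τ × Torus d, ‖pd j (φ q.1) q.2‖

/-- Lebesgue measure on `(0,T) × 𝕋ᵈ`. -/
def slab (d : ℕ) (T : ℝ) : Measure (ℝ × Torus d) :=
  volume.restrict (Ioo 0 T ×ˢ univ)

/-! ### Function spaces -/

/-- `f ∈ C¹(I; C²(𝕋ᵈ))`. As `C²(𝕋ᵈ)` carries the sup norms of all partial derivatives up to
order two, this means that each `f t` is `C²` and that `t ↦ ∂^β f(t)` is continuously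
differentiable as a curve in the Banach space `C(𝕋ᵈ)`, for every `|β| ≤ 2`. -/
def IsC1C2 {d : ℕ} (I : Set ℝ) (f : ℝ → Torus d → ℝ) : Prop :=
  (∀ t ∈ I, ContDiff ℝ 2 (lift (f t))) ∧
  ∀ β : List (Fin d), β.length ≤ 2 →
    ∃ F : ℝ → C(Torus d, ℝ), ContDiffOn ℝ 1 F I ∧ ∀ t ∈ I, ∀ x, F t x = iterPd β (f t) x

/-- `f ∈ L^∞(0,T; L^q(𝕋ᵈ))`. -/
def MemLinftyLp {d : ℕ} {F : Type*} [NormedAddCommGroup F]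
    (T : ℝ) (q : ℝ≥0∞) (f : ℝ → Torus d → F) : Prop :=
  AEStronglyMeasurable (fun p : ℝ × Torus d => f p.1 p.2) (slab d T) ∧
  ∃ C : ℝ≥0, ∀ᵐ t ∂volume.restrict (Ioo 0 T), eLpNorm (f t) q volume ≤ C

/-- `f ∈ C_weak([0,T]; L^q(𝕋ᵈ))` for a function `f` given up to null sets: `f` has a
representative that is continuous in time for the weak topology of `L^q`, `1 < q < ∞`. -/
def MemCWeak {d : ℕ} (T q : ℝ) (f : ℝ → Torus d → ℝ) : Prop :=
  ∃ g : ℝ → Torus d → ℝ,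
    (∀ᵐ t ∂volume.restrict (Ioo 0 T), g t =ᵐ[volume] f t) ∧
    (∀ t ∈ Icc 0 T, MemLp (g t) (ENNReal.ofReal q) volume) ∧
    ∀ h : Torus d → ℝ, MemLp h (ENNReal.ofReal (Real.conjExponent q)) volume →
      ContinuousOn (fun t => ∫ x, g t x * h x) (Icc 0 T)

/-- `f ∈ W^{1,2}(𝕋ᵈ)` with weak gradient `g`. -/
def HasWeakGradL2 {d : ℕ} (f : Torus d → ℝ) (g : Torus d → Vec d) : Prop :=
  MemLp f 2 volume ∧ MemLp g 2 volume ∧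
  ∀ ψ : Torus d → ℝ, ContDiff ℝ 1 (lift ψ) → ∀ j,
    ∫ x, f x * pd j ψ x = -∫ x, g x j * ψ x

/-- `f ∈ L²(0,T; W^{1,2}(𝕋ᵈ))` with weak spatial gradient `g`. -/
def HasWeakGradL2L2 {d : ℕ} (T : ℝ) (f : ℝ → Torus d → ℝ) (g : ℝ → Torus d → Vec d) : Prop :=
  MemLp (fun p : ℝ × Torus d => f p.1 p.2) 2 (slab d T) ∧
  MemLp (fun p : ℝ × Torus d => g p.1 p.2) 2 (slab d T) ∧
  ∀ᵐ t ∂volume.restrict (Ioo 0 T), HasWeakGradL2 (f t) (g t)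

/-! ### Constitutive functions -/

/-- The offset `p(ϱ) = ϱ^γ`. -/
def p (γ : ℝ) (r : ℝ) : ℝ := r ^ γ

/-- `E(ϱ) = ∫₀^ϱ p(s) ds`. -/
def E (γ : ℝ) (r : ℝ) : ℝ := ∫ s in (0 : ℝ)..r, p γ s

/-- `Q' (ϱ) = √ϱ p'(ϱ)`, normalised by `Q(0) = 0`. -/
def Q (γ : ℝ) (r : ℝ) : ℝ := ∫ s in (0 : ℝ)..r, √s * deriv (p γ) s

/-! ### Strong solutions -/

/-- The actual velocity `u = w - ∇p(ϱ)`. -/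
def vel {d : ℕ} (γ : ℝ) (ρ : ℝ → Torus d → ℝ) (w : ℝ → Torus d → Vec d)
    (t : ℝ) (x : Torus d) : Vec d :=
  w t x - grad (fun y => p γ (ρ t y)) x

/-- `(ϱ, w)` is a strong solution, with positive density, of
`∂ₜϱ + div(ϱu) = 0`, `∂ₜ(ϱw) + div(ϱu ⊗ w) = 0`, `u = w - ∇p(ϱ)`, on `(0,T) × 𝕋ᵈ`, in the
class `C¹(0,T; C²(𝕋ᵈ))` up to the initial time. -/
structure IsStrongSolution {d : ℕ} (γ T : ℝ) (ρ : ℝ → Torus d → ℝ)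
    (w : ℝ → Torus d → Vec d) : Prop where
  density_regular : IsC1C2 (Ico 0 T) ρ
  velocity_regular : ∀ i, IsC1C2 (Ico 0 T) (fun t x => w t x i)
  density_pos : ∀ t ∈ Ico 0 T, ∀ x, 0 < ρ t x
  continuity : ∀ t ∈ Ioo 0 T, ∀ x,
    dt ρ t x + ∑ j, pd j (fun y => ρ t y * vel γ ρ w t y j) x = 0
  momentum : ∀ t ∈ Ioo 0 T, ∀ x, ∀ i,
    dt (fun s y => ρ s y * w s y i) t x
      + ∑ j, pd j (fun y => ρ t y * vel γ ρ w t y j * w t y i) x = 0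

/-! ### Measure-valued solutions -/

/-- The phase space `[0,∞) × ℝᵈ × ℝᵈ` of the dummy variables `(ϱ, √ϱ w, D_Q)`. -/
abbrev Phase (d : ℕ) : Type := ℝ≥0 × Vec d × Vec d

/-- The phase space `[0,∞) × ℝᵈ` of the dummy variables `(ϱ, √ϱ w)` at the initial time. -/
abbrev Phase₀ (d : ℕ) : Type := ℝ≥0 × Vec d

/-- `⟨𝒱_{t,x}; f⟩`. -/
def avg {d : ℕ} {F : Type*} [NormedAddCommGroup F] [NormedSpace ℝ F]
    (V : Kernel (ℝ × Torus d) (Phase d)) (f : Phase d → F) (t : ℝ) (x : Torus d) : F :=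
  ∫ z, f z ∂(V (t, x))

/-- `⟨𝒱_{0,x}; f⟩`. -/
def avg₀ {d : ℕ} {F : Type*} [NormedAddCommGroup F] [NormedSpace ℝ F]
    (V₀ : Kernel (Torus d) (Phase₀ d)) (f : Phase₀ d → F) (x : Torus d) : F :=
  ∫ z, f z ∂(V₀ x)

/-- The density `ϱ = ⟨𝒱_{t,x}; ϱ⟩`. -/
def rho {d : ℕ} (V : Kernel (ℝ × Torus d) (Phase d)) : ℝ → Torus d → ℝ :=
  avg V (fun z => (z.1 : ℝ))

/-- `⟨𝒱_{t,x}; √ϱ w⟩`. -/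
def mom {d : ℕ} (V : Kernel (ℝ × Torus d) (Phase d)) : ℝ → Torus d → Vec d :=
  avg V (fun z => z.2.1)

/-- `⟨𝒱_{t,x}; D_Q⟩`. -/
def gradQ {d : ℕ} (V : Kernel (ℝ × Torus d) (Phase d)) : ℝ → Torus d → Vec d :=
  avg V (fun z => z.2.2)

/-- Integrability that gives a meaning to the energy balance:
`⟨𝒱; |√ϱ w|² ⟩`, `⟨𝒱; E(ϱ)⟩` and `⟨𝒱; |D_Q|²⟩` are finite a.e. and belong to
`L¹((0,T) × 𝕋ᵈ)`, and the initial energy is finite. -/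
structure FiniteEnergy {d : ℕ} (γ T : ℝ) (V₀ : Kernel (Torus d) (Phase₀ d))
    (V : Kernel (ℝ × Torus d) (Phase d)) : Prop where
  kinetic : Integrable (fun q : (ℝ × Torus d) × Phase d => ‖q.2.2.1‖ ^ 2) (slab d T ⊗ₘ V)
  potential : Integrable (fun q : (ℝ × Torus d) × Phase d => E γ q.2.1) (slab d T ⊗ₘ V)
  dissipation : Integrable (fun q : (ℝ × Torus d) × Phase d => ‖q.2.2.2‖ ^ 2) (slab d T ⊗ₘ V)
  initial : Integrable (fun q : Torus d × Phase₀ d => (1 / 2) * ‖q.2.2‖ ^ 2 + E γ q.2.1)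
    ((volume : Measure (Torus d)) ⊗ₘ V₀)

/-- The regularity required from a measure-valued solution. -/
structure Regularity {d : ℕ} (γ T : ℝ) (V : Kernel (ℝ × Torus d) (Phase d)) : Prop where
  density : MemCWeak T (γ + 1) (rho V)
  density_pow : ∀ α : ℝ, 0 < α → α < γ + 1 →
    (∀ᵐ q ∂slab d T, rho V q.1 q.2 ^ α = avg V (fun z => (z.1 : ℝ) ^ α) q.1 q.2) ∧
    MemCWeak T ((γ + 1) / α) (avg V (fun z => (z.1 : ℝ) ^ α))
  momentum : MemLinftyLp T 2 (mom V)
  momentum_eq : ∀ᵐ q ∂slab d T,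
    √(rho V q.1 q.2) • mom V q.1 q.2 = avg V (fun z => √(z.1 : ℝ) • z.2.1) q.1 q.2
  potential_eq : ∀ᵐ q ∂slab d T,
    Q γ (rho V q.1 q.2) = avg V (fun z => Q γ z.1) q.1 q.2
  gradient : HasWeakGradL2L2 T (fun t x => Q γ (rho V t x)) (gradQ V)

/-- The continuity equation, for a.e. `τ` and every test function. -/
def Continuity {d : ℕ} (T : ℝ) (V₀ : Kernel (Torus d) (Phase₀ d))
    (V : Kernel (ℝ × Torus d) (Phase d)) : Prop :=
  ∀ᵐ τ ∂volume.restrict (Ioo 0 T), ∀ ψ : ℝ → Torus d → ℝ, IsC1 T ψ →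
    (∫ x, rho V τ x * ψ τ x) - (∫ x, avg₀ V₀ (fun z => (z.1 : ℝ)) x * ψ 0 x)
      = ∫ t in (0 : ℝ)..τ, ∫ x,
          (rho V t x * dt ψ t x
            + √(rho V t x) * inner ℝ (mom V t x) (grad (ψ t) x)
            - √(rho V t x) * inner ℝ (gradQ V t x) (grad (ψ t) x))

/-- The pairing `⟨r; ∇φ⟩` of a matrix-valued measure with `∇φ` over `[0,τ] × 𝕋ᵈ`. -/
def defectPairing {d : ℕ} (r : Fin d → Fin d → SignedMeasure (ℝ × Torus d))
    (τ : ℝ) (φ : ℝ → Torus d → Vec d) : ℝ :=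
  ∑ i, ∑ j, ∫ᵛ q in (Icc 0 τ ×ˢ univ : Set (ℝ × Torus d)), (pd j (φ q.1) q.2) i ∂•(r i j)

/-- The momentum equation with its defect `r`, a matrix-valued measure on `[0,T] × 𝕋ᵈ`
(the space `L^∞_{weak-*}(0,T; ℳ(𝕋ᵈ))` embeds into the space of such measures, and only the
restriction of `r` to `[0,T] × 𝕋ᵈ` is used). -/
def Momentum {d : ℕ} (T : ℝ) (V₀ : Kernel (Torus d) (Phase₀ d))
    (V : Kernel (ℝ × Torus d) (Phase d)) (D : ℝ → ℝ) : Prop :=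
  ∃ (r : Fin d → Fin d → SignedMeasure (ℝ × Torus d)) (ξ : ℝ → ℝ),
    IntegrableOn ξ (Ioo 0 T) ∧
    ∀ᵐ τ ∂volume.restrict (Ioo 0 T), ∀ φ : ℝ → Torus d → Vec d, IsC1 T φ →
      (∀ ε : ℝ, 0 < ε →
        |defectPairing r τ φ| ≤
          (1 + 1 / (4 * ε)) * (∫ t in (0 : ℝ)..τ, ξ t * D t * c1Norm (φ t))
            + ε * c1NormST τ φ * D τ) ∧
      (∫ x, √(rho V τ x) * inner ℝ (mom V τ x) (φ τ x))
          - (∫ x, inner ℝ (avg₀ V₀ (fun z => √(z.1 : ℝ) • z.2) x) (φ 0 x))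
        = (∫ t in (0 : ℝ)..τ, ∫ x,
            (√(rho V t x) * inner ℝ (mom V t x) (dt φ t x)
              + (∑ i, ∑ j, avg V (fun z => z.2.1 i * z.2.1 j) t x * (pd j (φ t) x) i)
              - (∑ i, ∑ j, avg V (fun z => z.2.1 i * z.2.2 j) t x * (pd j (φ t) x) i)))
          + defectPairing r τ φ

/-- The energy inequality with its defect `R`, a measure on `[0,T] × 𝕋ᵈ`. -/
def EnergyInequality {d : ℕ} (γ T : ℝ) (V₀ : Kernel (Torus d) (Phase₀ d))
    (V : Kernel (ℝ × Torus d) (Phase d)) (D : ℝ → ℝ) : Prop :=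
  ∃ (R : SignedMeasure (ℝ × Torus d)) (C : ℝ), 0 < C ∧
    ∀ᵐ τ ∂volume.restrict (Ioo 0 T),
      (∀ ε : ℝ, 0 < ε →
        |R (Ioo 0 τ ×ˢ univ)| ≤
          C * (1 + 1 / (4 * ε)) * (∫ t in (0 : ℝ)..τ, D t) + ε * D τ) ∧
      (∫ x, avg V (fun z => (1 / 2) * ‖z.2.1‖ ^ 2 + E γ z.1) τ x)
          + (∫ t in (0 : ℝ)..τ, ∫ x, avg V (fun z => ‖z.2.2‖ ^ 2) t x) + D τ
        ≤ (∫ x, avg₀ V₀ (fun z => (1 / 2) * ‖z.2‖ ^ 2 + E γ z.1) x)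
          + (∫ t in (0 : ℝ)..τ, ∫ x, avg V (fun z => inner ℝ z.2.1 z.2.2) t x)
          + R (Ioo 0 τ ×ˢ univ)

/-- `(𝒱, 𝒟)` is a measure-valued solution with initial datum `𝒱₀`. A weakly-* measurable family
of probability measures is, up to modification on a null set, a Markov kernel. -/
structure IsMeasureValuedSolution {d : ℕ} (γ T : ℝ) (V₀ : Kernel (Torus d) (Phase₀ d))
    (V : Kernel (ℝ × Torus d) (Phase d)) (D : ℝ → ℝ) : Prop where
  markov_initial : IsMarkovKernel V₀
  markov : IsMarkovKernel V
  defect_bounded : MemLp D ∞ (volume.restrict (Ioo 0 T))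
  defect_nonneg : ∀ᵐ t ∂volume.restrict (Ioo 0 T), 0 ≤ D t
  finite_energy : FiniteEnergy γ T V₀ V
  regularity : Regularity γ T V
  continuity : Continuity T V₀ V
  momentum : Momentum T V₀ V D
  energy : EnergyInequality γ T V₀ V D

end AwRascle

end

noncomputable section

namespace AwRascle

/-! ### Partial derivatives on the torus and derivatives of the periodic lift. -/

section TorusCalculus

variable {d : ℕ} {F : Type*} [NormedAddCommGroup F] [NormedSpace ℝ F]

/-! The proof is a relative energy argument. For a state (r, z, q) and the strong solution (ϱ̄, w̄),
the density is ½|z - √r w̄|² + E(r | ϱ̄), where E(r | s) = E(r) - E(s) - p(s)(r - s) is non-negative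
and vanishes only for r = s. Expanding it leaves the energy, terms linear in √r z and in r, and a
function of ϱ̄ (`relEnergy_eq`). Its evolution is therefore controlled by the energy inequality, the
momentum equation tested with w̄ and the continuity equation tested with ½|w̄|² - p(ϱ̄).

Two facts make these balances usable. First, the power identity at exponent ½ forces the variance of
√r to vanish, so the density is deterministic (`density_concentrated`) and √r can be moved in and
out of averages. Second, since Q' = √r p' and r p' = γ p, one has √ϱ ∇Q(ϱ) = ∇(γ E(ϱ)). For the weak
solution this is a product of two L² functions, proved by differentiating translations in L²
(`integral_chain_rule`, `tot_gradQ_inner`).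

With Z = z - √r w̄, Y = q - √r ∇p(ϱ̄) and ū = w̄ - ∇p(ϱ̄), the equations of the strong solution
reduce the sum of all integrands to terms quadratic in (Z, Y), a multiple of E(r | ϱ̄) div ū, and
two expressions with zero mean on the torus (`Background.integrand_eq`, `Background.tot_remainder`).
The dissipation -|Y|² absorbs the products of Z and Y, and half of it is kept (`fluctuation_bound`).
The free parameter ε lets the defects at the final time be absorbed in half of 𝒟(τ). What remains is
a Grönwall inequality with zero initial value and an integrable kernel, since ξ is only in L¹
(`ae_eq_zero_of_le_integral`). Hence 𝒟, the relative energy and Y vanish, which fixes all three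
phase variables, with q = √ϱ̄ ∇p(ϱ̄) = ∇Q(ϱ̄).

The strong solution is regular only on [0, T), while test functions must be C¹ on [0, T]. It is
therefore composed with a smooth truncation of time, the argument is run on shorter intervals, and
these exhaust (0, T). -/

theorem isOpenQuotientMap_proj : IsOpenQuotientMap (proj : Vec d → Torus d) := by
  have h := IsOpenQuotientMap.piMap (ι := Fin d) (A := fun _ => ℝ) (B := fun _ => UnitAddCircle)
    (f := fun _ => QuotientAddGroup.mk) (fun _ => QuotientAddGroup.isOpenQuotientMap_mk)
  exact h.comp (EuclideanSpace.equiv (Fin d) ℝ).toHomeomorph.isOpenQuotientMap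

theorem proj_add_smul (y : Vec d) (s : ℝ) (j : Fin d) :
    proj (y + s • EuclideanSpace.single j (1 : ℝ)) = proj y + Pi.single j (s : UnitAddCircle) := by
  funext i
  by_cases h : i = j
  · subst h; simp [proj]
  · simp [proj, h]

theorem hasDerivAt_line (j : Fin d) {f : Torus d → F} {y : Vec d} {s : ℝ}
    (h : DifferentiableAt ℝ (lift f) (y + s • EuclideanSpace.single j (1 : ℝ))) :
    HasDerivAt (fun s : ℝ => f (proj y + Pi.single j (s : UnitAddCircle)))
      (fderiv ℝ (lift f) (y + s • EuclideanSpace.single j (1 : ℝ))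
        (EuclideanSpace.single j (1 : ℝ))) s := by
  have h1 : HasDerivAt (fun s : ℝ => y + s • EuclideanSpace.single j (1 : ℝ))
      (EuclideanSpace.single j (1 : ℝ)) s := by
    simpa using ((hasDerivAt_id s).smul_const (EuclideanSpace.single j (1 : ℝ))).const_add y
  have := h.hasFDerivAt.comp_hasDerivAt s h1
  refine this.congr_of_eventuallyEq (Eventually.of_forall fun s => ?_)
  simp [lift, proj_add_smul]

/-- Bridge between the two calculi: a step along a coordinate circle of the torus is a step along a
line upstairs. Differentiation is written on the torus, smoothness is imposed on the lift. -/
theorem pd_proj {f : Torus d → F} (j : Fin d) (y : Vec d) (h : DifferentiableAt ℝ (lift f) y) :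
    pd j f (proj y) = fderiv ℝ (lift f) y (EuclideanSpace.single j (1 : ℝ)) := by
  have := hasDerivAt_line (s := 0) (y := y) (f := f) j (by simpa using h)
  simpa [pd] using this.deriv

theorem hasDerivAt_shift {f : Torus d → F} (hf : ContDiff ℝ 1 (lift f)) (j : Fin d)
    (x : Torus d) (s : ℝ) :
    HasDerivAt (fun s : ℝ => f (x + Pi.single j (s : UnitAddCircle)))
      (pd j f (x + Pi.single j (s : UnitAddCircle))) s := by
  obtain ⟨y, rfl⟩ := isOpenQuotientMap_proj.surjective x
  rw [← proj_add_smul, pd_proj _ _ (hf.differentiable one_ne_zero _)]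
  exact hasDerivAt_line j (hf.differentiable one_ne_zero _)

/-- The partial derivative `∂_j f` exists at `x` and equals `f'`. -/
def HasPd (j : Fin d) (f : Torus d → F) (f' : F) (x : Torus d) : Prop :=
  HasDerivAt (fun s : ℝ => f (x + Pi.single j (s : UnitAddCircle))) f' 0

theorem HasPd.pd_eq {j : Fin d} {f : Torus d → F} {f' : F} {x : Torus d} (h : HasPd j f f' x) :
    pd j f x = f' := HasDerivAt.deriv h

theorem hasPd {f : Torus d → F} (hf : ContDiff ℝ 1 (lift f)) (j : Fin d) (x : Torus d) :
    HasPd j f (pd j f x) x := by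
  simpa [HasPd] using hasDerivAt_shift hf j x 0

theorem HasPd.sub {j : Fin d} {f g : Torus d → F} {f' g' : F} {x : Torus d}
    (hf : HasPd j f f' x) (hg : HasPd j g g' x) : HasPd j (fun y => f y - g y) (f' - g') x :=
  HasDerivAt.sub hf hg

theorem HasPd.mul {j : Fin d} {f g : Torus d → ℝ} {f' g' : ℝ} {x : Torus d}
    (hf : HasPd j f f' x) (hg : HasPd j g g' x) :
    HasPd j (fun y => f y * g y) (f' * g x + f x * g') x := by
  simpa [HasPd] using HasDerivAt.fun_mul hf hg

theorem HasPd.scomp {j : Fin d} {f : Torus d → ℝ} {f' : ℝ} {x : Torus d} {g : ℝ → F} {g' : F}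
    (hg : HasDerivAt g g' (f x)) (hf : HasPd j f f' x) :
    HasPd j (fun y => g (f y)) (f' • g') x := by
  have : HasDerivAt g g' ((fun s : ℝ => f (x + Pi.single j (s : UnitAddCircle))) 0) := by
    simpa using hg
  exact HasDerivAt.scomp 0 this hf

theorem HasPd.apply {j : Fin d} {f : Torus d → Vec d} {f' : Vec d} {x : Torus d}
    (hf : HasPd j f f' x) (i : Fin d) : HasPd j (fun y => f y i) (f' i) x :=
  (EuclideanSpace.proj (𝕜 := ℝ) i).hasFDerivAt.comp_hasDerivAt (0 : ℝ) hf

theorem contDiff_pd {n : WithTop ℕ∞} {f : Torus d → F} (hf : ContDiff ℝ (n + 1) (lift f))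
    (j : Fin d) : ContDiff ℝ n (lift (pd j f)) := by
  have h : lift (pd j f) = fun y => fderiv ℝ (lift f) y (EuclideanSpace.single j (1 : ℝ)) := by
    funext y
    exact pd_proj j y (hf.differentiable (by simp) y)
  rw [h]
  exact (hf.fderiv_right le_rfl).clm_apply contDiff_const

theorem continuous_of_lift {X : Type*} [TopologicalSpace X] {f : Torus d → X} (hf : Continuous (lift f)) : Continuous f :=
  (isOpenQuotientMap_proj (d := d)).isQuotientMap.continuous_iff.2 hf

theorem continuous_pd {f : Torus d → F} (hf : ContDiff ℝ 1 (lift f)) (j : Fin d) :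
    Continuous (pd j f) :=
  continuous_of_lift (contDiff_pd (n := 0) (by simpa using hf) j).continuous

theorem contDiff_lift_comp_add {n : WithTop ℕ∞} {f : Torus d → F} (hf : ContDiff ℝ n (lift f))
    (a : Torus d) : ContDiff ℝ n (lift fun x => f (x + a)) := by
  obtain ⟨b, rfl⟩ := isOpenQuotientMap_proj.surjective a
  have : (lift fun x => f (x + proj b)) = fun y => lift f (y + b) := by
    funext y
    simp only [lift]
    congr 1
  rw [this]
  exact hf.comp (contDiff_id.add contDiff_const)

theorem pd_comp_add (f : Torus d → F) (a : Torus d) (j : Fin d) (x : Torus d) :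
    pd j (fun x => f (x + a)) x = pd j f (x + a) := by
  simp only [pd, add_right_comm]

end TorusCalculus

/-! ### Continuity and bounds for C¹ fields on space-time. -/

section SpaceTime

variable {d : ℕ} {F : Type*} [NormedAddCommGroup F] [NormedSpace ℝ F]

theorem isOpenQuotientMap_id_proj :
    IsOpenQuotientMap (Prod.map id proj : ℝ × Vec d → ℝ × Torus d) :=
  IsOpenQuotientMap.prodMap IsOpenQuotientMap.id isOpenQuotientMap_proj

/-- Continuity at a point descends along an open quotient map; openness of `s` turns continuity
within the set into continuity at its points. -/
theorem continuousOn_of_lift {X : Type*} [TopologicalSpace X] {s : Set ℝ} (hs : IsOpen s)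
    {f : ℝ × Torus d → X}
    (hf : ContinuousOn (fun q : ℝ × Vec d => f (q.1, proj q.2)) (s ×ˢ univ)) :
    ContinuousOn f (s ×ˢ univ) := by
  rintro ⟨t, x⟩ ⟨ht, -⟩
  obtain ⟨y, rfl⟩ := isOpenQuotientMap_proj.surjective x
  have h1 : ContinuousAt (fun q : ℝ × Vec d => f (q.1, proj q.2)) (t, y) :=
    hf.continuousAt ((hs.prod isOpen_univ).mem_nhds ⟨ht, mem_univ _⟩)
  exact (isOpenQuotientMap_id_proj.continuousAt_comp_iff (g := f) (x := (t, y))).1 h1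
    |>.continuousWithinAt

theorem uniqueDiffOn_slab {T : ℝ} (hT : 0 < T) :
    UniqueDiffOn ℝ (Icc 0 T ×ˢ (univ : Set (Vec d))) :=
  (uniqueDiffOn_Icc hT).prod uniqueDiffOn_univ

variable {T : ℝ} {φ : ℝ → Torus d → F}

theorem IsC1.hasFDerivWithinAt (hφ : IsC1 T φ) {t : ℝ} (ht : t ∈ Icc 0 T) (y : Vec d) :
    HasFDerivWithinAt (fun q : ℝ × Vec d => φ q.1 (proj q.2))
      (fderivWithin ℝ (fun q : ℝ × Vec d => φ q.1 (proj q.2)) (Icc 0 T ×ˢ univ) (t, y))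
      (Icc 0 T ×ˢ univ) (t, y) :=
  (hφ.differentiableOn one_ne_zero (t, y) ⟨ht, mem_univ _⟩).hasFDerivWithinAt

theorem IsC1.contDiff_lift (hφ : IsC1 T φ) {t : ℝ} (ht : t ∈ Icc 0 T) :
    ContDiff ℝ 1 (lift (φ t)) := by
  rw [← contDiffOn_univ]
  exact ContDiffOn.comp hφ (g := fun q : ℝ × Vec d => φ q.1 (proj q.2)) (f := fun y => (t, y))
    (contDiff_const.prodMk contDiff_id).contDiffOn (fun y _ => ⟨ht, mem_univ _⟩)

/-- Slice derivatives are read off a single joint derivative, so they inherit its joint continuity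
and its bounds. -/
theorem IsC1.pd_eq (hφ : IsC1 T φ) {t : ℝ} (ht : t ∈ Icc 0 T) (j : Fin d) (y : Vec d) :
    pd j (φ t) (proj y) =
      fderivWithin ℝ (fun q : ℝ × Vec d => φ q.1 (proj q.2)) (Icc 0 T ×ˢ univ) (t, y)
        (0, EuclideanSpace.single j (1 : ℝ)) := by
  have hd := (hφ.contDiff_lift ht).differentiable one_ne_zero y
  rw [pd_proj j y hd]
  have h1 : HasFDerivWithinAt (fun y : Vec d => (t, y)) (ContinuousLinearMap.inr ℝ ℝ (Vec d))
      univ y := (hasFDerivAt_prodMk_right t y).hasFDerivWithinAt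
  have hm : MapsTo (fun y : Vec d => (t, y)) univ (Icc 0 T ×ˢ univ) :=
    fun y _ => ⟨ht, mem_univ _⟩
  have h2 := (hφ.hasFDerivWithinAt ht y).comp y h1 hm
  rw [hasFDerivWithinAt_univ] at h2
  have h3 := h2.unique (f := lift (φ t)) hd.hasFDerivAt
  rw [← h3]
  simp

theorem IsC1.hasDerivWithinAt (hφ : IsC1 T φ) {t : ℝ} (ht : t ∈ Icc 0 T) (y : Vec d) :
    HasDerivWithinAt (fun s => φ s (proj y))
      (fderivWithin ℝ (fun q : ℝ × Vec d => φ q.1 (proj q.2)) (Icc 0 T ×ˢ univ) (t, y)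
        (1, 0)) (Icc 0 T) t := by
  have h1 : HasDerivWithinAt (fun s : ℝ => (s, y)) (1, 0) (Icc 0 T) t :=
    ((hasDerivAt_id t).prodMk (hasDerivAt_const t y)).hasDerivWithinAt
  have hm : MapsTo (fun s : ℝ => (s, y)) (Icc 0 T) (Icc 0 T ×ˢ univ) :=
    fun s hs => ⟨hs, mem_univ _⟩
  exact (hφ.hasFDerivWithinAt ht y).comp_hasDerivWithinAt t h1 hm

theorem IsC1.hasDerivAt (hφ : IsC1 T φ) {t : ℝ} (ht : t ∈ Ioo 0 T) (x : Torus d) :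
    HasDerivAt (fun s => φ s x) (dt φ t x) t := by
  obtain ⟨y, rfl⟩ := isOpenQuotientMap_proj.surjective x
  have := (hφ.hasDerivWithinAt (Ioo_subset_Icc_self ht) y).hasDerivAt (Icc_mem_nhds ht.1 ht.2)
  exact this.differentiableAt.hasDerivAt

theorem IsC1.dt_eq (hφ : IsC1 T φ) {t : ℝ} (ht : t ∈ Ioo 0 T) (y : Vec d) :
    dt φ t (proj y) =
      fderivWithin ℝ (fun q : ℝ × Vec d => φ q.1 (proj q.2)) (Icc 0 T ×ˢ univ) (t, y)
        (1, 0) :=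
  ((hφ.hasDerivWithinAt (Ioo_subset_Icc_self ht) y).hasDerivAt (Icc_mem_nhds ht.1 ht.2)).deriv

theorem IsC1.continuousOn_fderivWithin (hT : 0 < T) (hφ : IsC1 T φ) :
    ContinuousOn (fderivWithin ℝ (fun q : ℝ × Vec d => φ q.1 (proj q.2)) (Icc 0 T ×ˢ univ))
      (Icc 0 T ×ˢ univ) :=
  ContDiffOn.continuousOn_fderivWithin hφ (uniqueDiffOn_slab hT) le_rfl

theorem IsC1.continuousOn (hφ : IsC1 T φ) :
    ContinuousOn (fun q : ℝ × Torus d => φ q.1 q.2) (Ioo 0 T ×ˢ univ) :=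
  continuousOn_of_lift isOpen_Ioo ((ContDiffOn.continuousOn hφ).mono
    (prod_mono Ioo_subset_Icc_self subset_rfl))

theorem IsC1.continuousOn_pd (hT : 0 < T) (hφ : IsC1 T φ) (j : Fin d) :
    ContinuousOn (fun q : ℝ × Torus d => pd j (φ q.1) q.2) (Ioo 0 T ×ˢ univ) := by
  refine continuousOn_of_lift isOpen_Ioo ?_
  refine (((hφ.continuousOn_fderivWithin hT).mono
    (prod_mono Ioo_subset_Icc_self subset_rfl)).clm_apply continuousOn_const).congr
    (fun q hq => hφ.pd_eq (Ioo_subset_Icc_self hq.1) j q.2)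

theorem IsC1.continuousOn_dt (hT : 0 < T) (hφ : IsC1 T φ) :
    ContinuousOn (fun q : ℝ × Torus d => dt φ q.1 q.2) (Ioo 0 T ×ˢ univ) := by
  refine continuousOn_of_lift isOpen_Ioo ?_
  refine (((hφ.continuousOn_fderivWithin hT).mono
    (prod_mono Ioo_subset_Icc_self subset_rfl)).clm_apply continuousOn_const).congr
    (fun q hq => hφ.dt_eq hq.1 q.2)

/-- The closed unit cube provides a compact set upstairs that covers the torus. -/
theorem exists_mem_cube (x : Torus d) :
    ∃ y ∈ (WithLp.toLp 2 '' (Icc 0 1 : Set (Fin d → ℝ)) : Set (Vec d)), proj y = x := by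
  have h : ∀ i, x i ∈ ((↑) '' Icc (0 : ℝ) (0 + 1) : Set UnitAddCircle) := fun i =>
    (AddCircle.coe_image_Icc_eq (1 : ℝ) 0).symm ▸ mem_univ (x i)
  choose z hz using h
  refine ⟨WithLp.toLp 2 z, ⟨z, ⟨fun i => (hz i).1.1, fun i => ?_⟩, rfl⟩, ?_⟩
  · simpa using (hz i).1.2
  · funext i
    exact (hz i).2

/-- A continuous function on `[0,T] × ℝᵈ` that descends to the torus is bounded. -/
theorem exists_bound_of_continuousOn {G : Type*} [NormedAddCommGroup G] {f : ℝ × Vec d → G}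
    (hf : ContinuousOn f (Icc 0 T ×ˢ univ)) :
    ∃ M : ℝ, 0 ≤ M ∧ ∀ t ∈ Icc 0 T, ∀ x : Torus d, ∃ y, proj y = x ∧ ‖f (t, y)‖ ≤ M := by
  have hK : IsCompact (Icc 0 T ×ˢ (WithLp.toLp 2 '' (Icc 0 1 : Set (Fin d → ℝ)) : Set (Vec d))) :=
    isCompact_Icc.prod (isCompact_Icc.image (PiLp.continuous_toLp 2 _))
  obtain ⟨M, hM⟩ := hK.exists_bound_of_continuousOn (hf.mono (prod_mono subset_rfl (subset_univ _)))
  refine ⟨max M 0, le_max_right _ _, fun t ht x => ?_⟩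
  obtain ⟨y, hy, rfl⟩ := exists_mem_cube x
  exact ⟨y, rfl, (hM (t, y) ⟨ht, hy⟩).trans (le_max_left _ _)⟩

/-- All bounds come from the field and its joint derivative on a compact set. The time derivative
`dt` is two-sided, hence restricted to interior times; the last clause has the one-sided derivative
that enters `c1NormST`. -/
theorem IsC1.exists_bound (hT : 0 < T) (hφ : IsC1 T φ) :
    ∃ M : ℝ, 0 ≤ M ∧ (∀ t ∈ Icc 0 T, ∀ x, ‖φ t x‖ ≤ M) ∧
      (∀ t ∈ Icc 0 T, ∀ x j, ‖pd j (φ t) x‖ ≤ M) ∧ (∀ t ∈ Ioo 0 T, ∀ x, ‖dt φ t x‖ ≤ M) ∧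
      (∀ τ, 0 < τ → τ ≤ T → ∀ t ∈ Icc 0 τ, ∀ x,
        ‖derivWithin (fun s => φ s x) (Icc 0 τ) t‖ ≤ M) := by
  obtain ⟨M₀, h0, h1⟩ := exists_bound_of_continuousOn (ContDiffOn.continuousOn hφ)
  obtain ⟨M₁, h2, h3⟩ := exists_bound_of_continuousOn (hφ.continuousOn_fderivWithin hT)
  refine ⟨max M₀ M₁, le_max_of_le_left h0, fun t ht x => ?_, fun t ht x j => ?_,
    fun t ht x => ?_, fun τ hτ hτT t ht x => ?_⟩
  · obtain ⟨y, rfl, hy⟩ := h1 t ht x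
    exact hy.trans (le_max_left _ _)
  · obtain ⟨y, rfl, hy⟩ := h3 t ht x
    rw [hφ.pd_eq ht]
    refine (ContinuousLinearMap.le_opNorm _ _).trans ?_
    simpa [Prod.norm_def] using hy.trans (le_max_right _ _)
  · obtain ⟨y, rfl, hy⟩ := h3 t (Ioo_subset_Icc_self ht) x
    rw [hφ.dt_eq ht]
    refine (ContinuousLinearMap.le_opNorm _ _).trans ?_
    simpa [Prod.norm_def] using hy.trans (le_max_right _ _)
  · have ht' : t ∈ Icc 0 T := ⟨ht.1, ht.2.trans hτT⟩
    obtain ⟨y, rfl, hy⟩ := h3 t ht' x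
    rw [((hφ.hasDerivWithinAt ht' y).mono (Icc_subset_Icc_right hτT)).derivWithin
      (uniqueDiffOn_Icc hτ t ht)]
    refine (ContinuousLinearMap.le_opNorm _ _).trans ?_
    simpa [Prod.norm_def] using hy.trans (le_max_right _ _)

end SpaceTime

/-! ### Translations, weak derivatives and the chain rule in L² of the torus. -/

section TorusIntegration

variable {d : ℕ}

/-- The point of the torus at signed distance `s` from `0` on the `j`-th axis. -/
def axis (j : Fin d) (s : ℝ) : Torus d := Pi.single j (s : UnitAddCircle)

theorem axis_neg (j : Fin d) (s : ℝ) : axis j (-s) = -axis j s := by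
  simp [axis, Pi.single_neg]

theorem axis_zero (j : Fin d) : axis j 0 = 0 := by simp [axis]

theorem continuous_axis (j : Fin d) : Continuous (axis j : ℝ → Torus d) :=
  (continuous_single j).comp (AddCircle.continuous_mk' 1)

theorem exists_bound_of_continuous {f : Torus d → ℝ} (hf : Continuous f) :
    ∃ C, 0 ≤ C ∧ ∀ x, ‖f x‖ ≤ C := by
  obtain ⟨C, hC⟩ := isCompact_univ.exists_bound_of_continuousOn hf.continuousOn
  exact ⟨max C 0, le_max_right _ _, fun x => (hC x (mem_univ x)).trans (le_max_left _ _)⟩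

theorem memLp_of_continuous {f : Torus d → ℝ} (hf : Continuous f) (p : ℝ≥0∞) :
    MemLp f p volume := by
  obtain ⟨C, -, hC⟩ := exists_bound_of_continuous hf
  exact MemLp.of_bound hf.aestronglyMeasurable C (Eventually.of_forall hC)

theorem integrable_mul_of_continuous {F u : Torus d → ℝ} (hF : Integrable F)
    (hu : Continuous u) : Integrable fun x => F x * u x := by
  obtain ⟨C, -, hC⟩ := exists_bound_of_continuous hu
  exact hF.mul_bdd hu.aestronglyMeasurable (Eventually.of_forall hC)

/-- The derivative falls on `u` alone, so integrability of `F` suffices; the dominating function is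
|F| times the supremum of |∂_j u|. -/
theorem hasDerivAt_integral_mul_shift {F u : Torus d → ℝ} (hF : Integrable F)
    (hu : ContDiff ℝ 1 (lift u)) (j : Fin d) (s : ℝ) :
    HasDerivAt (fun s => ∫ x, F x * u (x + axis j s)) (∫ x, F x * pd j u (x + axis j s)) s := by
  have hc : Continuous u := continuous_of_lift hu.continuous
  obtain ⟨C, -, hC⟩ := exists_bound_of_continuous (continuous_pd hu j)
  refine (hasDerivAt_integral_of_dominated_loc_of_deriv_le (𝕜 := ℝ) (bound := fun x => ‖F x‖ * C)
    (F' := fun s x => F x * pd j u (x + axis j s)) (s := univ) univ_mem ?_ ?_ ?_ ?_ ?_ ?_).2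
  · exact Eventually.of_forall fun s => (integrable_mul_of_continuous hF
      (hc.comp (continuous_id.add continuous_const))).aestronglyMeasurable
  · exact integrable_mul_of_continuous hF (hc.comp (continuous_id.add continuous_const))
  · exact (integrable_mul_of_continuous hF
      ((continuous_pd hu j).comp (continuous_id.add continuous_const))).aestronglyMeasurable
  · refine Eventually.of_forall fun x s _ => ?_
    rw [norm_mul]
    exact mul_le_mul_of_nonneg_left (hC _) (norm_nonneg _)
  · exact hF.norm.mul_const C
  · exact Eventually.of_forall fun x s _ => (hasDerivAt_shift hu j x s).const_mul (F x)

theorem integral_shift_mul (F u : Torus d → ℝ) (j : Fin d) (s : ℝ) :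
    ∫ x, F (axis j s + x) * u x = ∫ x, F x * u (x + axis j (-s)) := by
  rw [← integral_add_left_eq_self (fun x => F x * u (x + axis j (-s))) (axis j s)]
  simp [axis_neg]

/-- Haar invariance moves the translation from the rough factor to the smooth one, with the opposite
sign. -/
theorem hasDerivAt_integral_shift_mul {F u : Torus d → ℝ} (hF : Integrable F)
    (hu : ContDiff ℝ 1 (lift u)) (j : Fin d) (s : ℝ) :
    HasDerivAt (fun s => ∫ x, F (axis j s + x) * u x)
      (-∫ x, F x * pd j u (x + axis j (-s))) s := by
  simp only [integral_shift_mul]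
  have := (hasDerivAt_integral_mul_shift hF hu j (-s)).scomp s (hasDerivAt_neg s)
  simpa [Function.comp_def] using this

/-- By Haar invariance the mean of the translated function is constant in `s`, and its derivative at
0 is the mean of ∂_j u. -/
theorem integral_pd {u : Torus d → ℝ} (hu : ContDiff ℝ 1 (lift u)) (j : Fin d) :
    ∫ x, pd j u x = 0 := by
  have h := hasDerivAt_integral_mul_shift (F := fun _ : Torus d => (1 : ℝ))
    (integrable_const _) hu j 0
  have h1 : (fun s => ∫ x, (1 : ℝ) * u (x + axis j s)) = fun _ => ∫ x, u x := by
    funext s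
    simp only [one_mul]
    exact integral_add_right_eq_self u (axis j s)
  rw [h1] at h
  simpa [axis_zero] using h.unique (hasDerivAt_const _ _)

theorem contDiff_lift_mFourier (n : Fin d → ℤ) :
    ContDiff ℝ 1 (lift fun x => UnitAddTorus.mFourier n x) := by
  have : (lift fun x => UnitAddTorus.mFourier n x) = fun y : Vec d =>
      ∏ i, Complex.exp (2 * Real.pi * Complex.I * n i * (y i : ℝ) / (1 : ℝ)) := by
    funext y
    simp only [lift, UnitAddTorus.mFourier, proj, ContinuousMap.coe_mk, fourier_coe_apply]
  rw [this]
  refine contDiff_prod fun i _ => ContDiff.cexp ?_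
  refine (ContDiff.mul contDiff_const ?_).div_const _
  exact Complex.ofRealCLM.contDiff.comp (EuclideanSpace.proj (𝕜 := ℝ) i).contDiff

/-- Trigonometric polynomials are smooth and uniformly dense; the real part of a complex approximant
is at least as close to a real function. -/
theorem exists_contDiff_near (f : C(Torus d, ℝ)) {ε : ℝ} (hε : 0 < ε) :
    ∃ ψ : C(Torus d, ℝ), ContDiff ℝ 1 (lift ψ) ∧ ‖f - ψ‖ < ε := by
  let fc : C(Torus d, ℂ) := ⟨fun x => (f x : ℂ), by fun_prop⟩
  have h : fc ∈ (Submodule.span ℂ (range (UnitAddTorus.mFourier (d := Fin d)))).topologicalClosure := by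
    rw [UnitAddTorus.span_mFourier_closure_eq_top]; trivial
  obtain ⟨g, hg, hgf⟩ := Metric.mem_closure_iff.1 h ε hε
  have hgs : ContDiff ℝ 1 (lift g) := by
    refine Submodule.span_induction (s := range (UnitAddTorus.mFourier (d := Fin d)))
      (p := fun (g : C(Torus d, ℂ)) _ => ContDiff ℝ 1 (lift g)) ?_ ?_ ?_ ?_ hg
    · rintro _ ⟨n, rfl⟩
      exact contDiff_lift_mFourier n
    · exact contDiff_const (c := (0 : ℂ))
    · intro a b _ _ ha hb
      exact ha.add hb
    · intro c a _ ha
      exact contDiff_const.mul ha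
  refine ⟨⟨fun x => (g x).re, by fun_prop⟩, Complex.reCLM.contDiff.comp hgs, ?_⟩
  rw [ContinuousMap.norm_lt_iff _ hε]
  intro x
  have h1 : ‖(fc x - g x).re‖ ≤ ‖fc x - g x‖ := Complex.abs_re_le_norm _
  have h2 : dist (fc x) (g x) < ε := (ContinuousMap.dist_apply_le_dist x).trans_lt hgf
  rw [dist_eq_norm] at h2
  simpa [fc] using h1.trans_lt h2

theorem dense_contDiff :
    Dense {v : Lp ℝ 2 (volume : Measure (Torus d)) |
      ∃ (ψ : Torus d → ℝ) (hψ : ContDiff ℝ 1 (lift ψ)),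
        v = (memLp_of_continuous (continuous_of_lift hψ.continuous) 2).toLp ψ} := by
  have hd := ContinuousMap.toLp_denseRange ℝ (volume : Measure (Torus d)) (p := 2) ℝ (by simp)
  have h2 : Dense {ψ : C(Torus d, ℝ) | ContDiff ℝ 1 (lift ψ)} := by
    intro f
    rw [Metric.mem_closure_iff]
    intro ε hε
    obtain ⟨ψ, h1, h2⟩ := exists_contDiff_near f hε
    exact ⟨ψ, h1, by rwa [dist_eq_norm]⟩
  refine (hd.dense_image (ContinuousLinearMap.continuous _) h2).mono ?_
  rintro _ ⟨ψ, hψ, rfl⟩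
  exact ⟨ψ, hψ, rfl⟩

/-- Translation of `f ∈ L²(𝕋ᵈ)` by `s` along the `j`-th axis. -/
def trans (j : Fin d) (s : ℝ) (f : Lp ℝ 2 (volume : Measure (Torus d))) :
    Lp ℝ 2 (volume : Measure (Torus d)) :=
  Lp.compMeasurePreserving (fun x => axis j s + x)
    (measurePreserving_add_left (volume : Measure (Torus d)) (axis j s)) f

theorem trans_toLp (j : Fin d) (s : ℝ) {f : Torus d → ℝ} (hf : MemLp f 2 volume) :
    trans j s (hf.toLp f) =ᵐ[volume] fun x => f (axis j s + x) := by
  rw [trans, Lp.toLp_compMeasurePreserving]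
  exact MemLp.coeFn_toLp _

theorem trans_zero (j : Fin d) (f : Lp ℝ 2 (volume : Measure (Torus d))) : trans j 0 f = f := by
  refine Lp.ext ((Lp.coeFn_compMeasurePreserving f _).trans (Eventually.of_forall fun x => ?_))
  simp [axis_zero]

theorem tendsto_trans (j : Fin d) (f : Lp ℝ 2 (volume : Measure (Torus d))) :
    Tendsto (fun s => trans j s f) (𝓝 0) (𝓝 f) := by
  let m : C(ℝ × Torus d, Torus d) :=
    ⟨fun q => axis j q.1 + q.2, ((continuous_axis j).comp continuous_fst).add continuous_snd⟩
  have hc : Continuous fun s : ℝ => trans j s f :=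
    Continuous.compMeasurePreservingLp continuous_const m.curry.continuous
      (fun s => measurePreserving_add_left (volume : Measure (Torus d)) (axis j s)) (by simp)
  simpa [trans_zero] using hc.tendsto 0

theorem inner_toLp {f g : Torus d → ℝ} (hf : MemLp f 2 volume) (hg : MemLp g 2 volume) :
    inner ℝ (hf.toLp f) (hg.toLp g) = ∫ x, f x * g x := by
  rw [L2.inner_def]
  refine integral_congr_ae ?_
  filter_upwards [hf.coeFn_toLp, hg.coeFn_toLp] with x h1 h2
  rw [h1, h2]
  simp [mul_comm]

theorem inner_trans_toLp {f g : Torus d → ℝ} (hf : MemLp f 2 volume) (hg : MemLp g 2 volume)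
    (j : Fin d) (s : ℝ) :
    inner ℝ (trans j s (hf.toLp f)) (hg.toLp g) = ∫ x, f (axis j s + x) * g x := by
  rw [L2.inner_def]
  refine integral_congr_ae ?_
  filter_upwards [trans_toLp j s hf, hg.coeFn_toLp] with x h1 h2
  rw [h1, h2]
  simp [mul_comm]

/-- Duality: the bound extends from smooth test functions to all of L² by density, and is then
applied to `u` itself. -/
theorem norm_le_of_inner_contDiff {u : Lp ℝ 2 (volume : Measure (Torus d))} {c : ℝ}
    (hc : 0 ≤ c)
    (h : ∀ (ψ : Torus d → ℝ) (hψ : ContDiff ℝ 1 (lift ψ)),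
      inner ℝ u ((memLp_of_continuous (continuous_of_lift hψ.continuous) 2).toLp ψ) ≤
        c * ‖(memLp_of_continuous (continuous_of_lift hψ.continuous) 2).toLp ψ‖) : ‖u‖ ≤ c := by
  have h1 : ∀ v : Lp ℝ 2 (volume : Measure (Torus d)), inner ℝ u v ≤ c * ‖v‖ := by
    refine fun v => isClosed_property (p := fun v => inner ℝ u v ≤ c * ‖v‖)
      (e := ((↑) : {v : Lp ℝ 2 (volume : Measure (Torus d)) | _} → _))
      (dense_contDiff (d := d)).denseRange_val ?_ ?_ v
    · exact isClosed_le (by fun_prop) (by fun_prop)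
    · rintro ⟨_, ψ, hψ, rfl⟩
      exact h ψ hψ
  have h2 := h1 u
  rw [real_inner_self_eq_norm_mul_norm] at h2
  by_contra! hlt
  exact absurd h2 (not_le.2 (mul_lt_mul_of_pos_right hlt (hc.trans_lt hlt)))

/-- A weak partial derivative in `L²` is the derivative of the translation in `L²`. -/
theorem hasDerivAt_trans {f g : Torus d → ℝ} (hf : MemLp f 2 volume) (hg : MemLp g 2 volume)
    (j : Fin d)
    (hfg : ∀ ψ : Torus d → ℝ, ContDiff ℝ 1 (lift ψ) → ∫ x, f x * pd j ψ x = -∫ x, g x * ψ x) :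
    HasDerivAt (fun s => trans j s (hf.toLp f)) (hg.toLp g) 0 := by
  rw [hasDerivAt_iff_isLittleO, Asymptotics.isLittleO_iff]
  intro ε hε
  have h1 := (tendsto_trans j (hg.toLp g)).eventually (Metric.closedBall_mem_nhds _ hε)
  obtain ⟨δ, hδ, h2⟩ := Metric.eventually_nhds_iff_ball.1 h1
  rw [Metric.eventually_nhds_iff_ball]
  refine ⟨δ, hδ, fun h hh => ?_⟩
  have h0 : trans j 0 (hf.toLp f) = hf.toLp f := trans_zero j _
  rw [h0]
  simp only [sub_zero]
  refine norm_le_of_inner_contDiff (by positivity) fun ψ hψ => ?_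
  have hψ2 := memLp_of_continuous (continuous_of_lift hψ.continuous) 2
  set v := hψ2.toLp ψ
  -- Tested with ψ, the first-order error is the increment over [0, h] of a function with derivative
  -- ⟨τₛg - g, ψ⟩. This is at most ε‖ψ‖ for |s| < δ by continuity of translations, so the mean value
  -- inequality gives a bound uniform in ψ.
  have hk : ∀ s : ℝ, HasDerivAt
      (fun s => inner ℝ (trans j s (hf.toLp f)) v - s * inner ℝ (hg.toLp g) v)
      (inner ℝ (trans j s (hg.toLp g) - hg.toLp g) v) s := by
    intro s
    simp only [inner_sub_left]
    refine HasDerivAt.sub ?_ (by simpa using (hasDerivAt_id s).mul_const _)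
    simp only [v, inner_trans_toLp]
    have h3 := hasDerivAt_integral_shift_mul (hf.integrable (by norm_num)) hψ j s
    -- The weak derivative is tested with a translate of ψ, which gives the derivative at every s
    -- and not only at 0.
    have h4 := hfg (fun x => ψ (x + axis j (-s))) (contDiff_lift_comp_add hψ _)
    simp only [pd_comp_add] at h4
    rw [h4, neg_neg, ← integral_shift_mul] at h3
    exact h3
  have h5 := (convex_ball (0 : ℝ) δ).norm_image_sub_le_of_norm_hasDerivWithin_le
    (C := ε * ‖v‖) (fun s _ => (hk s).hasDerivWithinAt) (fun s hs => ?_)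
    (Metric.mem_ball_self hδ) hh
  · have h6 := (le_abs_self _).trans h5
    simp only [h0, zero_mul, sub_zero] at h6
    rw [inner_sub_left, inner_sub_left, real_inner_smul_left]
    nlinarith [h6]
  · refine (norm_inner_le_norm _ _).trans ?_
    gcongr
    have := h2 s hs
    rwa [← dist_eq_norm]

theorem integrable_abs_mul_abs (a b : Lp ℝ 2 (volume : Measure (Torus d))) :
    Integrable fun x => |a x| * |b x| := by
  refine (L2.integrable_inner (𝕜 := ℝ) |a| |b|).congr ?_
  filter_upwards [Lp.coeFn_abs a, Lp.coeFn_abs b] with x h1 h2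
  rw [h1, h2]
  simp [mul_comm]

theorem integral_abs_mul_abs_le (a b : Lp ℝ 2 (volume : Measure (Torus d))) :
    ∫ x, |a x| * |b x| ≤ ‖a‖ * ‖b‖ := by
  have h := real_inner_le_norm |a| |b|
  rw [norm_abs_eq_norm, norm_abs_eq_norm, L2.inner_def] at h
  refine le_trans (le_of_eq (integral_congr_ae ?_)) h
  filter_upwards [Lp.coeFn_abs a, Lp.coeFn_abs b] with x h1 h2
  rw [h1, h2]
  simp [mul_comm]

/-- The chain rule `R ∂_j f = ∂_j G` in the weak sense, where `G` is a function of `f` with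
derivative `R`. -/
theorem integral_chain_rule {f g R G u : Torus d → ℝ} (hf : MemLp f 2 volume)
    (hg : MemLp g 2 volume) (hR : MemLp R 2 volume) (hG : Integrable G) (j : Fin d)
    (hfg : ∀ ψ : Torus d → ℝ, ContDiff ℝ 1 (lift ψ) → ∫ x, f x * pd j ψ x = -∫ x, g x * ψ x)
    (hGR : ∀ x y, |G x - G y - R y * (f x - f y)| ≤ |R x - R y| * |f x - f y|)
    (hu : ContDiff ℝ 1 (lift u)) :
    ∫ x, R x * g x * u x = -∫ x, G x * pd j u x := by
  have huc : Continuous u := continuous_of_lift hu.continuous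
  obtain ⟨C, hC0, hC⟩ := exists_bound_of_continuous huc
  have hRu : MemLp (fun x => R x * u x) 2 volume := by
    refine MemLp.of_le_mul (c := C) hR (hR.1.mul huc.aestronglyMeasurable)
      (Eventually.of_forall fun x => ?_)
    rw [norm_mul, mul_comm]
    exact mul_le_mul_of_nonneg_right (hC x) (norm_nonneg _)
  have hD := hasDerivAt_trans hf hg j hfg
  have h1 := hasDerivAt_integral_shift_mul hG hu j 0
  simp only [neg_zero, axis_zero, add_zero] at h1
  have h2 : HasDerivAt (fun s => inner ℝ (trans j s (hf.toLp f)) (hRu.toLp _))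
      (inner ℝ (hg.toLp g) (hRu.toLp _)) 0 := by
    simpa using hD.inner ℝ (hasDerivAt_const (0 : ℝ) (hRu.toLp _))
  rw [inner_toLp] at h2
  simp only [inner_trans_toLp] at h2
  -- The linearization error is at most the product of the increments of R and f. In L² the first is
  -- o(1) by continuity of translations and the second is O(s) because f has an L² derivative, so by
  -- Cauchy-Schwarz the error is o(s).
  have h3 : HasDerivAt (fun s => ∫ x, (G (axis j s + x) - G x
      - R x * (f (axis j s + x) - f x)) * u x) 0 0 := by
    rw [hasDerivAt_iff_isLittleO]
    have hbig : (fun s => trans j s (hf.toLp f) - hf.toLp f) =O[𝓝 0] fun s : ℝ => s := by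
      simpa [trans_zero] using hD.isBigO_sub
    have hlit : (fun s => trans j s (hR.toLp R) - hR.toLp R) =o[𝓝 0] fun _ : ℝ => (1 : ℝ) := by
      rw [Asymptotics.isLittleO_one_iff]
      simpa using (tendsto_trans j (hR.toLp R)).sub_const (hR.toLp R)
    have := ((hlit.norm_left).mul_isBigO hbig.norm_left).const_mul_left C
    simp only [one_mul] at this
    simp only [smul_zero, sub_zero]
    refine Asymptotics.IsBigO.trans_isLittleO
      (Asymptotics.IsBigO.of_bound 1 (Eventually.of_forall fun s => ?_)) this
    simp only [axis_zero, zero_add, sub_self, mul_zero, zero_mul, integral_zero, sub_zero,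
      one_mul]
    set a := trans j s (hR.toLp R) - hR.toLp R
    set b := trans j s (hf.toLp f) - hf.toLp f
    have hab := integrable_abs_mul_abs a b
    calc ‖∫ x, (G (axis j s + x) - G x - R x * (f (axis j s + x) - f x)) * u x‖
        ≤ ∫ x, C * (|a x| * |b x|) := by
          refine norm_integral_le_of_norm_le (hab.const_mul C) ?_
          filter_upwards [trans_toLp j s hR, trans_toLp j s hf, hR.coeFn_toLp, hf.coeFn_toLp,
            Lp.coeFn_sub (trans j s (hR.toLp R)) (hR.toLp R),
            Lp.coeFn_sub (trans j s (hf.toLp f)) (hf.toLp f)] with x e1 e2 e3 e4 e5 e6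
          have ea : a x = R (axis j s + x) - R x := by
            rw [e5, Pi.sub_apply, e1, e3]
          have eb : b x = f (axis j s + x) - f x := by
            rw [e6, Pi.sub_apply, e2, e4]
          rw [norm_mul, ea, eb, mul_comm]
          exact mul_le_mul (hC x) (hGR _ _) (norm_nonneg _) hC0
      _ = C * ∫ x, |a x| * |b x| := integral_const_mul _ _
      _ ≤ C * (‖a‖ * ‖b‖) := by gcongr; exact integral_abs_mul_abs_le a b
      _ ≤ ‖C * (‖a‖ * ‖b‖)‖ := le_abs_self _
  have hfi : ∀ s, Integrable fun x => f (axis j s + x) * (R x * u x) := fun s =>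
    (hf.comp_measurePreserving
      (measurePreserving_add_left (volume : Measure (Torus d)) (axis j s))).integrable_mul hRu
  have hGs : ∀ s, Integrable fun x => G (axis j s + x) * u x := fun s =>
    integrable_mul_of_continuous (hG.comp_add_left (axis j s)) huc
  -- The same function of s now has two derivatives at 0: this one, through f, and `h1`, with the
  -- derivative thrown on u. Uniqueness gives the claim.
  have h4 : HasDerivAt (fun s => ∫ x, G (axis j s + x) * u x) (∫ x, g x * (R x * u x)) 0 := by
    have h5 := (h3.add h2).add_const
      ((∫ x, G x * u x) - ∫ x, f x * (R x * u x))
    rw [zero_add] at h5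
    refine h5.congr_of_eventuallyEq (Eventually.of_forall fun s => ?_)
    simp only [Pi.add_apply]
    have hf0 : Integrable fun x => f x * (R x * u x) := hf.integrable_mul hRu
    have hG0 : Integrable fun x => G x * u x := integrable_mul_of_continuous hG huc
    have h6 : ∀ x, (G (axis j s + x) - G x - R x * (f (axis j s + x) - f x)) * u x =
        (G (axis j s + x) * u x - G x * u x)
          - (f (axis j s + x) * (R x * u x) - f x * (R x * u x)) := fun x => by ring
    simp only [h6]
    have h7 := integral_sub ((hGs s).sub hG0) ((hfi s).sub hf0)
    simp only [Pi.sub_apply] at h7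
    rw [h7, integral_sub (hGs s) hG0,
      integral_sub (hfi s) hf0]
    ring
  rw [← h4.unique h1]
  exact integral_congr_ae (Eventually.of_forall fun x => by ring)

end TorusIntegration

/-! ### Identities and convexity for p, E and Q. -/

section Constitutive

variable {γ : ℝ}

theorem E_eq (hγ : 1 ≤ γ) (r : ℝ) : E γ r = r ^ (γ + 1) / (γ + 1) := by
  unfold E p
  rw [integral_rpow (Or.inl (by linarith)), Real.zero_rpow (by linarith), sub_zero]

theorem hasDerivAt_p (hγ : 1 ≤ γ) (s : ℝ) : HasDerivAt (p γ) (γ * s ^ (γ - 1)) s :=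
  Real.hasDerivAt_rpow_const (Or.inr hγ)

theorem deriv_p (hγ : 1 ≤ γ) : deriv (p γ) = fun s => γ * s ^ (γ - 1) :=
  funext fun s => (hasDerivAt_p hγ s).deriv

theorem hasDerivAt_E (hγ : 1 ≤ γ) (s : ℝ) : HasDerivAt (E γ) (p γ s) s := by
  have h : E γ = fun r => r ^ (γ + 1) / (γ + 1) := funext (E_eq hγ)
  rw [h]
  have := (Real.hasDerivAt_rpow_const (x := s) (p := γ + 1) (Or.inr (by linarith))).div_const (γ + 1)
  refine this.congr_deriv ?_
  have : γ + 1 ≠ 0 := by linarith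
  rw [p, add_sub_cancel_right]
  field_simp

/-- Euler's identity r p' = γ p for the power law. It makes γE a primitive of r p', so that √r ∇Q, r
∇p and ∇(γE) coincide for smooth positive densities. -/
theorem mul_deriv_p {r : ℝ} (hr : 0 < r) : r * (γ * r ^ (γ - 1)) = γ * p γ r := by
  have : r ^ γ = r ^ (γ - 1) * r := by
    conv_rhs => rw [← Real.rpow_add_one hr.ne', sub_add_cancel]
  rw [p, this]
  ring

theorem mul_p (hγ : 1 ≤ γ) {r : ℝ} (hr : 0 < r) : r * p γ r = (γ + 1) * E γ r := by
  have h1 : γ + 1 ≠ 0 := by linarith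
  rw [E_eq hγ, p, Real.rpow_add_one hr.ne']
  field_simp

theorem continuous_p (hγ : 1 ≤ γ) : Continuous (p γ) :=
  continuous_iff_continuousAt.2 fun s => (hasDerivAt_p hγ s).continuousAt

theorem continuous_E (hγ : 1 ≤ γ) : Continuous (E γ) :=
  continuous_iff_continuousAt.2 fun s => (hasDerivAt_E hγ s).continuousAt

theorem continuous_deriv_p (hγ : 1 ≤ γ) : Continuous fun s : ℝ => √s * deriv (p γ) s := by
  rw [deriv_p hγ]
  exact Real.continuous_sqrt.mul
    (continuous_const.mul (Real.continuous_rpow_const (by linarith)))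

theorem hasDerivAt_Q (hγ : 1 ≤ γ) (s : ℝ) : HasDerivAt (Q γ) (√s * (γ * s ^ (γ - 1))) s := by
  have h := intervalIntegral.integral_hasDerivAt_right
    ((continuous_deriv_p hγ).intervalIntegrable 0 s)
    (continuous_deriv_p hγ).stronglyMeasurable.stronglyMeasurableAtFilter
    (continuous_deriv_p hγ).continuousAt
  rw [deriv_p hγ] at h
  have hQ : Q γ = fun u => ∫ s in (0 : ℝ)..u, √s * (γ * s ^ (γ - 1)) := by
    funext u
    rw [Q, deriv_p hγ]
  rwa [hQ]

theorem Q_eq (hγ : 1 ≤ γ) {r : ℝ} (hr : 0 ≤ r) :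
    Q γ r = 2 * γ / (2 * γ + 1) * √r ^ (2 * γ + 1) := by
  have h1 : ∀ s ∈ uIcc 0 r, √s * deriv (p γ) s = γ * s ^ (γ - 1 / 2) := by
    intro s hs
    rw [uIcc_of_le hr] at hs
    rw [deriv_p hγ, Real.sqrt_eq_rpow]
    have : s ^ (γ - 1 / 2) = s ^ (1 / 2 : ℝ) * s ^ (γ - 1) := by
      rw [← Real.rpow_add_of_nonneg hs.1 (by norm_num) (by linarith)]
      congr 1; ring
    rw [this]; ring
  rw [Q, intervalIntegral.integral_congr h1, intervalIntegral.integral_const_mul,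
    integral_rpow (Or.inl (by linarith)), Real.zero_rpow (by linarith), Real.sqrt_eq_rpow,
    ← Real.rpow_mul hr]
  have h2 : (1 / 2 * (2 * γ + 1) : ℝ) = γ - 1 / 2 + 1 := by ring
  rw [h2]
  have h4 : 2 * γ + 1 ≠ 0 := by linarith
  generalize r ^ (γ - 1 / 2 + 1) = X
  rw [show γ - 1 / 2 + 1 = (2 * γ + 1) / 2 by ring]
  field_simp
  ring

theorem E_eq_sqrt (hγ : 1 ≤ γ) {r : ℝ} (hr : 0 ≤ r) :
    γ * E γ r = 2 * γ / (2 * γ + 2) * √r ^ (2 * γ + 2) := by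
  rw [E_eq hγ, Real.sqrt_eq_rpow, ← Real.rpow_mul hr]
  have h2 : (1 / 2 * (2 * γ + 2) : ℝ) = γ + 1 := by ring
  rw [h2]
  have h3 : γ + 1 ≠ 0 := by linarith
  have h4 : 2 * γ + 2 ≠ 0 := by linarith
  field_simp

/-- As a function of Q, the quantity γE has the increasing derivative √r, so it is convex, and this
is its tangent line inequality at `b`. In the variables x = √a, y = √b, m = 2γ it is Young's
inequality for y · x^(m+1) with exponents m+2 and (m+2)/(m+1). -/
theorem sqrt_mul_Q_sub_le (hγ : 1 ≤ γ) {a b : ℝ} (ha : 0 ≤ a) (hb : 0 ≤ b) :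
    √b * (Q γ a - Q γ b) ≤ γ * E γ a - γ * E γ b := by
  rw [Q_eq hγ ha, Q_eq hγ hb, E_eq_sqrt hγ ha, E_eq_sqrt hγ hb]
  set x := √a
  set y := √b
  have hx : 0 ≤ x := Real.sqrt_nonneg a
  have hy : 0 ≤ y := Real.sqrt_nonneg b
  set m := 2 * γ
  have hm : 2 ≤ m := by simp only [m]; linarith
  have hpq : (m + 2).HolderConjugate ((m + 2) / (m + 1)) := by
    rw [Real.holderConjugate_iff]
    refine ⟨by linarith, ?_⟩
    have : m + 2 ≠ 0 := by linarith
    field_simp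
    ring
  have h1 := Real.young_inequality_of_nonneg hy (Real.rpow_nonneg hx (m + 1)) hpq
  rw [← Real.rpow_mul hx, show (m + 1) * ((m + 2) / (m + 1)) = m + 2 by
    have : m + 1 ≠ 0 := by linarith
    field_simp] at h1
  have h2 : y ^ (m + 2) = y * y ^ (m + 1) := by
    rw [show m + 2 = (m + 1) + 1 by ring, Real.rpow_add_one' hy (by linarith)]; ring
  rw [h2] at h1 ⊢
  have h3 : (0 : ℝ) ≤ m / (m + 1) := by positivity
  have h4 := mul_le_mul_of_nonneg_left h1 h3
  have e1 : m / (m + 1) * (y * y ^ (m + 1) / (m + 2) + x ^ (m + 2) / ((m + 2) / (m + 1))) =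
      m / (m + 2) * x ^ (m + 2) + (m / (m + 1) - m / (m + 2)) * (y * y ^ (m + 1)) := by
    have : m + 2 ≠ 0 := by linarith
    have : m + 1 ≠ 0 := by linarith
    field_simp
    ring
  rw [e1] at h4
  linarith

/-- The tangent inequality at `b` makes the error non-negative; the one at `a` bounds it by (√a -
√b)(Q(a) - Q(b)). This is the hypothesis of `integral_chain_rule` with R = √ϱ, f = Q(ϱ), G = γE(ϱ).
-/
theorem abs_E_sub_sub_le (hγ : 1 ≤ γ) {a b : ℝ} (ha : 0 ≤ a) (hb : 0 ≤ b) :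
    |γ * E γ a - γ * E γ b - √b * (Q γ a - Q γ b)| ≤ |√a - √b| * |Q γ a - Q γ b| := by
  have h1 := sqrt_mul_Q_sub_le hγ ha hb
  have h2 := sqrt_mul_Q_sub_le hγ hb ha
  rw [← abs_mul, abs_of_nonneg (by linarith)]
  refine le_trans ?_ (le_abs_self _)
  linarith

/-- The relative potential energy `E(r | s) = E(r) - E(s) - E'(s)(r - s)`. -/
def relE (γ r s : ℝ) : ℝ := E γ r - E γ s - p γ s * (r - s)

/-- Strict convexity of E, in the form of Bernoulli's inequality with exponent γ + 1 at r/s - 1. -/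
theorem relE_pos (hγ : 1 ≤ γ) {r s : ℝ} (hr : 0 ≤ r) (hs : 0 < s) (hrs : r ≠ s) :
    0 < relE γ r s := by
  have h1 : -1 ≤ r / s - 1 := by
    have := div_nonneg hr hs.le
    linarith
  have h2 : r / s - 1 ≠ 0 := by
    rw [sub_ne_zero, Ne, div_eq_one_iff_eq hs.ne']
    exact hrs
  have h3 := one_add_mul_self_lt_rpow_one_add h1 h2 (p := γ + 1) (by linarith)
  rw [add_sub_cancel, Real.div_rpow hr hs.le] at h3
  have h4 : 0 < s ^ (γ + 1) := Real.rpow_pos_of_pos hs _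
  rw [lt_div_iff₀ h4, Real.rpow_add_one hs.ne'] at h3
  have h6 : (1 + (γ + 1) * (r / s - 1)) * (s ^ γ * s) =
      (γ + 1) * (s ^ γ * (r - s)) + s ^ γ * s := by
    field_simp
    ring
  rw [h6] at h3
  have h5 : 0 < γ + 1 := by linarith
  unfold relE
  rw [E_eq hγ, E_eq hγ, p, Real.rpow_add_one hs.ne', ← sub_div, sub_pos, lt_div_iff₀ h5]
  linarith

theorem relE_self (γ s : ℝ) : relE γ s s = 0 := by simp [relE]

theorem relE_nonneg (hγ : 1 ≤ γ) {r s : ℝ} (hr : 0 ≤ r) (hs : 0 < s) : 0 ≤ relE γ r s := by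
  rcases eq_or_ne r s with rfl | h
  · rw [relE_self]
  · exact (relE_pos hγ hr hs h).le

theorem eq_of_relE_eq_zero (hγ : 1 ≤ γ) {r s : ℝ} (hr : 0 ≤ r) (hs : 0 < s)
    (h : relE γ r s = 0) : r = s := by
  by_contra hne
  exact (relE_pos hγ hr hs hne).ne' h

theorem le_one_add_E (hγ : 1 ≤ γ) {r : ℝ} (hr : 0 ≤ r) : r ≤ 1 + (γ + 1) * E γ r := by
  have h1 : γ + 1 ≠ 0 := by linarith
  rw [E_eq hγ, mul_div_cancel₀ _ h1]
  rcases le_total r 1 with h | h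
  · linarith [Real.rpow_nonneg hr (γ + 1)]
  · have := Real.rpow_le_rpow_of_exponent_le h (show (1 : ℝ) ≤ γ + 1 by linarith)
    rw [Real.rpow_one] at this
    linarith

end Constitutive

/-! ### From curves in C(𝕋ᵈ) to joint differentiability. -/

section JointRegularity

variable {d : ℕ}

theorem fderiv_lift_eq {f : Torus d → ℝ} {y : Vec d} (h : DifferentiableAt ℝ (lift f) y) :
    fderiv ℝ (lift f) y = ∑ j, (EuclideanSpace.proj (𝕜 := ℝ) j).smulRight (pd j f (proj y)) := by
  ext v
  have hv : v = ∑ j, v j • EuclideanSpace.single j (1 : ℝ) := by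
    ext i
    simp [Finset.sum_apply, Pi.single_apply]
  conv_lhs => rw [hv]
  rw [map_sum]
  simp [pd_proj _ _ h]

theorem continuous_proj : Continuous (proj : Vec d → Torus d) :=
  isOpenQuotientMap_proj.continuous

/-- Joint differentiability of `(t, y) ↦ F t (proj y)` for a differentiable curve `F` in
`C(𝕋ᵈ)`. -/
theorem hasFDerivWithinAt_uncurry {I : Set ℝ} {F : ℝ → C(Torus d, ℝ)} {F' : C(Torus d, ℝ)}
    {t : ℝ} {y : Vec d} (hF : HasDerivWithinAt F F' I t)
    (hd : DifferentiableAt ℝ (lift (F t)) y) :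
    HasFDerivWithinAt (fun q : ℝ × Vec d => F q.1 (proj q.2))
      ((ContinuousLinearMap.fst ℝ ℝ (Vec d)).smulRight (F' (proj y))
        + (fderiv ℝ (lift (F t)) y).comp (ContinuousLinearMap.snd ℝ ℝ (Vec d)))
      (I ×ˢ univ) (t, y) := by
  have h1 : HasFDerivWithinAt (fun q : ℝ × Vec d => lift (F t) q.2)
      ((fderiv ℝ (lift (F t)) y).comp (ContinuousLinearMap.snd ℝ ℝ (Vec d))) (I ×ˢ univ) (t, y) :=
    (HasFDerivAt.comp (t, y) (g := lift (F t)) hd.hasFDerivAt hasFDerivAt_snd).hasFDerivWithinAt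
  have h2 : HasFDerivWithinAt (fun q : ℝ × Vec d => (F q.1 - F t) (proj q.2))
      ((ContinuousLinearMap.fst ℝ ℝ (Vec d)).smulRight (F' (proj y))) (I ×ˢ univ) (t, y) := by
    rw [hasFDerivWithinAt_iff_isLittleO]
    have hfst : Tendsto (fun q : ℝ × Vec d => q.1) (𝓝[I ×ˢ univ] (t, y)) (𝓝[I] t) := by
      refine tendsto_nhdsWithin_iff.2 ⟨?_, ?_⟩
      · exact (continuous_fst.tendsto (t, y)).mono_left nhdsWithin_le_nhds
      · exact eventually_nhdsWithin_of_forall fun q hq => hq.1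
    have hbig : (fun q : ℝ × Vec d => q.1 - t) =O[𝓝[I ×ˢ univ] (t, y)] fun q => q - (t, y) :=
      Asymptotics.IsBigO.of_bound 1 (Eventually.of_forall fun q => by
        simpa using norm_fst_le (q - (t, y)))
    -- The remainder of the curve is small in the sup norm, hence also at the moving point `proj
    -- q.2`; what is left is (q.1 - t) times the oscillation of F' near y.
    have hA : (fun q : ℝ × Vec d => F q.1 - F t - (q.1 - t) • F')
        =o[𝓝[I ×ˢ univ] (t, y)] fun q => q - (t, y) :=
      (((hasDerivWithinAt_iff_isLittleO.1 hF).comp_tendsto hfst).trans_isBigO hbig)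
    have hB : (fun q : ℝ × Vec d => (q.1 - t) • (F' (proj q.2) - F' (proj y)))
        =o[𝓝[I ×ˢ univ] (t, y)] fun q => q - (t, y) := by
      have hlit : (fun q : ℝ × Vec d => F' (proj q.2) - F' (proj y))
          =o[𝓝[I ×ˢ univ] (t, y)] fun _ => (1 : ℝ) := by
        rw [Asymptotics.isLittleO_one_iff]
        have : Continuous fun q : ℝ × Vec d => F' (proj q.2) - F' (proj y) :=
          (F'.continuous.comp (continuous_proj.comp continuous_snd)).sub continuous_const
        simpa using (this.tendsto (t, y)).mono_left nhdsWithin_le_nhds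
      simpa using (hbig.norm_right.smul_isLittleO hlit).norm_right
    have hA' : (fun q : ℝ × Vec d => (F q.1 - F t - (q.1 - t) • F') (proj q.2))
        =o[𝓝[I ×ˢ univ] (t, y)] fun q => q - (t, y) :=
      Asymptotics.IsBigO.trans_isLittleO (Asymptotics.IsBigO.of_bound 1
        (Eventually.of_forall fun q => by
          simpa using ContinuousMap.norm_coe_le_norm (F q.1 - F t - (q.1 - t) • F') (proj q.2))) hA
    refine (hA'.add hB).congr_left fun q => ?_
    simp
    ring
  have h3 := h2.add h1
  have h4 : (fun q : ℝ × Vec d => (F q.1 - F t) (proj q.2)) + (fun q => lift (F t) q.2) =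
      fun q : ℝ × Vec d => F q.1 (proj q.2) := by
    funext q
    simp [lift]
  rwa [h4] at h3

/-- The total derivative is assembled from the time derivative of the curve and from the first
spatial derivatives. Both are continuous curves in C(𝕋ᵈ), so evaluation makes them jointly
continuous. -/
theorem IsC1C2.contDiffOn {T : ℝ} {f : ℝ → Torus d → ℝ} (hf : IsC1C2 (Ico 0 T) f) :
    ContDiffOn ℝ 1 (fun q : ℝ × Vec d => f q.1 (proj q.2)) (Ico 0 T ×ˢ univ) := by
  obtain ⟨h2, hF⟩ := hf
  obtain ⟨F, hFd, hFe⟩ := hF [] (by simp)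
  choose G hGd hGe using fun j : Fin d => hF [j] (by simp)
  have hud : UniqueDiffOn ℝ (Ico (0 : ℝ) T) := uniqueDiffOn_Ico 0 T
  have hud2 : UniqueDiffOn ℝ (Ico (0 : ℝ) T ×ˢ (univ : Set (Vec d))) := hud.prod uniqueDiffOn_univ
  have hFf : ∀ t ∈ Ico 0 T, ⇑(F t) = f t := fun t ht => funext fun x => hFe t ht x
  have hev : ∀ {K : ℝ → C(Torus d, ℝ)}, ContinuousOn K (Ico 0 T) →
      ContinuousOn (fun q : ℝ × Vec d => K q.1 (proj q.2)) (Ico 0 T ×ˢ univ) := by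
    intro K hK
    have h3 : ContinuousOn (fun q : ℝ × Vec d => (K q.1, proj q.2)) (Ico 0 T ×ˢ univ) :=
      (hK.comp continuousOn_fst fun q hq => hq.1).prodMk
        (continuous_proj.comp continuous_snd).continuousOn
    exact (continuous_eval (F := C(Torus d, ℝ))).comp_continuousOn h3
  rw [show (1 : WithTop ℕ∞) = 0 + 1 by simp, contDiffOn_succ_iff_hasFDerivWithinAt_of_uniqueDiffOn hud2]
  refine ⟨by simp, fun q => (ContinuousLinearMap.fst ℝ ℝ (Vec d)).smulRight
      (derivWithin F (Ico 0 T) q.1 (proj q.2))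
      + ∑ j, ((EuclideanSpace.proj (𝕜 := ℝ) j).smulRight (G j q.1 (proj q.2))).comp
        (ContinuousLinearMap.snd ℝ ℝ (Vec d)), ?_, ?_⟩
  · rw [contDiffOn_zero]
    have hF' := hFd.continuousOn_derivWithin hud le_rfl
    refine ContinuousOn.add ?_ (continuousOn_finsetSum _ fun j _ => ?_)
    · exact ((ContinuousLinearMap.smulRightL ℝ (ℝ × Vec d) ℝ
        (ContinuousLinearMap.fst ℝ ℝ (Vec d))).continuous.comp_continuousOn (hev hF'))
    · refine ContinuousOn.clm_comp ?_ continuousOn_const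
      exact ((ContinuousLinearMap.smulRightL ℝ (Vec d) ℝ
        (EuclideanSpace.proj (𝕜 := ℝ) j)).continuous.comp_continuousOn (hev (hGd j).continuousOn))
  · rintro ⟨t, y⟩ ⟨ht, -⟩
    have hdt : DifferentiableAt ℝ (lift (f t)) y := (h2 t ht).differentiable (by simp) y
    have h4 := hasFDerivWithinAt_uncurry (y := y)
      (hFd.differentiableOn one_ne_zero t ht).hasDerivWithinAt (by rwa [hFf t ht])
    rw [hFf t ht, fderiv_lift_eq hdt] at h4
    refine (h4.congr (fun q hq => (hFe q.1 hq.1 _).symm) (hFe t ht _).symm).congr_fderiv ?_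
    ext v
    · simp
    · simp [hGe _ t ht, iterPd]

end JointRegularity

/-! ### A smooth truncation of time. -/

section TimeTruncation

/-- A smooth function equal to `t` for `t ≤ a` and with values in `[0, b]` for `t ≥ 0`. -/
def truncTime (a b t : ℝ) : ℝ := t * Real.smoothTransition ((b - t) / (b - a))

variable {a b : ℝ}

theorem contDiff_truncTime {n : ℕ∞} : ContDiff ℝ n (truncTime a b) :=
  contDiff_id.mul (Real.smoothTransition.contDiff.comp
    ((contDiff_const.sub contDiff_id).div_const _))

theorem truncTime_of_le (hab : a < b) {t : ℝ} (ht : t ≤ a) : truncTime a b t = t := by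
  rw [truncTime, Real.smoothTransition.one_of_one_le, mul_one]
  rw [one_le_div (by linarith)]
  linarith

theorem truncTime_mem (ha : 0 < a) (hab : a < b) {t : ℝ} (ht : 0 ≤ t) :
    truncTime a b t ∈ Icc 0 b := by
  have h0 := Real.smoothTransition.nonneg ((b - t) / (b - a))
  have h1 := Real.smoothTransition.le_one ((b - t) / (b - a))
  refine ⟨mul_nonneg ht h0, ?_⟩
  unfold truncTime
  rcases le_total t b with h | h
  · exact (mul_le_of_le_one_right ht h1).trans h
  · rw [Real.smoothTransition.zero_of_nonpos
      (div_nonpos_of_nonpos_of_nonneg (by linarith) (by linarith)), mul_zero]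
    linarith

end TimeTruncation

/-! ### The strong solution as an admissible test field. -/

section Background

variable {d : ℕ}

/-- A pair of `C¹` functions on `[0,T] × 𝕋ᵈ` that solves the Aw-Rascle system, in
non-conservative form, on the time interval `(0,a)`. -/
structure Background (γ T a : ℝ) (r : ℝ → Torus d → ℝ) (v : ℝ → Torus d → Vec d) : Prop where
  density : IsC1 T r
  velocity : IsC1 T v
  pos : ∀ t ∈ Icc 0 T, ∀ x, 0 < r t x
  vel_smooth : ∀ t ∈ Ioo 0 a, ∀ j, ContDiff ℝ 1 (lift fun x => vel γ r v t x j)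
  continuity : ∀ t ∈ Ioo 0 a, ∀ x,
    dt r t x = -∑ j, (pd j (r t) x * vel γ r v t x j + r t x * pd j (fun y => vel γ r v t y j) x)
  transport : ∀ t ∈ Ioo 0 a, ∀ x i, dt v t x i = -∑ j, vel γ r v t x j * pd j (v t) x i

/-- Test functions must be C¹ up to time T, where nothing is known about the strong solution. The
composition only evaluates it at times in [0, b] ⊂ [0, T) and does not change it on [0, a]. -/
theorem IsC1C2.isC1_truncTime {T a b : ℝ} (ha : 0 < a) (hab : a < b) (hb : b < T)
    {f : ℝ → Torus d → ℝ} (hf : IsC1C2 (Ico 0 T) f) : IsC1 T fun t => f (truncTime a b t) := by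
  refine hf.contDiffOn.comp (g := fun q : ℝ × Vec d => f q.1 (proj q.2))
    (f := fun q : ℝ × Vec d => (truncTime a b q.1, q.2)) ?_ ?_
  · exact ((contDiff_truncTime (n := 1)).comp contDiff_fst |>.prodMk contDiff_snd).contDiffOn
  · rintro ⟨t, y⟩ ⟨ht, -⟩
    have h := truncTime_mem ha hab ht.1
    exact ⟨⟨h.1, h.2.trans_lt hb⟩, mem_univ _⟩

theorem contDiff_lift_p {γ : ℝ} {n : WithTop ℕ∞} {f : Torus d → ℝ} (hf : ContDiff ℝ n (lift f))
    (hpos : ∀ x, 0 < f x) : ContDiff ℝ n (lift fun x => p γ (f x)) :=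
  hf.rpow_const_of_ne fun y => (hpos (proj y)).ne'

theorem contDiff_lift_vel {γ : ℝ} {ρ : ℝ → Torus d → ℝ} {w : ℝ → Torus d → Vec d} {t : ℝ}
    (hρ : ContDiff ℝ 2 (lift (ρ t))) (hpos : ∀ x, 0 < ρ t x) (j : Fin d)
    (hw : ContDiff ℝ 1 (lift fun x => w t x j)) :
    ContDiff ℝ 1 (lift fun x => vel γ ρ w t x j) := by
  have h : ContDiff ℝ 1 (lift (pd j fun x => p γ (ρ t x))) :=
    contDiff_pd (by simpa [one_add_one_eq_two] using contDiff_lift_p hρ hpos) j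
  exact hw.sub h

/-- The momentum equation minus w times the continuity equation is ϱ(∂ₜw + u·∇w) = 0, and ϱ > 0 may
be divided out. The equations hold on (0, a), where the truncation is the identity; regularity and
positivity hold on all of [0, T]. -/
theorem IsStrongSolution.background {γ T : ℝ} {ρ : ℝ → Torus d → ℝ} {w : ℝ → Torus d → Vec d}
    (h : IsStrongSolution γ T ρ w) {a b : ℝ} (ha : 0 < a) (hab : a < b) (hb : b < T) :
    Background γ T a (fun t => ρ (truncTime a b t)) (fun t => w (truncTime a b t)) := by
  have hIco : ∀ t ∈ Ioo 0 a, t ∈ Ico 0 T := fun t ht =>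
    ⟨ht.1.le, ht.2.trans (hab.trans hb)⟩
  have hIoo : ∀ t ∈ Ioo 0 a, t ∈ Ioo 0 T := fun t ht =>
    ⟨ht.1, ht.2.trans (hab.trans hb)⟩
  have hθ : ∀ t ∈ Ioo 0 a, truncTime a b t = t := fun t ht => truncTime_of_le hab ht.2.le
  have hdt : ∀ {G : Type} [NormedAddCommGroup G] [NormedSpace ℝ G] (f : ℝ → Torus d → G),
      ∀ t ∈ Ioo 0 a, ∀ x, dt (fun t => f (truncTime a b t)) t x = dt f t x := by
    intro G _ _ f t ht x
    refine Filter.EventuallyEq.deriv_eq ?_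
    filter_upwards [Ioo_mem_nhds ht.1 ht.2] with s hs
    rw [hθ s hs]
  have hC1ρ : IsC1 T fun t => ρ (truncTime a b t) :=
    h.density_regular.isC1_truncTime ha hab hb
  have hC1w : IsC1 T fun t => w (truncTime a b t) := by
    unfold IsC1
    rw [contDiffOn_euclidean]
    exact fun i => (h.velocity_regular i).isC1_truncTime ha hab hb
  have hvel : ∀ t ∈ Ioo 0 a, ∀ x,
      vel γ (fun t => ρ (truncTime a b t)) (fun t => w (truncTime a b t)) t x = vel γ ρ w t x := by
    intro t ht x
    simp only [vel, hθ t ht]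
  have hvs : ∀ t ∈ Ioo 0 a, ∀ j, ContDiff ℝ 1 (lift fun x => vel γ ρ w t x j) := fun t ht j =>
    contDiff_lift_vel (h.density_regular.1 t (hIco t ht)) (h.density_pos t (hIco t ht)) j
      (((h.velocity_regular j).1 t (hIco t ht)).of_le (by norm_num))
  have hρs : ∀ t ∈ Ioo 0 a, ContDiff ℝ 1 (lift (ρ t)) := fun t ht =>
    (h.density_regular.1 t (hIco t ht)).of_le (by norm_num)
  have hws : ∀ t ∈ Ioo 0 a, ∀ i, ContDiff ℝ 1 (lift fun x => w t x i) := fun t ht i =>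
    ((h.velocity_regular i).1 t (hIco t ht)).of_le (by norm_num)
  have hcont : ∀ t ∈ Ioo 0 a, ∀ x, dt ρ t x =
      -∑ j, (pd j (ρ t) x * vel γ ρ w t x j + ρ t x * pd j (fun y => vel γ ρ w t y j) x) := by
    intro t ht x
    rw [eq_neg_iff_add_eq_zero, ← h.continuity t (hIoo t ht) x]
    congr 1
    refine Finset.sum_congr rfl fun j _ => ?_
    exact ((hasPd (hρs t ht) j x).mul (hasPd (hvs t ht j) j x)).pd_eq.symm
  refine ⟨hC1ρ, hC1w, fun t ht x => ?_, fun t ht j => ?_, fun t ht x => ?_, fun t ht x i => ?_⟩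
  · have := truncTime_mem ha hab ht.1
    exact h.density_pos _ ⟨this.1, this.2.trans_lt hb⟩ x
  · simp only [hvel t ht]
    exact hvs t ht j
  · simp only [hvel t ht, hdt ρ t ht, hθ t ht]
    exact hcont t ht x
  · have hpdw : ∀ j, pd j (w t) x i = pd j (fun y => w t y i) x := by
      intro j
      have := hC1w.contDiff_lift (Ioo_subset_Icc_self (hIoo t ht))
      simp only [hθ t ht] at this
      exact ((hasPd this j x).apply i).pd_eq.symm
    simp only [hvel t ht, hdt w t ht, hθ t ht, hpdw]
    have hdw : HasDerivAt (fun s => w s x i) (dt w t x i) t := by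
      have h1 := hC1w.hasDerivAt (hIoo t ht) x
      rw [hdt w t ht] at h1
      refine ((EuclideanSpace.proj (𝕜 := ℝ) i).hasFDerivAt.comp_hasDerivAt t h1).congr_of_eventuallyEq ?_
      filter_upwards [Ioo_mem_nhds ht.1 ht.2] with s hs
      simp [hθ s hs]
    have hdρ : HasDerivAt (fun s => ρ s x) (dt ρ t x) t := by
      have h1 := hC1ρ.hasDerivAt (hIoo t ht) x
      rw [hdt ρ t ht] at h1
      refine h1.congr_of_eventuallyEq ?_
      filter_upwards [Ioo_mem_nhds ht.1 ht.2] with s hs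
      simp [hθ s hs]
    have hm := h.momentum t (hIoo t ht) x i
    have e1 : dt (fun s y => ρ s y * w s y i) t x = dt ρ t x * w t x i + ρ t x * dt w t x i :=
      (hdρ.mul hdw).deriv
    have e2 : ∀ j, pd j (fun y => ρ t y * vel γ ρ w t y j * w t y i) x =
        (pd j (ρ t) x * vel γ ρ w t x j + ρ t x * pd j (fun y => vel γ ρ w t y j) x) * w t x i
          + ρ t x * vel γ ρ w t x j * pd j (fun y => w t y i) x := fun j =>
      (((hasPd (hρs t ht) j x).mul (hasPd (hvs t ht j) j x)).mul (hasPd (hws t ht i) j x)).pd_eq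
    rw [e1, hcont t ht x] at hm
    simp only [e2] at hm
    have e4 : ∀ (c e : Fin d → ℝ) (k : ℝ), ∑ j, (c j * k + e j) = (∑ j, c j) * k + ∑ j, e j := by
      intro c e k
      rw [Finset.sum_add_distrib, Finset.sum_mul]
    rw [e4] at hm
    have e3 : ∑ j, ρ t x * vel γ ρ w t x j * pd j (fun y => w t y i) x =
        ρ t x * ∑ j, vel γ ρ w t x j * pd j (fun y => w t y i) x := by
      rw [Finset.mul_sum]
      exact Finset.sum_congr rfl fun j _ => by ring
    rw [e3] at hm
    have hpos := h.density_pos t (hIco t ht) x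
    have : ρ t x * (dt w t x i + ∑ j, vel γ ρ w t x j * pd j (fun y => w t y i) x) = 0 := by
      linarith
    rcases mul_eq_zero.1 this with h0 | h0
    · exact absurd h0 hpos.ne'
    · linarith

end Background

/-! ### Bounded coefficients on the space-time slab. -/

section Slab

variable {d : ℕ} {T : ℝ}

theorem slab_eq_prod (d : ℕ) (T : ℝ) :
    slab d T = (volume.restrict (Ioo 0 T)).prod (volume : Measure (Torus d)) := by
  rw [slab, Measure.volume_eq_prod, ← Measure.prod_restrict, Measure.restrict_univ]

instance : IsFiniteMeasure (slab d T) := by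
  rw [slab_eq_prod]
  have : IsFiniteMeasure (volume.restrict (Ioo 0 T)) := ⟨by simp⟩
  infer_instance

theorem ae_ae_of_ae_slab {P : ℝ × Torus d → Prop} (h : ∀ᵐ q ∂slab d T, P q) :
    ∀ᵐ t ∂volume.restrict (Ioo 0 T), ∀ᵐ x ∂(volume : Measure (Torus d)), P (t, x) := by
  rw [slab_eq_prod] at h
  exact Measure.ae_ae_of_ae_prod h

theorem ae_slab_mem : ∀ᵐ q ∂slab d T, q.1 ∈ Ioo 0 T := by
  rw [slab]
  filter_upwards [ae_restrict_mem (measurableSet_Ioo.prod MeasurableSet.univ)] with q hq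
  exact hq.1

variable {G : Type*} [NormedAddCommGroup G]

theorem memLp_top_slab {c : ℝ × Torus d → G} (hc : ContinuousOn c (Ioo 0 T ×ˢ univ)) {M : ℝ}
    [SecondCountableTopology G]
    (hM : ∀ t ∈ Ioo 0 T, ∀ x, ‖c (t, x)‖ ≤ M) : MemLp c ∞ (slab d T) := by
  borelize G
  refine memLp_top_of_bound
    (hc.aestronglyMeasurable (measurableSet_Ioo.prod MeasurableSet.univ)) M ?_
  filter_upwards [ae_slab_mem] with q hq
  exact hM q.1 hq q.2

variable [NormedSpace ℝ G] [SecondCountableTopology G] {φ : ℝ → Torus d → G}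

theorem IsC1.memLp_top (hT : 0 < T) (hφ : IsC1 T φ) :
    MemLp (fun q : ℝ × Torus d => φ q.1 q.2) ∞ (slab d T) := by
  obtain ⟨M, -, h, -⟩ := hφ.exists_bound hT
  exact memLp_top_slab hφ.continuousOn fun t ht x => h t (Ioo_subset_Icc_self ht) x

theorem IsC1.memLp_top_pd (hT : 0 < T) (hφ : IsC1 T φ) (j : Fin d) :
    MemLp (fun q : ℝ × Torus d => pd j (φ q.1) q.2) ∞ (slab d T) := by
  obtain ⟨M, -, -, h, -⟩ := hφ.exists_bound hT
  exact memLp_top_slab (hφ.continuousOn_pd hT j) fun t ht x => h t (Ioo_subset_Icc_self ht) x j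

theorem IsC1.memLp_top_dt (hT : 0 < T) (hφ : IsC1 T φ) :
    MemLp (fun q : ℝ × Torus d => dt φ q.1 q.2) ∞ (slab d T) := by
  obtain ⟨M, -, -, -, h, -⟩ := hφ.exists_bound hT
  exact memLp_top_slab (hφ.continuousOn_dt hT) h

end Slab

/-! ### Integrability of products and inner products. -/

section Inner

variable {α : Type*} {m : MeasurableSpace α} {μ : Measure α} {H : Type*} [NormedAddCommGroup H]
  [InnerProductSpace ℝ H]

theorem memLp_inner {p q r : ℝ≥0∞} [ENNReal.HolderTriple p q r] {f g : α → H} (hf : MemLp f p μ)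
    (hg : MemLp g q μ) : MemLp (fun x => inner ℝ (f x) (g x)) r μ :=
  MemLp.of_bilin (fun x y => inner ℝ x y) 1 hf hg (hf.1.inner hg.1)
    (Eventually.of_forall fun x => by simpa using nnnorm_inner_le_nnnorm (𝕜 := ℝ) (f x) (g x))

theorem integrable_inner_of_memLp {f g : α → H} (hf : MemLp f 2 μ) (hg : MemLp g 2 μ) :
    Integrable (fun x => inner ℝ (f x) (g x)) μ :=
  memLp_one_iff_integrable.1 (memLp_inner hf hg)

theorem integrable_mul_of_memLp_top {c f : α → ℝ} (hc : MemLp c ∞ μ) (hf : Integrable f μ) :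
    Integrable (fun x => c x * f x) μ :=
  memLp_one_iff_integrable.1 (MemLp.mul' (memLp_one_iff_integrable.2 hf) hc)

theorem memLp_toLp_of_apply {d : ℕ} {p : ℝ≥0∞} {f : α → Vec d} (h : ∀ i, MemLp (fun x => f x i) p μ) :
    MemLp f p μ := by
  have h1 : f = fun x => ∑ i, f x i • EuclideanSpace.single i (1 : ℝ) := by
    funext x
    ext i
    simp [Finset.sum_apply, Pi.single_apply]
  rw [h1]
  refine memLp_finsetSum _ fun i _ => ?_
  exact MemLp.of_le (h i) ((h i).1.smul_const _) (Eventually.of_forall fun x => by simp [norm_smul])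

end Inner

/-! ### Spatial totals of functions on phase space. -/

section Total

variable {d : ℕ} {T : ℝ} {V : Kernel (ℝ × Torus d) (Phase d)}

/-- The spatial integral `∫ ⟨𝒱_{t,x}; g(t,x,·)⟩ dx`. -/
def tot (V : Kernel (ℝ × Torus d) (Phase d)) (g : (ℝ × Torus d) × Phase d → ℝ) (t : ℝ) : ℝ :=
  ∫ x, ∫ z, g ((t, x), z) ∂V (t, x)

variable {g h : (ℝ × Torus d) × Phase d → ℝ}

theorem measurePreserving_fst_slab [IsMarkovKernel V] :
    MeasurePreserving Prod.fst (slab d T ⊗ₘ V) (slab d T) :=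
  ⟨measurable_fst, Measure.fst_compProd _ _⟩

theorem ae_integrable_of_compProd [IsMarkovKernel V] {G : Type*} [NormedAddCommGroup G]
    {g : (ℝ × Torus d) × Phase d → G} (hg : Integrable g (slab d T ⊗ₘ V)) :
    ∀ᵐ t ∂volume.restrict (Ioo 0 T), ∀ᵐ x ∂(volume : Measure (Torus d)),
      Integrable (fun z => g ((t, x), z)) (V (t, x)) :=
  ae_ae_of_ae_slab ((Measure.integrable_compProd_iff hg.1).1 hg).1

theorem integrable_integral_kernel [IsMarkovKernel V] (hg : Integrable g (slab d T ⊗ₘ V)) :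
    Integrable (fun q => ∫ z, g (q, z) ∂V q) (slab d T) := by
  rw [Measure.compProd] at hg
  simpa using hg.integral_compProd

theorem ae_integrable_integral_kernel [IsMarkovKernel V] (hg : Integrable g (slab d T ⊗ₘ V)) :
    ∀ᵐ t ∂volume.restrict (Ioo 0 T), Integrable fun x => ∫ z, g ((t, x), z) ∂V (t, x) := by
  have h := integrable_integral_kernel hg
  rw [slab_eq_prod] at h
  exact h.prod_right_ae

theorem integrableOn_tot [IsMarkovKernel V] (hg : Integrable g (slab d T ⊗ₘ V)) :
    IntegrableOn (tot V g) (Ioo 0 T) := by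
  have h := integrable_integral_kernel hg
  rw [slab_eq_prod] at h
  exact h.integral_prod_left

/-- Only for almost every time: integrability over space, time and phase passes to time slices by
Fubini, up to a null set. -/
theorem tot_add [IsMarkovKernel V] (hg : Integrable g (slab d T ⊗ₘ V))
    (hh : Integrable h (slab d T ⊗ₘ V)) :
    ∀ᵐ t ∂volume.restrict (Ioo 0 T), tot V (fun q => g q + h q) t = tot V g t + tot V h t := by
  filter_upwards [ae_integrable_of_compProd hg, ae_integrable_of_compProd hh,
    ae_integrable_integral_kernel hg, ae_integrable_integral_kernel hh] with t h1 h2 h3 h4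
  unfold tot
  rw [← integral_add h3 h4]
  refine integral_congr_ae ?_
  filter_upwards [h1, h2] with x h5 h6
  exact integral_add h5 h6

theorem tot_neg (g : (ℝ × Torus d) × Phase d → ℝ) (t : ℝ) :
    tot V (fun q => -g q) t = -tot V g t := by
  simp [tot, integral_neg]

theorem tot_sub [IsMarkovKernel V] (hg : Integrable g (slab d T ⊗ₘ V))
    (hh : Integrable h (slab d T ⊗ₘ V)) :
    ∀ᵐ t ∂volume.restrict (Ioo 0 T), tot V (fun q => g q - h q) t = tot V g t - tot V h t := by
  filter_upwards [tot_add hg hh.neg] with t ht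
  have h1 : tot V (-h) t = -tot V h t := tot_neg h t
  simp only [sub_eq_add_neg]
  simp only [Pi.neg_apply] at ht
  rw [ht, h1]

theorem tot_const_mul (c : ℝ) (g : (ℝ × Torus d) × Phase d → ℝ) (t : ℝ) :
    tot V (fun q => c * g q) t = c * tot V g t := by
  simp [tot, integral_const_mul]

theorem tot_nonneg (hg : ∀ q, 0 ≤ g q) (t : ℝ) : 0 ≤ tot V g t :=
  integral_nonneg fun _ => integral_nonneg fun _ => hg _

/-- The total of a quantity that does not depend on the phase variable. -/
theorem tot_fst [IsMarkovKernel V] (c : ℝ × Torus d → ℝ) (t : ℝ) :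
    tot V (fun q => c q.1) t = ∫ x, c (t, x) := by
  simp [tot]

theorem tot_congr_of_mem {t : ℝ} (hgh : ∀ x z, g ((t, x), z) = h ((t, x), z)) :
    tot V g t = tot V h t := by
  simp only [tot, hgh]

theorem tot_mono [IsMarkovKernel V] (hg : Integrable g (slab d T ⊗ₘ V))
    (hh : Integrable h (slab d T ⊗ₘ V)) (hle : ∀ᵐ q ∂slab d T, ∀ z, g (q, z) ≤ h (q, z)) :
    ∀ᵐ t ∂volume.restrict (Ioo 0 T), tot V g t ≤ tot V h t := by
  filter_upwards [ae_integrable_of_compProd hg, ae_integrable_of_compProd hh,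
    ae_integrable_integral_kernel hg, ae_integrable_integral_kernel hh,
    ae_ae_of_ae_slab hle] with t h1 h2 h3 h4 h7
  refine integral_mono_ae h3 h4 ?_
  filter_upwards [h1, h2, h7] with x h5 h6 h8
  exact integral_mono h5 h6 h8

theorem exists_ae_bound {α : Type*} {m : MeasurableSpace α} {μ : Measure α} {f : α → ℝ}
    (hf : MemLp f ∞ μ) : ∃ M : ℝ, 0 ≤ M ∧ ∀ᵐ x ∂μ, |f x| ≤ M := by
  refine ⟨(eLpNormEssSup f μ).toReal, ENNReal.toReal_nonneg, ?_⟩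
  have hfin : eLpNormEssSup f μ ≠ ∞ := by
    have := hf.2.ne
    rwa [eLpNorm_exponent_top] at this
  filter_upwards [ae_le_eLpNormEssSup (f := f) (μ := μ)] with x hx
  have := ENNReal.toReal_mono hfin hx
  simpa using this

/-- A non-negative quantity with vanishing total vanishes almost surely. -/
theorem ae_eq_zero_of_tot_eq_zero [IsMarkovKernel V] (hg : Integrable g (slab d T ⊗ₘ V))
    {a : ℝ} (haT : a ≤ T) (hpos : ∀ t ∈ Ioo 0 a, ∀ x z, 0 ≤ g ((t, x), z))
    (h0 : ∀ᵐ t ∂volume.restrict (Ioo 0 a), tot V g t = 0) :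
    ∀ᵐ q ∂slab d a, ∀ᵐ z ∂V q, g (q, z) = 0 := by
  have hsub : slab d a ≤ slab d T :=
    Measure.restrict_mono (prod_mono (Ioo_subset_Ioo_right haT) subset_rfl) le_rfl
  have hint : Integrable (fun q => ∫ z, g (q, z) ∂V q) (slab d a) :=
    (integrable_integral_kernel hg).mono_measure hsub
  have hae : ∀ᵐ q ∂slab d a, Integrable (fun z => g (q, z)) (V q) :=
    (((Measure.integrable_compProd_iff hg.1).1 hg).1).filter_mono (ae_mono hsub)
  have h1 : ∫ q, ∫ z, g (q, z) ∂V q ∂slab d a = 0 := by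
    rw [slab_eq_prod] at hint ⊢
    rw [integral_prod _ hint]
    exact integral_eq_zero_of_ae h0
  have hn : 0 ≤ᵐ[slab d a] fun q => ∫ z, g (q, z) ∂V q := by
    filter_upwards [ae_slab_mem] with q hq
    exact integral_nonneg fun z => hpos q.1 hq q.2 z
  rw [integral_eq_zero_iff_of_nonneg_ae hn hint] at h1
  filter_upwards [h1, hae, ae_slab_mem] with q h2 h3 h4
  exact (integral_eq_zero_iff_of_nonneg (fun z => hpos q.1 h4 q.2 z) h3).1 h2

theorem intervalIntegral_congr_ae_Ioo {f g : ℝ → ℝ} {a τ : ℝ} (hτ : 0 ≤ τ) (hτa : τ ≤ a)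
    (h : ∀ᵐ t ∂volume.restrict (Ioo 0 a), f t = g t) :
    ∫ t in (0 : ℝ)..τ, f t = ∫ t in (0 : ℝ)..τ, g t := by
  rw [intervalIntegral.integral_of_le hτ, intervalIntegral.integral_of_le hτ,
    integral_Ioc_eq_integral_Ioo, integral_Ioc_eq_integral_Ioo]
  exact integral_congr_ae (ae_restrict_of_ae_restrict_of_subset (Ioo_subset_Ioo_right hτa) h)

theorem intervalIntegral_mono_ae_Ioo {f g : ℝ → ℝ} {a τ : ℝ} (hτ : 0 ≤ τ) (hτa : τ ≤ a)
    (hf : IntegrableOn f (Ioo 0 a)) (hg : IntegrableOn g (Ioo 0 a))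
    (h : ∀ᵐ t ∂volume.restrict (Ioo 0 a), f t ≤ g t) :
    ∫ t in (0 : ℝ)..τ, f t ≤ ∫ t in (0 : ℝ)..τ, g t := by
  rw [intervalIntegral.integral_of_le hτ, intervalIntegral.integral_of_le hτ,
    integral_Ioc_eq_integral_Ioo, integral_Ioc_eq_integral_Ioo]
  exact integral_mono_ae (hf.mono_set (Ioo_subset_Ioo_right hτa))
    (hg.mono_set (Ioo_subset_Ioo_right hτa))
    (ae_restrict_of_ae_restrict_of_subset (Ioo_subset_Ioo_right hτa) h)

theorem intervalIntegrable_of_Ioo {f : ℝ → ℝ} {a τ : ℝ} (hτ : 0 ≤ τ) (hτa : τ ≤ a)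
    (hf : IntegrableOn f (Ioo 0 a)) : IntervalIntegrable f volume 0 τ := by
  rw [intervalIntegrable_iff_integrableOn_Ioo_of_le hτ]
  exact hf.mono_set (Ioo_subset_Ioo_right hτa)

end Total

/-! ### The density is deterministic. -/

section Concentration

variable {d : ℕ} {γ T : ℝ} {V₀ : Kernel (Torus d) (Phase₀ d)} {V : Kernel (ℝ × Torus d) (Phase d)}

theorem FiniteEnergy.memLp_mom (h : FiniteEnergy γ T V₀ V) :
    MemLp (fun q : (ℝ × Torus d) × Phase d => q.2.2.1) 2 (slab d T ⊗ₘ V) :=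
  (memLp_two_iff_integrable_sq_norm (by fun_prop)).2 h.kinetic

theorem FiniteEnergy.memLp_gradQ (h : FiniteEnergy γ T V₀ V) :
    MemLp (fun q : (ℝ × Torus d) × Phase d => q.2.2.2) 2 (slab d T ⊗ₘ V) :=
  (memLp_two_iff_integrable_sq_norm (by fun_prop)).2 h.dissipation

theorem FiniteEnergy.integrable_density [IsMarkovKernel V] (hγ : 1 ≤ γ)
    (h : FiniteEnergy γ T V₀ V) :
    Integrable (fun q : (ℝ × Torus d) × Phase d => (q.2.1 : ℝ)) (slab d T ⊗ₘ V) := by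
  refine Integrable.mono' ((integrable_const (1 : ℝ)).add (h.potential.const_mul (γ + 1)))
    (by fun_prop) (Eventually.of_forall fun q => ?_)
  rw [Real.norm_of_nonneg (NNReal.coe_nonneg _)]
  exact le_one_add_E hγ q.2.1.2

theorem FiniteEnergy.memLp_sqrt [IsMarkovKernel V] (hγ : 1 ≤ γ) (h : FiniteEnergy γ T V₀ V) :
    MemLp (fun q : (ℝ × Torus d) × Phase d => √(q.2.1 : ℝ)) 2 (slab d T ⊗ₘ V) := by
  refine (memLp_two_iff_integrable_sq (by fun_prop)).2 ?_
  refine (h.integrable_density hγ).congr (Eventually.of_forall fun q => ?_)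
  exact (Real.sq_sqrt q.2.1.2).symm

theorem rho_nonneg (V : Kernel (ℝ × Torus d) (Phase d)) (t : ℝ) (x : Torus d) :
    0 ≤ rho V t x :=
  integral_nonneg fun z => z.1.2

/-- The density is deterministic: the parametrized measure is concentrated on `r = ϱ`. -/
theorem density_concentrated [IsMarkovKernel V] (hγ : 1 ≤ γ) (h : FiniteEnergy γ T V₀ V)
    (hr : Regularity γ T V) : ∀ᵐ q ∂slab d T, ∀ᵐ z ∂V q, (z.1 : ℝ) = rho V q.1 q.2 := by
  have h1 := ((Measure.integrable_compProd_iff (h.integrable_density hγ).1).1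
    (h.integrable_density hγ)).1
  have h2i := (h.memLp_sqrt hγ).integrable (by norm_num)
  have h2 := ((Measure.integrable_compProd_iff h2i.1).1 h2i).1
  filter_upwards [(hr.density_pow (1 / 2) (by norm_num) (by linarith)).1, h1, h2] with q h3 h4 h5
  set ρ := rho V q.1 q.2
  have hρ : 0 ≤ ρ := rho_nonneg V _ _
  have e1 : ∫ z, (z.1 : ℝ) ∂V q = ρ := rfl
  have e2 : ∫ z, √(z.1 : ℝ) ∂V q = √ρ := by
    rw [Real.sqrt_eq_rpow, h3]
    simp only [avg, Real.sqrt_eq_rpow]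
  -- The mean of this square is ϱ - 2√ϱ⟨√r⟩ + ϱ. It vanishes because ⟨√r⟩ = √ϱ, the power identity
  -- at exponent ½.
  have e3 : ∀ z : Phase d, (√(z.1 : ℝ) - √ρ) ^ 2 = (z.1 : ℝ) - 2 * √ρ * √(z.1 : ℝ) + ρ := by
    intro z
    have h6 := Real.sq_sqrt z.1.2
    have h7 := Real.sq_sqrt hρ
    simp only [NNReal.val_eq_coe] at h6
    nlinarith
  have hi : Integrable (fun z : Phase d => (√(z.1 : ℝ) - √ρ) ^ 2) (V q) := by
    simp only [e3]
    exact (h4.sub (h5.const_mul _)).add (integrable_const _)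
  have e4 : ∫ z, (√(z.1 : ℝ) - √ρ) ^ 2 ∂V q = 0 := by
    simp only [e3]
    have h6 : Integrable (fun z : Phase d => (z.1 : ℝ) - 2 * √ρ * √(z.1 : ℝ)) (V q) :=
      h4.sub (h5.const_mul _)
    rw [integral_add h6 (integrable_const _),
      integral_sub h4 (h5.const_mul (2 * √ρ)), integral_const_mul, e1, e2]
    have := Real.mul_self_sqrt hρ
    simp
    linarith
  rw [integral_eq_zero_iff_of_nonneg (fun z => sq_nonneg _) hi] at e4
  filter_upwards [e4] with z hz
  have h8 : √(z.1 : ℝ) - √ρ = 0 := by simpa using hz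
  exact (Real.sqrt_inj z.1.2 hρ).1 (sub_eq_zero.1 h8)

end Concentration

/-! ### The quadratic form of the fluctuations. -/

section Algebra

variable {H : Type*} [NormedAddCommGroup H] [InnerProductSpace ℝ H]

/-- The algebraic identity behind the relative energy: `Z = z - s v` and `Y = q - s P` are the
fluctuations of the momentum and of the gradient variable. -/
theorem fluctuation_identity (z q v P : H) (L : H →ₗ[ℝ] H) (s R c : ℝ) :
    inner ℝ z q - ‖q‖ ^ 2
        + (s ^ 2 * (inner ℝ v (-L (v - P)) - c)
          + s * (inner ℝ v (L (z - q)) - inner ℝ P (z - q)))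
        - (s * inner ℝ z (-L (v - P)) + inner ℝ z (L (z - q))) + R * c
      = -inner ℝ (z - s • v) (L ((z - s • v) - (q - s • P)))
        + inner ℝ (z - s • v) (q - s • P) - ‖q - s • P‖ ^ 2
        + s * inner ℝ q (v - P) - s ^ 2 * inner ℝ (v - P) P - (s ^ 2 - R) * c := by
  -- In the application `s` is √r, `R` the strong density, `P` = ∇p(R), `c` = ∂ₜp(R), `L` the
  -- gradient of `v`, and -L(v - P) is ∂ₜv by the transport equation. Only linearity of `L` is
  -- needed for the expansion.
  simp only [← real_inner_self_eq_norm_sq, map_sub, map_smul, inner_sub_left, inner_sub_right,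
    inner_smul_left, inner_smul_right, inner_neg_right, RCLike.conj_to_real]
  rw [real_inner_comm q P, real_inner_comm z P, real_inner_comm q v]
  ring

/-- The mixed terms add up to (A + 1)|Z||Y| ≤ ½(A + 1)²|Z|² + ½|Y|², so half of the dissipation |Y|²
pays for them and the other half survives. The term A|Z|² accounts for the summand 2A. -/
theorem fluctuation_bound {Z Y : H} {L : H →ₗ[ℝ] H} {A S e γ σ : ℝ} (hγ : 0 ≤ γ) (hA : 0 ≤ A)
    (hL : ∀ y, ‖L y‖ ≤ A * ‖y‖) (he : 0 ≤ e) (hσ : |σ| ≤ S) :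
    -inner ℝ Z (L (Z - Y)) + inner ℝ Z Y - ‖Y‖ ^ 2 - γ * e * σ ≤
      (2 * A + (A + 1) ^ 2 + γ * S) * (1 / 2 * ‖Z‖ ^ 2 + e) - 1 / 2 * ‖Y‖ ^ 2 := by
  have h1 : -inner ℝ Z (L (Z - Y)) ≤ ‖Z‖ * (A * (‖Z‖ + ‖Y‖)) := by
    refine (neg_le_abs _).trans ((abs_real_inner_le_norm _ _).trans ?_)
    refine mul_le_mul_of_nonneg_left ((hL _).trans ?_) (norm_nonneg _)
    exact mul_le_mul_of_nonneg_left (norm_sub_le _ _) hA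
  have h2 : inner ℝ Z Y ≤ ‖Z‖ * ‖Y‖ := real_inner_le_norm _ _
  have h3 : -(γ * e * σ) ≤ γ * e * S := by
    have := mul_le_mul_of_nonneg_left ((neg_le_abs σ).trans hσ) (mul_nonneg hγ he)
    linarith
  have h4 : 0 ≤ S := (abs_nonneg _).trans hσ
  have h5 : 0 ≤ γ * S * ‖Z‖ ^ 2 := by positivity
  have h6 : 0 ≤ (2 * A + (A + 1) ^ 2) * e := by positivity
  nlinarith [sq_nonneg ((A + 1) * ‖Z‖ - ‖Y‖)]

end Algebra

/-! ### Derivatives of the test fields built from the strong solution. -/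

section BackgroundFields

variable {d : ℕ} {γ T a : ℝ}

/-- The gradient of a vector field, as a linear map: `y ↦ ∑ⱼ yⱼ ∂ⱼ φ`. -/
def lin (φ : Torus d → Vec d) (x : Torus d) : Vec d →ₗ[ℝ] Vec d where
  toFun y := ∑ j, y j • pd j φ x
  map_add' y z := by simp [add_smul, Finset.sum_add_distrib]
  map_smul' c y := by simp [Finset.smul_sum, smul_smul]

theorem lin_apply (φ : Torus d → Vec d) (x : Torus d) (y : Vec d) :
    lin φ x y = ∑ j, y j • pd j φ x := rfl

theorem inner_lin (φ : Torus d → Vec d) (x : Torus d) (z y : Vec d) :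
    inner ℝ z (lin φ x y) = ∑ i, ∑ j, z i * y j * (pd j φ x) i := by
  rw [lin_apply, inner_sum, Finset.sum_comm]
  refine Finset.sum_congr rfl fun j _ => ?_
  rw [inner_smul_right, PiLp.inner_apply, Finset.mul_sum]
  exact Finset.sum_congr rfl fun i _ => by simp; ring

theorem norm_lin_le {φ : Torus d → Vec d} {x : Torus d} {M : ℝ} (hM : ∀ j, ‖pd j φ x‖ ≤ M)
    (y : Vec d) : ‖lin φ x y‖ ≤ d * M * ‖y‖ := by
  rw [lin_apply]
  refine (norm_sum_le _ _).trans ?_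
  have : ∀ j ∈ Finset.univ, ‖y j • pd j φ x‖ ≤ ‖y‖ * M := fun j _ => by
    rw [norm_smul]
    exact mul_le_mul (PiLp.norm_apply_le y j) (hM j) (norm_nonneg _) (norm_nonneg _)
  refine (Finset.sum_le_sum this).trans (le_of_eq ?_)
  simp
  ring

theorem inner_grad (f : Torus d → ℝ) (x : Torus d) (y : Vec d) :
    inner ℝ y (grad f x) = ∑ j, y j * pd j f x := by
  simp [PiLp.inner_apply, grad, mul_comm]

theorem IsC1.p_comp {r : ℝ → Torus d → ℝ} (hr : IsC1 T r) (hpos : ∀ t ∈ Icc 0 T, ∀ x, 0 < r t x) :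
    IsC1 T fun t x => p γ (r t x) :=
  ContDiffOn.rpow_const_of_ne hr fun q hq => (hpos q.1 hq.1 _).ne'

theorem IsC1.E_comp (hγ : 1 ≤ γ) {r : ℝ → Torus d → ℝ} (hr : IsC1 T r)
    (hpos : ∀ t ∈ Icc 0 T, ∀ x, 0 < r t x) : IsC1 T fun t x => γ * E γ (r t x) := by
  simp only [E_eq hγ]
  exact contDiffOn_const.mul ((ContDiffOn.rpow_const_of_ne hr
    fun q hq => (hpos q.1 hq.1 _).ne').div_const _)

theorem IsC1.inv_comp {r : ℝ → Torus d → ℝ} (hr : IsC1 T r)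
    (hpos : ∀ t ∈ Icc 0 T, ∀ x, 0 < r t x) : IsC1 T fun t x => (r t x)⁻¹ :=
  ContDiffOn.inv hr fun q hq => (hpos q.1 hq.1 _).ne'

/-- The test function `½|w|² - p(ϱ)` for the continuity equation. -/
def densityTest (γ : ℝ) (r : ℝ → Torus d → ℝ) (v : ℝ → Torus d → Vec d) (t : ℝ) (x : Torus d) : ℝ :=
  1 / 2 * ‖v t x‖ ^ 2 - p γ (r t x)

variable {r : ℝ → Torus d → ℝ} {v : ℝ → Torus d → Vec d}

theorem Background.isC1_densityTest (h : Background γ T a r v) : IsC1 T (densityTest γ r v) :=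
  (contDiffOn_const.mul (ContDiffOn.norm_sq ℝ h.velocity)).sub (h.density.p_comp h.pos)

theorem Background.hasPd_velocity (h : Background γ T a r v) {t : ℝ} (ht : t ∈ Icc 0 T)
    (j : Fin d) (x : Torus d) : HasPd j (v t) (pd j (v t) x) x :=
  hasPd (h.velocity.contDiff_lift ht) j x

theorem Background.hasPd_density (h : Background γ T a r v) {t : ℝ} (ht : t ∈ Icc 0 T)
    (j : Fin d) (x : Torus d) : HasPd j (r t) (pd j (r t) x) x :=
  hasPd (h.density.contDiff_lift ht) j x

theorem hasPd_norm_sq {j : Fin d} {f : Torus d → Vec d} {f' : Vec d} {x : Torus d}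
    (hf : HasPd j f f' x) : HasPd j (fun y => ‖f y‖ ^ 2) (2 * inner ℝ (f x) f') x := by
  simpa [HasPd] using HasDerivAt.norm_sq hf

theorem Background.pd_densityTest (h : Background γ T a r v) {t : ℝ} (ht : t ∈ Icc 0 T)
    (j : Fin d) (x : Torus d) :
    pd j (densityTest γ r v t) x =
      inner ℝ (v t x) (pd j (v t) x) - pd j (fun y => p γ (r t y)) x := by
  have h1 : HasPd j (fun y => 1 / 2 * ‖v t y‖ ^ 2) (1 / 2 * (2 * inner ℝ (v t x) (pd j (v t) x))) x :=
    HasDerivAt.const_mul _ (hasPd_norm_sq (h.hasPd_velocity ht j x))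
  have h2 := hasPd ((h.density.p_comp (γ := γ) h.pos).contDiff_lift ht) j x
  have h3 := (h1.sub h2).pd_eq
  rw [show (densityTest γ r v t) = fun y => 1 / 2 * ‖v t y‖ ^ 2 - p γ (r t y) from rfl, h3]
  ring

theorem Background.inner_grad_densityTest (h : Background γ T a r v) {t : ℝ} (ht : t ∈ Icc 0 T)
    (x : Torus d) (y : Vec d) :
    inner ℝ y (grad (densityTest γ r v t) x) =
      inner ℝ (v t x) (lin (v t) x y) - inner ℝ (grad (fun y => p γ (r t y)) x) y := by
  rw [inner_grad, real_inner_comm y (grad (fun y => p γ (r t y)) x), inner_grad, lin_apply, inner_sum, ← Finset.sum_sub_distrib]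
  refine Finset.sum_congr rfl fun j _ => ?_
  rw [h.pd_densityTest ht, inner_smul_right]
  ring

theorem Background.dt_densityTest (h : Background γ T a r v) {t : ℝ} (ht : t ∈ Ioo 0 T)
    (x : Torus d) :
    dt (densityTest γ r v) t x =
      inner ℝ (v t x) (dt v t x) - dt (fun t x => p γ (r t x)) t x := by
  have h1 := ((h.velocity.hasDerivAt ht x).norm_sq).const_mul (1 / 2 : ℝ)
  have h2 := (h.density.p_comp (γ := γ) h.pos).hasDerivAt ht x
  have h3 := (h1.sub h2).deriv
  refine Eq.trans h3 ?_
  ring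

theorem Background.dt_velocity (h : Background γ T a r v) {t : ℝ} (ht : t ∈ Ioo 0 a)
    (x : Torus d) : dt v t x = -lin (v t) x (vel γ r v t x) := by
  ext i
  rw [h.transport t ht x i, lin_apply]
  simp [Finset.sum_apply]

/-- The divergence of the velocity, expressed through the continuity equation. -/
def divVel (γ : ℝ) (r : ℝ → Torus d → ℝ) (v : ℝ → Torus d → Vec d) (t : ℝ) (x : Torus d) : ℝ :=
  -((dt r t x + ∑ j, vel γ r v t x j * pd j (r t) x) * (r t x)⁻¹)

/-- The velocity u is only known to be smooth slice by slice for t < a, so its divergence does not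
directly give a bounded measurable coefficient on the slab. `divVel` is built from C¹ data on all of
(0, T) and agrees with div u where the continuity equation holds. -/
theorem Background.divVel_eq (h : Background γ T a r v) (haT : a ≤ T) {t : ℝ} (ht : t ∈ Ioo 0 a)
    (x : Torus d) : divVel γ r v t x = ∑ j, pd j (fun y => vel γ r v t y j) x := by
  have hpos := h.pos t ⟨ht.1.le, ht.2.le.trans haT⟩ x
  rw [divVel, h.continuity t ht x, Finset.sum_add_distrib, ← Finset.mul_sum]
  have : ∑ j, vel γ r v t x j * pd j (r t) x = ∑ j, pd j (r t) x * vel γ r v t x j :=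
    Finset.sum_congr rfl fun j _ => mul_comm _ _
  rw [this]
  field_simp
  ring

theorem Background.pd_p (hγ : 1 ≤ γ) (h : Background γ T a r v) {t : ℝ} (ht : t ∈ Icc 0 T)
    (j : Fin d) (x : Torus d) :
    pd j (fun y => p γ (r t y)) x = γ * r t x ^ (γ - 1) * pd j (r t) x := by
  rw [((h.hasPd_density ht j x).scomp (hasDerivAt_p hγ (r t x))).pd_eq, smul_eq_mul, mul_comm]

theorem Background.dt_p (hγ : 1 ≤ γ) (h : Background γ T a r v) {t : ℝ} (ht : t ∈ Ioo 0 T)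
    (x : Torus d) :
    dt (fun t x => p γ (r t x)) t x = γ * r t x ^ (γ - 1) * dt r t x :=
  (HasDerivAt.comp (h₂ := p γ) t (hasDerivAt_p hγ (r t x)) (h.density.hasDerivAt ht x)).deriv

theorem Background.dt_E (hγ : 1 ≤ γ) (h : Background γ T a r v) {t : ℝ} (ht : t ∈ Ioo 0 T)
    (x : Torus d) :
    dt (fun t x => γ * E γ (r t x)) t x = r t x * dt (fun t x => p γ (r t x)) t x := by
  have h1 := (((hasDerivAt_E hγ (r t x)).comp t (h.density.hasDerivAt ht x)).const_mul γ).deriv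
  refine Eq.trans h1 ?_
  rw [h.dt_p hγ ht]
  have := mul_deriv_p (γ := γ) (h.pos t (Ioo_subset_Icc_self ht) x)
  linear_combination (-dt r t x) * this

/-- The continuity equation multiplied by p'(r), with r p' = γ p. -/
theorem Background.dt_p_eq (hγ : 1 ≤ γ) (h : Background γ T a r v) (haT : a ≤ T) {t : ℝ}
    (ht : t ∈ Ioo 0 a) (x : Torus d) :
    dt (fun t x => p γ (r t x)) t x =
      -inner ℝ (vel γ r v t x) (grad (fun y => p γ (r t y)) x)
        - γ * p γ (r t x) * divVel γ r v t x := by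
  have htT : t ∈ Ioo 0 T := ⟨ht.1, ht.2.trans_le haT⟩
  have hpos := h.pos t (Ioo_subset_Icc_self htT) x
  rw [h.dt_p hγ htT, inner_grad]
  have e1 : ∑ j, vel γ r v t x j * pd j (fun y => p γ (r t y)) x =
      γ * r t x ^ (γ - 1) * ∑ j, vel γ r v t x j * pd j (r t) x := by
    rw [Finset.mul_sum]
    refine Finset.sum_congr rfl fun j _ => ?_
    rw [h.pd_p hγ (Ioo_subset_Icc_self htT)]
    ring
  rw [e1, ← mul_deriv_p hpos, divVel]
  field_simp
  ring

end BackgroundFields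

/-! ### The balance laws in terms of phase space integrands. -/

section Balance

variable {d : ℕ} {γ T : ℝ} {V₀ : Kernel (Torus d) (Phase₀ d)} {V : Kernel (ℝ × Torus d) (Phase d)}
  {D : ℝ → ℝ}

/-- The space-time integrand of the continuity equation. -/
def massFlux (ψ : ℝ → Torus d → ℝ) (q : (ℝ × Torus d) × Phase d) : ℝ :=
  q.2.1 * dt ψ q.1.1 q.1.2
    + √(q.2.1 : ℝ) * inner ℝ (q.2.2.1 - q.2.2.2) (grad (ψ q.1.1) q.1.2)

/-- The space-time integrand of the momentum equation. -/
def momFlux (φ : ℝ → Torus d → Vec d) (q : (ℝ × Torus d) × Phase d) : ℝ :=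
  √(q.2.1 : ℝ) * inner ℝ q.2.2.1 (dt φ q.1.1 q.1.2)
    + inner ℝ q.2.2.1 (lin (φ q.1.1) q.1.2 (q.2.2.1 - q.2.2.2))

theorem MemLp.fst_compProd [IsMarkovKernel V] {G : Type*} [NormedAddCommGroup G]
    {c : ℝ × Torus d → G} {p : ℝ≥0∞} (hc : MemLp c p (slab d T)) :
    MemLp (fun q : (ℝ × Torus d) × Phase d => c q.1) p (slab d T ⊗ₘ V) :=
  hc.comp_measurePreserving measurePreserving_fst_slab

theorem IsC1.memLp_top_grad (hT : 0 < T) {ψ : ℝ → Torus d → ℝ} (hψ : IsC1 T ψ) :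
    MemLp (fun q : ℝ × Torus d => grad (ψ q.1) q.2) ∞ (slab d T) :=
  memLp_toLp_of_apply fun j => hψ.memLp_top_pd hT j

theorem MemLp.apply {α : Type*} {m : MeasurableSpace α} {μ : Measure α} {p : ℝ≥0∞} {f : α → Vec d}
    (hf : MemLp f p μ) (i : Fin d) : MemLp (fun x => f x i) p μ :=
  (EuclideanSpace.proj (𝕜 := ℝ) i).comp_memLp' hf

theorem memLp_lin [IsMarkovKernel V] (hT : 0 < T) {φ : ℝ → Torus d → Vec d} (hφ : IsC1 T φ)
    {F : (ℝ × Torus d) × Phase d → Vec d} {p : ℝ≥0∞} (hF : MemLp F p (slab d T ⊗ₘ V)) :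
    MemLp (fun q => lin (φ q.1.1) q.1.2 (F q)) p (slab d T ⊗ₘ V) := by
  simp only [lin_apply]
  refine memLp_finsetSum _ fun j _ => ?_
  exact MemLp.smul (p := p) (q := ∞) (MemLp.fst_compProd (hφ.memLp_top_pd hT j)) (MemLp.apply hF j)

theorem integrable_sqrt_mul_inner [IsMarkovKernel V] (hγ : 1 ≤ γ) (h : FiniteEnergy γ T V₀ V)
    {F : (ℝ × Torus d) × Phase d → Vec d} (hF : MemLp F 2 (slab d T ⊗ₘ V))
    {c : ℝ × Torus d → Vec d} (hc : MemLp c ∞ (slab d T)) :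
    Integrable (fun q => √(q.2.1 : ℝ) * inner ℝ (F q) (c q.1)) (slab d T ⊗ₘ V) := by
  have h1 : MemLp (fun q : (ℝ × Torus d) × Phase d => √(q.2.1 : ℝ) • c q.1) 2 (slab d T ⊗ₘ V) :=
    MemLp.smul (p := 2) (q := ∞) (MemLp.fst_compProd hc) (h.memLp_sqrt hγ)
  refine (integrable_inner_of_memLp hF h1).congr (Eventually.of_forall fun q => ?_)
  simp [inner_smul_right]

theorem integrable_density_mul [IsMarkovKernel V] (hγ : 1 ≤ γ) (h : FiniteEnergy γ T V₀ V)
    {c : ℝ × Torus d → ℝ} (hc : MemLp c ∞ (slab d T)) :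
    Integrable (fun q => (q.2.1 : ℝ) * c q.1) (slab d T ⊗ₘ V) := by
  refine (integrable_mul_of_memLp_top (MemLp.fst_compProd hc) (h.integrable_density hγ)).congr
    (Eventually.of_forall fun q => mul_comm _ _)

theorem integrable_massFlux [IsMarkovKernel V] (hγ : 1 ≤ γ) (hT : 0 < T)
    (h : FiniteEnergy γ T V₀ V) {ψ : ℝ → Torus d → ℝ} (hψ : IsC1 T ψ) :
    Integrable (massFlux ψ) (slab d T ⊗ₘ V) := by
  have h1 := integrable_density_mul (V := V) hγ h (hψ.memLp_top_dt hT)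
  have h2 := integrable_sqrt_mul_inner hγ h (h.memLp_mom.sub h.memLp_gradQ)
    (hψ.memLp_top_grad hT)
  exact h1.add h2

theorem integrable_momFlux [IsMarkovKernel V] (hγ : 1 ≤ γ) (hT : 0 < T)
    (h : FiniteEnergy γ T V₀ V) {φ : ℝ → Torus d → Vec d} (hφ : IsC1 T φ) :
    Integrable (momFlux φ) (slab d T ⊗ₘ V) := by
  have h1 := integrable_sqrt_mul_inner hγ h h.memLp_mom (hφ.memLp_top_dt hT)
  have h2 := memLp_lin hT hφ (h.memLp_mom.sub h.memLp_gradQ)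
  exact h1.add (integrable_inner_of_memLp h.memLp_mom h2)

/-- Since r is almost surely constant, √r leaves the average. This reconciles products of averages,
as in the balance laws, with averages of products. -/
theorem integral_sqrt_mul_inner {q : ℝ × Torus d} {F : Phase d → Vec d}
    (hρ : ∀ᵐ z ∂V q, (z.1 : ℝ) = rho V q.1 q.2) (hF : Integrable F (V q)) (c : Vec d) :
    ∫ z, √(z.1 : ℝ) * inner ℝ (F z) c ∂V q = √(rho V q.1 q.2) * inner ℝ (∫ z, F z ∂V q) c := by
  have h1 : ∫ z, √(z.1 : ℝ) * inner ℝ (F z) c ∂V q =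
      ∫ z, √(rho V q.1 q.2) * inner ℝ c (F z) ∂V q := by
    refine integral_congr_ae ?_
    filter_upwards [hρ] with z hz
    rw [hz, real_inner_comm]
  rw [h1, integral_const_mul, integral_inner hF, real_inner_comm]

theorem ae_integrable_of_memLp [IsMarkovKernel V] {G : Type*} [NormedAddCommGroup G]
    {F : (ℝ × Torus d) × Phase d → G}
    (hF : MemLp F 2 (slab d T ⊗ₘ V)) : ∀ᵐ q ∂slab d T, Integrable (fun z => F (q, z)) (V q) := by
  have h := hF.integrable (by norm_num)
  exact ((Measure.integrable_compProd_iff h.1).1 h).1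

theorem integral_massFlux [IsMarkovKernel V] (hγ : 1 ≤ γ)
    (h : FiniteEnergy γ T V₀ V) (hr : Regularity γ T V) (ψ : ℝ → Torus d → ℝ) :
    ∀ᵐ q ∂slab d T, ∫ z, massFlux ψ (q, z) ∂V q =
      rho V q.1 q.2 * dt ψ q.1 q.2
        + √(rho V q.1 q.2) * inner ℝ (mom V q.1 q.2) (grad (ψ q.1) q.2)
        - √(rho V q.1 q.2) * inner ℝ (gradQ V q.1 q.2) (grad (ψ q.1) q.2) := by
  have hi := h.integrable_density hγ
  filter_upwards [density_concentrated hγ h hr, ae_integrable_of_memLp h.memLp_mom,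
    ae_integrable_of_memLp h.memLp_gradQ, ((Measure.integrable_compProd_iff hi.1).1 hi).1]
    with q h1 h2 h3 h4
  have h5 := integral_sqrt_mul_inner h1 (h2.sub h3) (grad (ψ q.1) q.2)
  simp only [Pi.sub_apply] at h5
  rw [integral_sub h2 h3, inner_sub_left] at h5
  have h6 : Integrable (fun z : Phase d => √(z.1 : ℝ) *
      inner ℝ (z.2.1 - z.2.2) (grad (ψ q.1) q.2)) (V q) := by
    have : Integrable (fun z : Phase d => √(rho V q.1 q.2) *
        inner ℝ (z.2.1 - z.2.2) (grad (ψ q.1) q.2)) (V q) :=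
      ((h2.sub h3).inner_const (𝕜 := ℝ) _).const_mul _
    refine this.congr ?_
    filter_upwards [h1] with z hz
    rw [hz]
  simp only [massFlux]
  rw [integral_add (h4.mul_const _) h6, integral_mul_const, h5]
  simp only [rho, mom, gradQ, avg]
  ring

/-- Written with totals of phase space functions, this balance can be combined with the others under
one integral sign, so that the cancellations become pointwise algebra. -/
theorem IsMeasureValuedSolution.continuity_tot (hV : IsMeasureValuedSolution γ T V₀ V D)
    (hγ : 1 ≤ γ) {ψ : ℝ → Torus d → ℝ} (hψ : IsC1 T ψ) :
    ∀ᵐ τ ∂volume.restrict (Ioo 0 T),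
      tot V (fun q => (q.2.1 : ℝ) * ψ q.1.1 q.1.2) τ
          - (∫ x, avg₀ V₀ (fun z => (z.1 : ℝ)) x * ψ 0 x)
        = ∫ t in (0 : ℝ)..τ, tot V (massFlux ψ) t := by
  have := hV.markov
  filter_upwards [hV.continuity, ae_restrict_mem measurableSet_Ioo] with τ h1 hτ
  have h2 := h1 ψ hψ
  have e1 : tot V (fun q => (q.2.1 : ℝ) * ψ q.1.1 q.1.2) τ = ∫ x, rho V τ x * ψ τ x := by
    simp only [tot, rho, avg, integral_mul_const]
  rw [e1, h2]
  refine intervalIntegral_congr_ae_Ioo hτ.1.le hτ.2.le ?_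
  filter_upwards [ae_ae_of_ae_slab (integral_massFlux hγ hV.finite_energy hV.regularity ψ)] with t ht
  refine integral_congr_ae ?_
  filter_upwards [ht] with x hx
  exact hx.symm

theorem integral_momFlux [IsMarkovKernel V] (hγ : 1 ≤ γ)
    (h : FiniteEnergy γ T V₀ V) (hr : Regularity γ T V) (φ : ℝ → Torus d → Vec d) :
    ∀ᵐ q ∂slab d T, ∫ z, momFlux φ (q, z) ∂V q =
      √(rho V q.1 q.2) * inner ℝ (mom V q.1 q.2) (dt φ q.1 q.2)
        + (∑ i, ∑ j, avg V (fun z => z.2.1 i * z.2.1 j) q.1 q.2 * (pd j (φ q.1) q.2) i)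
        - (∑ i, ∑ j, avg V (fun z => z.2.1 i * z.2.2 j) q.1 q.2 * (pd j (φ q.1) q.2) i) := by
  have hzz : ∀ᵐ q ∂slab d T, ∀ i j, Integrable (fun z : Phase d => z.2.1 i * z.2.1 j) (V q) := by
    rw [ae_all_iff]; intro i
    rw [ae_all_iff]; intro j
    have hi := (MemLp.apply h.memLp_mom i).integrable_mul (MemLp.apply h.memLp_mom j)
    exact ((Measure.integrable_compProd_iff hi.1).1 hi).1
  have hzq : ∀ᵐ q ∂slab d T, ∀ i j, Integrable (fun z : Phase d => z.2.1 i * z.2.2 j) (V q) := by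
    rw [ae_all_iff]; intro i
    rw [ae_all_iff]; intro j
    have hi := (MemLp.apply h.memLp_mom i).integrable_mul (MemLp.apply h.memLp_gradQ j)
    exact ((Measure.integrable_compProd_iff hi.1).1 hi).1
  filter_upwards [density_concentrated hγ h hr, ae_integrable_of_memLp h.memLp_mom, hzz, hzq]
    with q h1 h2 h3 h4
  have h5 := integral_sqrt_mul_inner h1 h2 (dt φ q.1 q.2)
  have h6 : Integrable (fun z : Phase d => √(z.1 : ℝ) * inner ℝ z.2.1 (dt φ q.1 q.2)) (V q) := by
    have : Integrable (fun z : Phase d => √(rho V q.1 q.2) *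
        inner ℝ z.2.1 (dt φ q.1 q.2)) (V q) :=
      (h2.inner_const (𝕜 := ℝ) _).const_mul _
    refine this.congr ?_
    filter_upwards [h1] with z hz
    rw [hz]
  have e1 : ∀ z : Phase d, momFlux φ (q, z) =
      √(z.1 : ℝ) * inner ℝ z.2.1 (dt φ q.1 q.2)
        + (∑ i, ∑ j, z.2.1 i * z.2.1 j * (pd j (φ q.1) q.2) i)
        - (∑ i, ∑ j, z.2.1 i * z.2.2 j * (pd j (φ q.1) q.2) i) := by
    intro z
    simp only [momFlux, map_sub, inner_sub_right, inner_lin]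
    ring
  have h7 : Integrable (fun z : Phase d => ∑ i, ∑ j, z.2.1 i * z.2.1 j * (pd j (φ q.1) q.2) i) (V q) :=
    integrable_finsetSum _ fun i _ => integrable_finsetSum _ fun j _ => (h3 i j).mul_const _
  have h8 : Integrable (fun z : Phase d => ∑ i, ∑ j, z.2.1 i * z.2.2 j * (pd j (φ q.1) q.2) i) (V q) :=
    integrable_finsetSum _ fun i _ => integrable_finsetSum _ fun j _ => (h4 i j).mul_const _
  have h9 : Integrable (fun z : Phase d => √(z.1 : ℝ) * inner ℝ z.2.1 (dt φ q.1 q.2)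
        + (∑ i, ∑ j, z.2.1 i * z.2.1 j * (pd j (φ q.1) q.2) i)) (V q) := h6.add h7
  simp only [e1]
  rw [integral_sub h9 h8, integral_add h6 h7, h5,
    integral_finsetSum _ fun i _ => integrable_finsetSum _ fun j _ => (h3 i j).mul_const _,
    integral_finsetSum _ fun i _ => integrable_finsetSum _ fun j _ => (h4 i j).mul_const _]
  have e2 : ∀ i, ∫ z : Phase d, ∑ j, z.2.1 i * z.2.1 j * (pd j (φ q.1) q.2) i ∂V q =
      ∑ j, avg V (fun z => z.2.1 i * z.2.1 j) q.1 q.2 * (pd j (φ q.1) q.2) i := by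
    intro i
    rw [integral_finsetSum _ fun j _ => (h3 i j).mul_const _]
    simp only [integral_mul_const, avg]
  have e3 : ∀ i, ∫ z : Phase d, ∑ j, z.2.1 i * z.2.2 j * (pd j (φ q.1) q.2) i ∂V q =
      ∑ j, avg V (fun z => z.2.1 i * z.2.2 j) q.1 q.2 * (pd j (φ q.1) q.2) i := by
    intro i
    rw [integral_finsetSum _ fun j _ => (h4 i j).mul_const _]
    simp only [integral_mul_const, avg]
  simp only [e2, e3]
  rfl

theorem tot_sqrt_mul_inner [IsMarkovKernel V] (hγ : 1 ≤ γ)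
    (h : FiniteEnergy γ T V₀ V) (hr : Regularity γ T V) (φ : ℝ → Torus d → Vec d) :
    ∀ᵐ t ∂volume.restrict (Ioo 0 T),
      tot V (fun q => √(q.2.1 : ℝ) * inner ℝ q.2.2.1 (φ q.1.1 q.1.2)) t =
        ∫ x, √(rho V t x) * inner ℝ (mom V t x) (φ t x) := by
  filter_upwards [ae_ae_of_ae_slab (density_concentrated hγ h hr),
    ae_ae_of_ae_slab (ae_integrable_of_memLp h.memLp_mom)] with t h1 h2
  refine integral_congr_ae ?_
  filter_upwards [h1, h2] with x h3 h4
  exact integral_sqrt_mul_inner h3 h4 _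

/-- The momentum balance together with the bound of its defect. -/
theorem IsMeasureValuedSolution.momentum_tot (hV : IsMeasureValuedSolution γ T V₀ V D)
    (hγ : 1 ≤ γ) {φ : ℝ → Torus d → Vec d} (hφ : IsC1 T φ) :
    ∃ ξ : ℝ → ℝ, IntegrableOn ξ (Ioo 0 T) ∧ ∀ᵐ τ ∂volume.restrict (Ioo 0 T), ∃ m : ℝ,
      (∀ ε : ℝ, 0 < ε → |m| ≤
        (1 + 1 / (4 * ε)) * (∫ t in (0 : ℝ)..τ, ξ t * D t * c1Norm (φ t))
            + ε * c1NormST τ φ * D τ) ∧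
      tot V (fun q => √(q.2.1 : ℝ) * inner ℝ q.2.2.1 (φ q.1.1 q.1.2)) τ
          - (∫ x, inner ℝ (avg₀ V₀ (fun z => √(z.1 : ℝ) • z.2) x) (φ 0 x))
        = (∫ t in (0 : ℝ)..τ, tot V (momFlux φ) t) + m := by
  have := hV.markov
  obtain ⟨R, ξ, hξ, h⟩ := hV.momentum
  refine ⟨ξ, hξ, ?_⟩
  filter_upwards [h, ae_restrict_mem measurableSet_Ioo,
    tot_sqrt_mul_inner hγ hV.finite_energy hV.regularity φ] with τ h1 hτ h2
  refine ⟨defectPairing R τ φ, (h1 φ hφ).1, ?_⟩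
  rw [h2, (h1 φ hφ).2]
  congr 1
  refine intervalIntegral_congr_ae_Ioo hτ.1.le hτ.2.le ?_
  filter_upwards [ae_ae_of_ae_slab (integral_momFlux hγ hV.finite_energy hV.regularity φ)] with t ht
  refine integral_congr_ae ?_
  filter_upwards [ht] with x hx
  exact hx.symm

end Balance

/-! ### Expressions with zero mean on the torus. -/

section Cancellation

variable {d : ℕ} {γ T a : ℝ} {V₀ : Kernel (Torus d) (Phase₀ d)}
  {V : Kernel (ℝ × Torus d) (Phase d)} {D : ℝ → ℝ}
  {r : ℝ → Torus d → ℝ} {v : ℝ → Torus d → Vec d}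

theorem ae_Ioo_of_le {P : ℝ → Prop} (haT : a ≤ T) (h : ∀ᵐ t ∂volume.restrict (Ioo 0 T), P t) :
    ∀ᵐ t ∂volume.restrict (Ioo 0 a), P t :=
  ae_restrict_of_ae_restrict_of_subset (Ioo_subset_Ioo_right haT) h

/-- The chain rule `√ϱ ∇Q(ϱ) = ∇(γ E(ϱ))`, tested with a smooth field. -/
theorem tot_gradQ_inner [IsMarkovKernel V] (hγ : 1 ≤ γ) (h : FiniteEnergy γ T V₀ V)
    (hr : Regularity γ T V) :
    ∀ᵐ t ∂volume.restrict (Ioo 0 T), ∀ U : Torus d → Vec d,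
      (∀ j, ContDiff ℝ 1 (lift fun x => U x j)) →
      tot V (fun q => √(q.2.1 : ℝ) * inner ℝ q.2.2.2 (U q.1.2)
        + γ * E γ q.2.1 * ∑ j, pd j (fun y => U y j) q.1.2) t = 0 := by
  have hEi := (Measure.integrable_compProd_iff h.potential.1).1 h.potential
  -- The exceptional set of times is fixed before `U` is chosen, so the field may later depend on
  -- time.
  filter_upwards [ae_ae_of_ae_slab (density_concentrated hγ h hr),
    ae_ae_of_ae_slab (ae_integrable_of_memLp h.memLp_gradQ), ae_ae_of_ae_slab hEi.1,
    ae_integrable_integral_kernel (h.integrable_density hγ),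
    ae_integrable_integral_kernel h.potential, hr.gradient.2.2] with t h1 h2 h3 h4 h5 h6 U hU
  have hR : MemLp (fun x => √(rho V t x)) 2 volume := by
    have hm : AEStronglyMeasurable (fun x => √(rho V t x)) (volume : Measure (Torus d)) :=
      Real.continuous_sqrt.comp_aestronglyMeasurable h4.1
    refine (memLp_two_iff_integrable_sq hm).2 (h4.congr (Eventually.of_forall fun x => ?_))
    exact (Real.sq_sqrt (rho_nonneg V t x)).symm
  have hG : Integrable (fun x => γ * E γ (rho V t x)) := by
    refine (h5.const_mul γ).congr ?_
    filter_upwards [h1] with x hx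
    have : ∫ z, E γ (z.1 : ℝ) ∂V (t, x) = ∫ z, E γ (rho V t x) ∂V (t, x) :=
      integral_congr_ae (by filter_upwards [hx] with z hz; rw [hz])
    simp [this]
  have hc : ∀ j, Continuous fun x => U x j := fun j => continuous_of_lift (hU j).continuous
  have hint1 : ∀ j, Integrable fun x => √(rho V t x) * gradQ V t x j * U x j := fun j =>
    integrable_mul_of_continuous (hR.integrable_mul (MemLp.apply h6.2.1 j)) (hc j)
  have hint2 : ∀ j, Integrable fun x => γ * E γ (rho V t x) * pd j (fun y => U y j) x := fun j =>
    integrable_mul_of_continuous hG (continuous_pd (hU j) j)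
  have e1 : tot V (fun q => √(q.2.1 : ℝ) * inner ℝ q.2.2.2 (U q.1.2)
        + γ * E γ q.2.1 * ∑ j, pd j (fun y => U y j) q.1.2) t =
      ∫ x, ∑ j, (√(rho V t x) * gradQ V t x j * U x j
        + γ * E γ (rho V t x) * pd j (fun y => U y j) x) := by
    refine integral_congr_ae ?_
    filter_upwards [h1, h2, h3] with x h7 h8 h9
    have h10 : ∫ z, (√(z.1 : ℝ) * inner ℝ z.2.2 (U x)
        + γ * E γ z.1 * ∑ j, pd j (fun y => U y j) x) ∂V (t, x) =
        ∫ z, (√(rho V t x) * inner ℝ (U x) z.2.2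
        + γ * E γ (rho V t x) * ∑ j, pd j (fun y => U y j) x) ∂V (t, x) := by
      refine integral_congr_ae ?_
      filter_upwards [h7] with z hz
      rw [hz, real_inner_comm]
    refine h10.trans ?_
    rw [integral_add ((h8.const_inner (𝕜 := ℝ) _).const_mul _) (integrable_const _),
      integral_const_mul, integral_inner h8, integral_const]
    have h11 : inner ℝ (U x) (∫ z, z.2.2 ∂V (t, x)) = ∑ j, gradQ V t x j * U x j := by
      simp [PiLp.inner_apply, gradQ, avg]
    rw [h11, Finset.sum_add_distrib, Finset.mul_sum, Finset.mul_sum]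
    simp [mul_assoc, Finset.mul_sum]
  have hint : ∀ j, Integrable fun x => √(rho V t x) * gradQ V t x j * U x j
      + γ * E γ (rho V t x) * pd j (fun y => U y j) x := fun j => (hint1 j).add (hint2 j)
  rw [e1, integral_finsetSum _ fun j _ => hint j]
  refine Finset.sum_eq_zero fun j _ => ?_
  rw [integral_add (hint1 j) (hint2 j)]
  have := integral_chain_rule (f := fun x => Q γ (rho V t x)) (g := fun x => gradQ V t x j)
    (R := fun x => √(rho V t x)) (G := fun x => γ * E γ (rho V t x)) (u := fun x => U x j)
    h6.1 (MemLp.apply h6.2.1 j) hR hG j (fun ψ hψ => h6.2.2 ψ hψ j)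
    (fun x y => abs_E_sub_sub_le hγ (rho_nonneg V t x) (rho_nonneg V t y)) (hU j)
  rw [this, neg_add_cancel]

theorem Background.contDiff_density (h : Background γ T a r v) {t : ℝ} (ht : t ∈ Icc 0 T) :
    ContDiff ℝ 1 (lift (r t)) := h.density.contDiff_lift ht

/-- The integrand is div(γE(r)u), because ∇(γE(r)) = r∇p(r). -/
theorem Background.integral_div (hγ : 1 ≤ γ) (h : Background γ T a r v) (haT : a ≤ T) {t : ℝ}
    (ht : t ∈ Ioo 0 a) :
    ∫ x, (r t x * inner ℝ (vel γ r v t x) (grad (fun y => p γ (r t y)) x)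
      + γ * E γ (r t x) * divVel γ r v t x) = 0 := by
  have htT : t ∈ Icc 0 T := ⟨ht.1.le, ht.2.le.trans haT⟩
  have hE : ContDiff ℝ 1 (lift fun x => γ * E γ (r t x)) :=
    (h.density.E_comp hγ h.pos).contDiff_lift htT
  have hEu : ∀ j, ContDiff ℝ 1 (lift fun x => γ * E γ (r t x) * vel γ r v t x j) := fun j =>
    hE.mul (h.vel_smooth t ht j)
  have e1 : ∀ x, r t x * inner ℝ (vel γ r v t x) (grad (fun y => p γ (r t y)) x)
      + γ * E γ (r t x) * divVel γ r v t x =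
      ∑ j, pd j (fun x => γ * E γ (r t x) * vel γ r v t x j) x := by
    intro x
    rw [h.divVel_eq haT ht, inner_grad, Finset.mul_sum, Finset.mul_sum, ← Finset.sum_add_distrib]
    refine Finset.sum_congr rfl fun j _ => ?_
    have h1 : HasPd j (fun x => γ * E γ (r t x)) (γ * p γ (r t x) * pd j (r t) x) x := by
      have := HasPd.scomp ((hasDerivAt_E hγ (r t x)).const_mul γ) (h.hasPd_density htT j x)
      simpa [mul_comm] using this
    rw [(h1.mul (hasPd (h.vel_smooth t ht j) j x)).pd_eq, h.pd_p hγ htT]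
    have := mul_deriv_p (γ := γ) (h.pos t htT x)
    linear_combination (vel γ r v t x j * pd j (r t) x) * this
  simp only [e1]
  rw [integral_finsetSum _ fun j _ =>
    (memLp_of_continuous (continuous_pd (hEu j) j) 1).integrable le_rfl]
  exact Finset.sum_eq_zero fun j _ => integral_pd (hEu j) j

/-- The fundamental theorem of calculus for the mean of a `C¹` function over the torus. -/
theorem IsC1.integral_sub_integral (hT : 0 < T) {f : ℝ → Torus d → ℝ} (hf : IsC1 T f) {τ : ℝ}
    (hτ : τ ∈ Ioo 0 T) :
    (∫ x, f τ x) - ∫ x, f 0 x = ∫ t in (0 : ℝ)..τ, ∫ x, dt f t x := by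
  obtain ⟨M, hM0, hM, -, hMt, -⟩ := hf.exists_bound hT
  have hcont : ∀ t ∈ Icc 0 T, Continuous (f t) := fun t ht =>
    continuous_of_lift (hf.contDiff_lift ht).continuous
  have hslice : ∀ t ∈ Ioo 0 T, Continuous fun x => dt f t x := by
    intro t ht
    have h1 := hf.continuousOn_dt hT
    have : ContinuousOn (fun x : Torus d => (t, x)) univ := by fun_prop
    exact continuousOn_univ.1 (h1.comp this fun x _ => ⟨ht, mem_univ _⟩)
  refine (intervalIntegral.integral_eq_sub_of_hasDerivAt_of_le hτ.1.le
    (f := fun t => ∫ x, f t x) ?_ ?_ ?_).symm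
  · refine continuousOn_of_dominated (bound := fun _ => M) ?_ ?_ (integrable_const _) ?_
    · intro t ht
      exact (hcont t ⟨ht.1, ht.2.trans hτ.2.le⟩).aestronglyMeasurable
    · intro t ht
      exact Eventually.of_forall fun x => hM t ⟨ht.1, ht.2.trans hτ.2.le⟩ x
    · refine Eventually.of_forall fun x => ?_
      obtain ⟨y, rfl⟩ := isOpenQuotientMap_proj.surjective x
      have hy : ContinuousOn (fun t => f t (proj y)) (Icc 0 T) :=
        fun t ht => (hf.hasDerivWithinAt ht y).continuousWithinAt
      exact hy.mono (Icc_subset_Icc_right hτ.2.le)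
  · intro t ht
    have htT : t ∈ Ioo 0 T := ⟨ht.1, ht.2.trans hτ.2⟩
    refine (hasDerivAt_integral_of_dominated_loc_of_deriv_le (𝕜 := ℝ) (bound := fun _ => M)
      (F' := fun t x => dt f t x) (Ioo_mem_nhds htT.1 htT.2) ?_ ?_ ?_ ?_ (integrable_const _) ?_).2
    · filter_upwards [Ioo_mem_nhds htT.1 htT.2] with s hs
      exact (hcont s (Ioo_subset_Icc_self hs)).aestronglyMeasurable
    · exact (memLp_of_continuous (hcont t (Ioo_subset_Icc_self htT)) 1).integrable le_rfl
    · exact (hslice t htT).aestronglyMeasurable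
    · exact Eventually.of_forall fun x s hs => hMt s hs x
    · exact Eventually.of_forall fun x s hs => hf.hasDerivAt hs x
  · have h1 := (hf.memLp_top_dt hT).integrable (by simp)
    rw [slab_eq_prod] at h1
    exact intervalIntegrable_of_Ioo hτ.1.le hτ.2.le h1.integral_prod_left

end Cancellation

/-! ### The relative energy and its remainder. -/

section RelativeEnergy

variable {d : ℕ} {γ T a : ℝ} {V₀ : Kernel (Torus d) (Phase₀ d)}
  {V : Kernel (ℝ × Torus d) (Phase d)} {D : ℝ → ℝ}

/-- The momentum fluctuation `√ϱ w - √r v`. -/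
def momFluct (v : ℝ → Torus d → Vec d) (q : (ℝ × Torus d) × Phase d) : Vec d :=
  q.2.2.1 - √(q.2.1 : ℝ) • v q.1.1 q.1.2

/-- The gradient fluctuation `D_Q - √r ∇p(ϱ)`. -/
def gradFluct (γ : ℝ) (r : ℝ → Torus d → ℝ) (q : (ℝ × Torus d) × Phase d) : Vec d :=
  q.2.2.2 - √(q.2.1 : ℝ) • grad (fun y => p γ (r q.1.1 y)) q.1.2

/-- The density of the relative energy. -/
def relEnergy (γ : ℝ) (r : ℝ → Torus d → ℝ) (v : ℝ → Torus d → Vec d)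
    (q : (ℝ × Torus d) × Phase d) : ℝ :=
  1 / 2 * ‖momFluct v q‖ ^ 2 + relE γ q.2.1 (r q.1.1 q.1.2)

/-- The density of the remainder in the relative energy inequality. -/
def remainder (γ : ℝ) (r : ℝ → Torus d → ℝ) (v : ℝ → Torus d → Vec d)
    (q : (ℝ × Torus d) × Phase d) : ℝ :=
  -inner ℝ (momFluct v q) (lin (v q.1.1) q.1.2 (momFluct v q - gradFluct γ r q))
    + inner ℝ (momFluct v q) (gradFluct γ r q) - ‖gradFluct γ r q‖ ^ 2
    - γ * relE γ q.2.1 (r q.1.1 q.1.2) * divVel γ r v q.1.1 q.1.2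

variable {r : ℝ → Torus d → ℝ} {v : ℝ → Torus d → Vec d}

/-- This expansion dictates the test functions: the terms depending on the state, beyond the energy,
are linear in √r z and in r, with coefficients v and ½|v|² - p. The identity s p(s) - E(s) = γE(s)
turns the state-free part into γE of the strong density. -/
theorem relEnergy_eq (hγ : 1 ≤ γ) {q : (ℝ × Torus d) × Phase d} (hpos : 0 < r q.1.1 q.1.2) :
    relEnergy γ r v q =
      (1 / 2 * ‖q.2.2.1‖ ^ 2 + E γ q.2.1)
        - √(q.2.1 : ℝ) * inner ℝ q.2.2.1 (v q.1.1 q.1.2)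
        + q.2.1 * densityTest γ r v q.1.1 q.1.2 + γ * E γ (r q.1.1 q.1.2) := by
  have h1 : (√(q.2.1 : ℝ)) ^ 2 = q.2.1 := Real.sq_sqrt q.2.1.2
  have h2 := mul_p hγ hpos
  rw [relEnergy, momFluct, norm_sub_sq_real, inner_smul_right, norm_smul,
    Real.norm_of_nonneg (Real.sqrt_nonneg _), mul_pow, h1, relE, densityTest]
  linear_combination h2

/-- The algebraic core. The left side collects the integrands of the three balances and the time
derivative of the state-free term; by the equations of the background it becomes the remainder plus
two brackets, each of zero mean. -/
theorem Background.integrand_eq (hγ : 1 ≤ γ) (h : Background γ T a r v) (haT : a ≤ T)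
    (q : (ℝ × Torus d) × Phase d) (hq : q.1.1 ∈ Ioo 0 a) :
    inner ℝ q.2.2.1 q.2.2.2 - ‖q.2.2.2‖ ^ 2 + massFlux (densityTest γ r v) q - momFlux v q
        + dt (fun t x => γ * E γ (r t x)) q.1.1 q.1.2
      = remainder γ r v q
        + (√(q.2.1 : ℝ) * inner ℝ q.2.2.2 (vel γ r v q.1.1 q.1.2)
          + γ * E γ q.2.1 * divVel γ r v q.1.1 q.1.2)
        - (r q.1.1 q.1.2 * inner ℝ (vel γ r v q.1.1 q.1.2)
            (grad (fun y => p γ (r q.1.1 y)) q.1.2)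
          + γ * E γ (r q.1.1 q.1.2) * divVel γ r v q.1.1 q.1.2) := by
  obtain ⟨⟨t, x⟩, R, z, y⟩ := q
  simp only at hq
  have htT : t ∈ Ioo 0 T := ⟨hq.1, hq.2.trans_le haT⟩
  have htI := Ioo_subset_Icc_self htT
  have h1 : (√(R : ℝ)) ^ 2 = R := Real.sq_sqrt R.2
  have hid := fluctuation_identity z y (v t x) (grad (fun y => p γ (r t y)) x) (lin (v t) x)
    (√(R : ℝ)) (r t x) (dt (fun t x => p γ (r t x)) t x)
  have hvel : v t x - grad (fun y => p γ (r t y)) x = vel γ r v t x := rfl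
  rw [hvel, ← h.dt_velocity hq, ← h.dt_densityTest htT, ← h.inner_grad_densityTest htI, h1] at hid
  simp only [massFlux, momFlux, remainder, momFluct, gradFluct, h.dt_E hγ htT]
  have hdp := h.dt_p_eq hγ haT hq x
  simp only [relE]
  -- After ∂ₜp is replaced through the continuity equation, the density difference R - r t x enters
  -- through γ p (R - r t x) div u. This is γ(E(R) - E(r t x) - E(R | r t x)) div u, which feeds the
  -- two brackets and the remainder.
  linear_combination hid - ((R : ℝ) - r t x) * hdp

theorem IsC1.memLp_sqrt_smul [IsMarkovKernel V] (hγ : 1 ≤ γ) (h : FiniteEnergy γ T V₀ V)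
    {c : ℝ × Torus d → Vec d} (hc : MemLp c ∞ (slab d T)) :
    MemLp (fun q : (ℝ × Torus d) × Phase d => √(q.2.1 : ℝ) • c q.1) 2 (slab d T ⊗ₘ V) :=
  MemLp.smul (p := 2) (q := ∞) (MemLp.fst_compProd hc) (h.memLp_sqrt hγ)

theorem Background.memLp_momFluct [IsMarkovKernel V] (hγ : 1 ≤ γ) (hT : 0 < T)
    (h : FiniteEnergy γ T V₀ V) (hB : Background γ T a r v) :
    MemLp (momFluct v) 2 (slab d T ⊗ₘ V) :=
  h.memLp_mom.sub (IsC1.memLp_sqrt_smul hγ h (hB.velocity.memLp_top hT))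

theorem Background.memLp_gradFluct [IsMarkovKernel V] (hγ : 1 ≤ γ) (hT : 0 < T)
    (h : FiniteEnergy γ T V₀ V) (hB : Background γ T a r v) :
    MemLp (gradFluct γ r) 2 (slab d T ⊗ₘ V) :=
  h.memLp_gradQ.sub (IsC1.memLp_sqrt_smul hγ h
    ((hB.density.p_comp hB.pos).memLp_top_grad hT))

theorem Background.memLp_vel (hT : 0 < T) (hB : Background γ T a r v) :
    MemLp (fun q : ℝ × Torus d => vel γ r v q.1 q.2) ∞ (slab d T) :=
  (hB.velocity.memLp_top hT).sub ((hB.density.p_comp hB.pos).memLp_top_grad hT)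

theorem Background.memLp_divVel (hT : 0 < T) (hB : Background γ T a r v) :
    MemLp (fun q : ℝ × Torus d => divVel γ r v q.1 q.2) ∞ (slab d T) := by
  have h1 : MemLp (fun q : ℝ × Torus d => ∑ j, vel γ r v q.1 q.2 j * pd j (r q.1) q.2) ∞
      (slab d T) :=
    memLp_finsetSum _ fun j _ => MemLp.mul' (p := ∞) (q := ∞) (hB.density.memLp_top_pd hT j)
      (MemLp.apply (hB.memLp_vel hT) j)
  exact (MemLp.mul' (p := ∞) (q := ∞) ((hB.density.inv_comp hB.pos).memLp_top hT)
    ((hB.density.memLp_top_dt hT).add h1)).neg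

theorem Background.integrable_relE [IsMarkovKernel V] (hγ : 1 ≤ γ) (hT : 0 < T)
    (h : FiniteEnergy γ T V₀ V) (hB : Background γ T a r v) :
    Integrable (fun q : (ℝ × Torus d) × Phase d => relE γ q.2.1 (r q.1.1 q.1.2))
      (slab d T ⊗ₘ V) := by
  have h1 : MemLp (fun q : ℝ × Torus d => γ * E γ (r q.1 q.2)) ∞ (slab d T) :=
    (hB.density.E_comp hγ hB.pos).memLp_top hT
  have h2 : MemLp (fun q : ℝ × Torus d => p γ (r q.1 q.2)) ∞ (slab d T) :=
    (hB.density.p_comp hB.pos).memLp_top hT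
  have h3 := integrable_density_mul (V := V) hγ h h2
  have h4 : Integrable (fun q : (ℝ × Torus d) × Phase d => γ * E γ (r q.1.1 q.1.2))
      (slab d T ⊗ₘ V) := (MemLp.fst_compProd h1).integrable (by simp)
  have h5 : Integrable (fun q : (ℝ × Torus d) × Phase d => r q.1.1 q.1.2 * p γ (r q.1.1 q.1.2))
      (slab d T ⊗ₘ V) := (MemLp.fst_compProd (MemLp.mul' (p := ∞) (q := ∞) (r := ∞) h2
        (hB.density.memLp_top hT))).integrable (by simp)
  have h6 := ((h.potential.sub (h4.const_mul γ⁻¹)).sub h3).add h5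
  refine h6.congr (Eventually.of_forall fun q => ?_)
  have : γ ≠ 0 := by linarith
  simp only [Pi.add_apply, Pi.sub_apply, relE]
  rw [inv_mul_cancel_left₀ this]
  ring

theorem Background.integrable_relEnergy [IsMarkovKernel V] (hγ : 1 ≤ γ) (hT : 0 < T)
    (h : FiniteEnergy γ T V₀ V) (hB : Background γ T a r v) :
    Integrable (relEnergy γ r v) (slab d T ⊗ₘ V) := by
  have h1 := hB.memLp_momFluct hγ hT h
  have h2 := ((memLp_two_iff_integrable_sq_norm h1.1).1 h1).const_mul (1 / 2)
  exact h2.add (hB.integrable_relE hγ hT h)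

theorem Background.integrable_remainder [IsMarkovKernel V] (hγ : 1 ≤ γ) (hT : 0 < T)
    (h : FiniteEnergy γ T V₀ V) (hB : Background γ T a r v) :
    Integrable (remainder γ r v) (slab d T ⊗ₘ V) := by
  have hZ := hB.memLp_momFluct hγ hT h
  have hY := hB.memLp_gradFluct hγ hT h
  have h1 := integrable_inner_of_memLp hZ (memLp_lin hT hB.velocity (hZ.sub hY))
  have h2 := integrable_inner_of_memLp hZ hY
  have h3 := (memLp_two_iff_integrable_sq_norm hY.1).1 hY
  have h4 := integrable_mul_of_memLp_top (MemLp.fst_compProd (V := V) (hB.memLp_divVel hT))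
    ((hB.integrable_relE hγ hT h).const_mul γ)
  refine (((h1.neg.add h2).sub h3).sub h4).congr (Eventually.of_forall fun q => ?_)
  simp only [Pi.add_apply, Pi.sub_apply, Pi.neg_apply, remainder]
  ring

end RelativeEnergy

/-! ### The relative energy inequality. -/

section RelativeEnergyInequality

variable {d : ℕ} {γ T a : ℝ} {V₀ : Kernel (Torus d) (Phase₀ d)}
  {V : Kernel (ℝ × Torus d) (Phase d)} {D : ℝ → ℝ}
  {r : ℝ → Torus d → ℝ} {v : ℝ → Torus d → Vec d}

/-- The initial relative energy vanishes. -/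
theorem Background.initial_energy (hγ : 1 ≤ γ) (hT : 0 < T) (hB : Background γ T a r v)
    (h₀ : ∀ᵐ x ∂(volume : Measure (Torus d)),
      V₀ x = Measure.dirac (Real.toNNReal (r 0 x), √(r 0 x) • v 0 x)) :
    (∫ x, avg₀ V₀ (fun z => (1 / 2) * ‖z.2‖ ^ 2 + E γ z.1) x)
      - (∫ x, inner ℝ (avg₀ V₀ (fun z => √(z.1 : ℝ) • z.2) x) (v 0 x))
      + (∫ x, avg₀ V₀ (fun z => (z.1 : ℝ)) x * densityTest γ r v 0 x)
      + ∫ x, γ * E γ (r 0 x) = 0 := by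
  have h0T : (0 : ℝ) ∈ Icc 0 T := ⟨le_rfl, hT.le⟩
  have hpos := hB.pos 0 h0T
  have hrc : Continuous (r 0) := continuous_of_lift (hB.density.contDiff_lift h0T).continuous
  have hvc : Continuous (v 0) := continuous_of_lift (hB.velocity.contDiff_lift h0T).continuous
  have hEc : Continuous fun x => E γ (r 0 x) := (continuous_E hγ).comp hrc
  have hpc : Continuous fun x => p γ (r 0 x) := (continuous_p hγ).comp hrc
  have hcoe : ∀ x, ((Real.toNNReal (r 0 x) : ℝ≥0) : ℝ) = r 0 x := fun x =>
    Real.coe_toNNReal _ (hpos x).le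
  have hs : ∀ x, √(r 0 x) * √(r 0 x) = r 0 x := fun x => Real.mul_self_sqrt (hpos x).le
  have e1 : ∫ x, avg₀ V₀ (fun z => (1 / 2) * ‖z.2‖ ^ 2 + E γ z.1) x =
      ∫ x, (1 / 2 * (r 0 x * ‖v 0 x‖ ^ 2) + E γ (r 0 x)) := by
    refine integral_congr_ae ?_
    filter_upwards [h₀] with x hx
    simp only [avg₀, hx, integral_dirac, hcoe, norm_smul, mul_pow, Real.norm_eq_abs, sq_abs]
    rw [Real.sq_sqrt (hpos x).le]
  have e2 : ∫ x, inner ℝ (avg₀ V₀ (fun z => √(z.1 : ℝ) • z.2) x) (v 0 x) =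
      ∫ x, r 0 x * ‖v 0 x‖ ^ 2 := by
    refine integral_congr_ae ?_
    filter_upwards [h₀] with x hx
    simp only [avg₀, hx, integral_dirac, hcoe, smul_smul, hs, real_inner_smul_left,
      real_inner_self_eq_norm_sq]
  have e3 : ∫ x, avg₀ V₀ (fun z => (z.1 : ℝ)) x * densityTest γ r v 0 x =
      ∫ x, r 0 x * densityTest γ r v 0 x := by
    refine integral_congr_ae ?_
    filter_upwards [h₀] with x hx
    simp only [avg₀, hx, integral_dirac, hcoe]
  have hint : ∀ {f : Torus d → ℝ}, Continuous f → Integrable f := fun hf =>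
    (memLp_of_continuous hf 1).integrable le_rfl
  have hdc : Continuous fun x => densityTest γ r v 0 x := by
    unfold densityTest
    fun_prop
  have c1 : Continuous fun x => 1 / 2 * (r 0 x * ‖v 0 x‖ ^ 2) + E γ (r 0 x) := by fun_prop
  have c2 : Continuous fun x => r 0 x * ‖v 0 x‖ ^ 2 := by fun_prop
  have c3 : Continuous fun x => r 0 x * densityTest γ r v 0 x := by fun_prop
  have c4 : Continuous fun x => γ * E γ (r 0 x) := by fun_prop
  have c5 : Continuous fun x => 1 / 2 * (r 0 x * ‖v 0 x‖ ^ 2) + E γ (r 0 x)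
      - r 0 x * ‖v 0 x‖ ^ 2 := c1.sub c2
  have c6 : Continuous fun x => 1 / 2 * (r 0 x * ‖v 0 x‖ ^ 2) + E γ (r 0 x)
      - r 0 x * ‖v 0 x‖ ^ 2 + r 0 x * densityTest γ r v 0 x := c5.add c3
  rw [e1, e2, e3, ← integral_sub (hint c1) (hint c2), ← integral_add (hint c5) (hint c3),
    ← integral_add (hint c6) (hint c4)]
  -- The kinetic terms cancel as ½ - 1 + ½, and (γ + 1)E(r) - r p(r) = 0 is left.
  refine integral_eq_zero_of_ae (Eventually.of_forall fun x => ?_)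
  have := mul_p hγ (hpos x)
  simp only [densityTest, Pi.zero_apply]
  linear_combination -this

theorem integrable_energy (h : FiniteEnergy γ T V₀ V) :
    Integrable (fun q : (ℝ × Torus d) × Phase d => (1 / 2) * ‖q.2.2.1‖ ^ 2 + E γ q.2.1)
      (slab d T ⊗ₘ V) :=
  (h.kinetic.const_mul _).add h.potential

theorem Background.tot_relEnergy [IsMarkovKernel V] (hγ : 1 ≤ γ) (hT : 0 < T)
    (h : FiniteEnergy γ T V₀ V) (hB : Background γ T a r v) :
    ∀ᵐ t ∂volume.restrict (Ioo 0 T), tot V (relEnergy γ r v) t =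
      tot V (fun q => (1 / 2) * ‖q.2.2.1‖ ^ 2 + E γ q.2.1) t
        - tot V (fun q => √(q.2.1 : ℝ) * inner ℝ q.2.2.1 (v q.1.1 q.1.2)) t
        + tot V (fun q => (q.2.1 : ℝ) * densityTest γ r v q.1.1 q.1.2) t
        + ∫ x, γ * E γ (r t x) := by
  have i1 := integrable_energy h
  have i2 := integrable_sqrt_mul_inner hγ h h.memLp_mom (hB.velocity.memLp_top hT)
  have i3 := integrable_density_mul (V := V) hγ h (hB.isC1_densityTest.memLp_top hT)
  have i4 : Integrable (fun q : (ℝ × Torus d) × Phase d => γ * E γ (r q.1.1 q.1.2))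
      (slab d T ⊗ₘ V) :=
    (MemLp.fst_compProd ((hB.density.E_comp hγ hB.pos).memLp_top hT)).integrable (by simp)
  filter_upwards [tot_sub i1 i2, tot_add (i1.sub i2) i3, tot_add ((i1.sub i2).add i3) i4,
    ae_restrict_mem measurableSet_Ioo] with t h1 h2 h3 ht
  simp only [Pi.sub_apply, Pi.add_apply] at h2 h3
  have h4 := tot_fst (V := V) (fun q => γ * E γ (r q.1 q.2)) t
  rw [← h1, ← h4]
  refine Eq.trans ?_ (h3.trans (congrArg (· + _) h2))
  exact tot_congr_of_mem fun x z =>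
    relEnergy_eq hγ (q := ((t, x), z)) (hB.pos t (Ioo_subset_Icc_self ht) x)

/-- Integrating the pointwise identity leaves only the remainder: one bracket has zero total by the
weak chain rule for Q(ϱ), tested with u, the other by the classical divergence theorem. -/
theorem Background.tot_remainder [IsMarkovKernel V] (hγ : 1 ≤ γ) (hT : 0 < T) (haT : a ≤ T)
    (h : FiniteEnergy γ T V₀ V) (hr : Regularity γ T V) (hB : Background γ T a r v) :
    ∀ᵐ t ∂volume.restrict (Ioo 0 a),
      tot V (fun q => inner ℝ q.2.2.1 q.2.2.2) t - tot V (fun q => ‖q.2.2.2‖ ^ 2) t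
        + tot V (massFlux (densityTest γ r v)) t - tot V (momFlux v) t
        + (∫ x, dt (fun t x => γ * E γ (r t x)) t x) = tot V (remainder γ r v) t := by
  have i1 := integrable_inner_of_memLp h.memLp_mom h.memLp_gradQ
  have i2 := h.dissipation
  have i3 := integrable_massFlux (V := V) hγ hT h hB.isC1_densityTest
  have i4 := integrable_momFlux (V := V) hγ hT h hB.velocity
  have i5 : Integrable (fun q : (ℝ × Torus d) × Phase d =>
      dt (fun t x => γ * E γ (r t x)) q.1.1 q.1.2) (slab d T ⊗ₘ V) :=
    (MemLp.fst_compProd ((hB.density.E_comp hγ hB.pos).memLp_top_dt hT)).integrable (by simp)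
  have j1 := hB.integrable_remainder hγ hT h
  have j2 : Integrable (fun q : (ℝ × Torus d) × Phase d =>
      √(q.2.1 : ℝ) * inner ℝ q.2.2.2 (vel γ r v q.1.1 q.1.2)
          + γ * E γ q.2.1 * divVel γ r v q.1.1 q.1.2) (slab d T ⊗ₘ V) := by
    have k1 := integrable_sqrt_mul_inner hγ h h.memLp_gradQ (hB.memLp_vel hT)
    have k2 := integrable_mul_of_memLp_top (MemLp.fst_compProd (V := V) (hB.memLp_divVel hT))
      (h.potential.const_mul γ)
    exact (k1.add k2).congr (Eventually.of_forall fun q => by simp [mul_comm])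
  have j3 : Integrable (fun q : (ℝ × Torus d) × Phase d =>
      r q.1.1 q.1.2 * inner ℝ (vel γ r v q.1.1 q.1.2) (grad (fun y => p γ (r q.1.1 y)) q.1.2)
          + γ * E γ (r q.1.1 q.1.2) * divVel γ r v q.1.1 q.1.2) (slab d T ⊗ₘ V) := by
    have k1 : MemLp (fun q : ℝ × Torus d => r q.1 q.2 *
        inner ℝ (vel γ r v q.1 q.2) (grad (fun y => p γ (r q.1 y)) q.2)) ∞ (slab d T) :=
      MemLp.mul' (p := ∞) (q := ∞) (memLp_inner (p := ∞) (q := ∞) (hB.memLp_vel hT)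
        ((hB.density.p_comp hB.pos).memLp_top_grad hT)) (hB.density.memLp_top hT)
    have k2 : MemLp (fun q : ℝ × Torus d => γ * E γ (r q.1 q.2) * divVel γ r v q.1 q.2) ∞
        (slab d T) :=
      MemLp.mul' (p := ∞) (q := ∞) (hB.memLp_divVel hT)
        ((hB.density.E_comp hγ hB.pos).memLp_top hT)
    exact (MemLp.fst_compProd (k1.add k2)).integrable (by simp)
  have i12 : Integrable (fun q : (ℝ × Torus d) × Phase d =>
      inner ℝ q.2.2.1 q.2.2.2 - ‖q.2.2.2‖ ^ 2) (slab d T ⊗ₘ V) := i1.sub i2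
  have i13 : Integrable (fun q : (ℝ × Torus d) × Phase d =>
      inner ℝ q.2.2.1 q.2.2.2 - ‖q.2.2.2‖ ^ 2 + massFlux (densityTest γ r v) q)
      (slab d T ⊗ₘ V) := i12.add i3
  have i14 : Integrable (fun q : (ℝ × Torus d) × Phase d =>
      inner ℝ q.2.2.1 q.2.2.2 - ‖q.2.2.2‖ ^ 2 + massFlux (densityTest γ r v) q - momFlux v q)
      (slab d T ⊗ₘ V) := i13.sub i4
  have j12 : Integrable (fun q : (ℝ × Torus d) × Phase d => remainder γ r v q
      + (√(q.2.1 : ℝ) * inner ℝ q.2.2.2 (vel γ r v q.1.1 q.1.2)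
          + γ * E γ q.2.1 * divVel γ r v q.1.1 q.1.2)) (slab d T ⊗ₘ V) := j1.add j2
  filter_upwards [ae_Ioo_of_le haT (tot_sub i1 i2), ae_Ioo_of_le haT (tot_add i12 i3),
    ae_Ioo_of_le haT (tot_sub i13 i4), ae_Ioo_of_le haT (tot_add i14 i5),
    ae_Ioo_of_le haT (tot_add j1 j2), ae_Ioo_of_le haT (tot_sub j12 j3),
    ae_Ioo_of_le haT (tot_gradQ_inner hγ h hr),
    ae_restrict_mem measurableSet_Ioo] with t h1 h2 h3 h4 h5 h6 h7 ht
  have e1 := tot_fst (V := V) (fun q => dt (fun t x => γ * E γ (r t x)) q.1 q.2) t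
  have e2 := tot_fst (V := V) (fun q => r q.1 q.2 *
    inner ℝ (vel γ r v q.1 q.2) (grad (fun y => p γ (r q.1 y)) q.2)
          + γ * E γ (r q.1 q.2) * divVel γ r v q.1 q.2) t
  have e3 := hB.integral_div hγ haT ht
  have e4 := h7 (vel γ r v t) (hB.vel_smooth t ht)
  have e5 : tot V (fun q => √(q.2.1 : ℝ) * inner ℝ q.2.2.2 (vel γ r v q.1.1 q.1.2)
          + γ * E γ q.2.1 * divVel γ r v q.1.1 q.1.2) t = 0 := by
    rw [← e4]
    exact tot_congr_of_mem fun x z => by simp only [hB.divVel_eq haT ht]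
  rw [← h1, ← h2, ← h3, ← e1, ← h4]
  refine Eq.trans (tot_congr_of_mem fun x z => ?_) (h6.trans ?_)
  · exact hB.integrand_eq hγ haT ((t, x), z) ht
  · rw [h5, e5, e2, e3]
    ring

/-- Pointwise `fluctuation_bound`, with A = d·M from a bound M on the partial derivatives of v and S
an essential bound of `divVel`. The retained half of |Y|² later identifies the gradient variable. -/
theorem Background.tot_remainder_le [IsMarkovKernel V] (hγ : 1 ≤ γ) (hT : 0 < T)
    (h : FiniteEnergy γ T V₀ V) (hB : Background γ T a r v) :
    ∃ K : ℝ, 0 ≤ K ∧ ∀ᵐ t ∂volume.restrict (Ioo 0 T), tot V (remainder γ r v) t ≤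
      K * tot V (relEnergy γ r v) t - 1 / 2 * tot V (fun q => ‖gradFluct γ r q‖ ^ 2) t := by
  obtain ⟨S, hS0, hS⟩ := exists_ae_bound (hB.memLp_divVel hT)
  obtain ⟨M, hM0, -, hM, -⟩ := hB.velocity.exists_bound hT
  have hA : 0 ≤ (d : ℝ) * M := by positivity
  have hY := hB.memLp_gradFluct (V := V) hγ hT h
  have i1 := (hB.integrable_relEnergy (V := V) hγ hT h).const_mul
    (2 * (d * M) + (d * M + 1) ^ 2 + γ * S)
  have i2 := ((memLp_two_iff_integrable_sq_norm hY.1).1 hY).const_mul (1 / 2)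
  refine ⟨2 * (d * M) + (d * M + 1) ^ 2 + γ * S, by positivity, ?_⟩
  filter_upwards [tot_sub i1 i2, tot_mono (hB.integrable_remainder hγ hT h) (i1.sub i2) (by
    filter_upwards [hS, ae_slab_mem] with q h1 h2 z
    exact fluctuation_bound (by linarith) hA
      (norm_lin_le (hM q.1 (Ioo_subset_Icc_self h2) q.2))
      (relE_nonneg hγ z.1.2 (hB.pos q.1 (Ioo_subset_Icc_self h2) q.2)) h1)] with t h1 h2
  refine h2.trans (le_of_eq ?_)
  rw [← tot_const_mul, ← tot_const_mul]
  exact h1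

theorem c1Norm_nonneg (φ : Torus d → Vec d) : 0 ≤ c1Norm φ :=
  add_nonneg (Real.iSup_nonneg fun _ => norm_nonneg _)
    (Finset.sum_nonneg fun _ _ => Real.iSup_nonneg fun _ => norm_nonneg _)

theorem IsC1.c1Norm_bound (hT : 0 < T) {φ : ℝ → Torus d → Vec d} (hφ : IsC1 T φ) :
    ∃ M : ℝ, 0 ≤ M ∧ (∀ t ∈ Icc 0 T, c1Norm (φ t) ≤ M) ∧
      ∀ τ ∈ Ioo 0 T, c1NormST τ φ ≤ M := by
  obtain ⟨M, hM0, h1, h2, -, h3⟩ := hφ.exists_bound hT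
  refine ⟨M + M + ∑ _j : Fin d, M, by positivity, fun t ht => ?_, fun τ hτ => ?_⟩
  · refine add_le_add ?_ (Finset.sum_le_sum fun j _ => Real.iSup_le (fun x => h2 t ht x j) hM0)
    exact (Real.iSup_le (fun x => h1 t ht x) hM0).trans (by linarith)
  · have hsub : ∀ q : Icc 0 τ × Torus d, (q.1 : ℝ) ∈ Icc 0 T := fun q =>
      ⟨q.1.2.1, q.1.2.2.trans hτ.2.le⟩
    refine add_le_add (add_le_add ?_ ?_) (Finset.sum_le_sum fun j _ => ?_)
    · exact Real.iSup_le (fun q => h1 _ (hsub q) _) hM0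
    · exact Real.iSup_le (fun q => h3 τ hτ.1 hτ.2.le _ q.1.2 _) hM0
    · exact Real.iSup_le (fun q => h2 _ (hsub q) _ j) hM0

theorem integrableOn_mul_bounded {ξ D : ℝ → ℝ} (hξ : IntegrableOn ξ (Ioo 0 T))
    (hD : MemLp D ∞ (volume.restrict (Ioo 0 T))) : IntegrableOn (fun t => ξ t * D t) (Ioo 0 T) :=
  (integrable_mul_of_memLp_top hD hξ).congr (Eventually.of_forall fun _ => mul_comm _ _)

/-- Energy inequality minus momentum balance plus mass balance, plus the time increment of the mean
of γE for the background. The initial values add up to zero, the integrands to the remainder, and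
the defects yield the kernel κ, which is only integrable because ξ is. -/
theorem IsMeasureValuedSolution.relative_energy_inequality (hV : IsMeasureValuedSolution γ T V₀ V D)
    (hγ : 1 ≤ γ) (hT : 0 < T) (haT : a ≤ T) (hB : Background γ T a r v)
    (h₀ : ∀ᵐ x ∂(volume : Measure (Torus d)),
      V₀ x = Measure.dirac (Real.toNNReal (r 0 x), √(r 0 x) • v 0 x)) :
    ∃ (K : ℝ) (κ : ℝ → ℝ), 0 ≤ K ∧ (∀ t, 0 ≤ κ t) ∧ IntegrableOn κ (Ioo 0 T) ∧
      ∀ᵐ τ ∂volume.restrict (Ioo 0 a),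
        tot V (relEnergy γ r v) τ + 1 / 2 * D τ
            + 1 / 2 * ∫ t in (0 : ℝ)..τ, tot V (fun q => ‖gradFluct γ r q‖ ^ 2) t
          ≤ ∫ t in (0 : ℝ)..τ, (K * tot V (relEnergy γ r v) t + κ t * D t) := by
  have := hV.markov
  have h := hV.finite_energy
  obtain ⟨K, hK0, hK⟩ := hB.tot_remainder_le (V := V) hγ hT h
  obtain ⟨M, hM0, hM1, hM2⟩ := hB.velocity.c1Norm_bound hT
  obtain ⟨ξ, hξ, hmom⟩ := hV.momentum_tot hγ hB.velocity
  obtain ⟨R, C, hC, hen⟩ := hV.energy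
  -- At the final time the energy defect costs ε D(τ) and the momentum defect at most ε M D(τ), with
  -- M bounding the C¹ norms of v; the choice makes the sum ½ D(τ).
  set ε : ℝ := 1 / (2 * (1 + M)) with hε
  have hε0 : 0 < ε := by positivity
  have hεM : ε * (1 + M) = 1 / 2 := by
    rw [hε]
    field_simp
  set c : ℝ := 1 + 1 / (4 * ε) with hc
  have hc0 : 0 ≤ c := by positivity
  have hDi : IntegrableOn D (Ioo 0 T) := by
    have : IsFiniteMeasure (volume.restrict (Ioo 0 T)) := ⟨by simp⟩
    exact hV.defect_bounded.integrable (by simp)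
  have hξD := integrableOn_mul_bounded hξ.norm hV.defect_bounded
  have hIrel := integrableOn_tot (hB.integrable_relEnergy (V := V) hγ hT h)
  have hY := hB.memLp_gradFluct (V := V) hγ hT h
  have hIY := integrableOn_tot ((memLp_two_iff_integrable_sq_norm hY.1).1 hY)
  refine ⟨K, fun t => c * C + c * M * ‖ξ t‖, hK0, fun _ => by positivity, ?_, ?_⟩
  · exact (integrableOn_const (by simp)).add (hξ.norm.const_mul _)
  have hE := hB.density.E_comp hγ hB.pos
  have i1 := integrableOn_tot (integrable_inner_of_memLp h.memLp_mom h.memLp_gradQ)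
  have i2 := integrableOn_tot h.dissipation
  have i3 := integrableOn_tot (integrable_massFlux (V := V) hγ hT h hB.isC1_densityTest)
  have i4 := integrableOn_tot (integrable_momFlux (V := V) hγ hT h hB.velocity)
  have i5 : IntegrableOn (fun t => ∫ x, dt (fun t x => γ * E γ (r t x)) t x) (Ioo 0 T) := by
    have h1 := (hE.memLp_top_dt hT).integrable (by simp)
    rw [slab_eq_prod] at h1
    exact h1.integral_prod_left
  filter_upwards [ae_Ioo_of_le haT hmom, ae_Ioo_of_le haT hen,
    ae_Ioo_of_le haT (hV.continuity_tot hγ hB.isC1_densityTest),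
    ae_Ioo_of_le haT (hB.tot_relEnergy (V := V) hγ hT h), ae_Ioo_of_le haT hV.defect_nonneg,
    ae_restrict_mem measurableSet_Ioo] with τ ⟨m, hm, hmeq⟩ ⟨hR, hRle⟩ hce hrel hDτ hτ
  have hτT : τ ∈ Ioo 0 T := ⟨hτ.1, hτ.2.trans_le haT⟩
  have II : ∀ {f : ℝ → ℝ}, IntegrableOn f (Ioo 0 T) → IntervalIntegrable f volume 0 τ :=
    fun hf => intervalIntegrable_of_Ioo hτ.1.le hτT.2.le hf
  have hstrong := hE.integral_sub_integral hT hτT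
  have hinit := hB.initial_energy hγ hT h₀
  have hsum : (∫ t in (0 : ℝ)..τ, tot V (fun q => inner ℝ q.2.2.1 q.2.2.2) t)
      - (∫ t in (0 : ℝ)..τ, tot V (fun q => ‖q.2.2.2‖ ^ 2) t)
      + (∫ t in (0 : ℝ)..τ, tot V (massFlux (densityTest γ r v)) t)
      - (∫ t in (0 : ℝ)..τ, tot V (momFlux v) t)
      + (∫ t in (0 : ℝ)..τ, ∫ x, dt (fun t x => γ * E γ (r t x)) t x)
      ≤ K * (∫ t in (0 : ℝ)..τ, tot V (relEnergy γ r v) t)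
        - 1 / 2 * ∫ t in (0 : ℝ)..τ, tot V (fun q => ‖gradFluct γ r q‖ ^ 2) t := by
    rw [← intervalIntegral.integral_sub (II i1) (II i2),
      ← intervalIntegral.integral_add ((II i1).sub (II i2)) (II i3),
      ← intervalIntegral.integral_sub (((II i1).sub (II i2)).add (II i3)) (II i4),
      ← intervalIntegral.integral_add ((((II i1).sub (II i2)).add (II i3)).sub (II i4)) (II i5),
      ← intervalIntegral.integral_const_mul, ← intervalIntegral.integral_const_mul,
      ← intervalIntegral.integral_sub ((II hIrel).const_mul K) ((II hIY).const_mul (1 / 2))]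
    rw [intervalIntegral_congr_ae_Ioo hτ.1.le hτ.2.le
      (hB.tot_remainder (V := V) hγ hT haT h hV.regularity)]
    exact intervalIntegral_mono_ae_Ioo hτ.1.le hτT.2.le
      (integrableOn_tot (hB.integrable_remainder hγ hT h))
      ((hIrel.const_mul K).sub (hIY.const_mul (1 / 2))) hK
  have hmbound : |m| ≤ c * (M * ∫ t in (0 : ℝ)..τ, ‖ξ t‖ * D t) + ε * M * D τ := by
    refine (hm ε hε0).trans (add_le_add ?_ ?_)
    · refine mul_le_mul_of_nonneg_left ?_ hc0
      rw [← intervalIntegral.integral_const_mul]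
      -- The sign of ξ is not prescribed, so it is replaced by |ξ|; D is non-negative.
      refine (le_abs_self _).trans (intervalIntegral.norm_integral_le_of_norm_le
        (f := fun t => ξ t * D t * c1Norm (v t)) hτ.1.le ?_ ((II hξD).const_mul M))
      have hDn := (ae_restrict_iff' measurableSet_Ioo).1 hV.defect_nonneg
      filter_upwards [hDn] with t ht htτ
      have htT : t ∈ Ioo 0 T := ⟨htτ.1, htτ.2.trans_lt hτT.2⟩
      have hDt := ht htT
      rw [norm_mul, norm_mul, Real.norm_of_nonneg hDt, Real.norm_of_nonneg (c1Norm_nonneg _),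
        mul_comm M]
      exact mul_le_mul_of_nonneg_left (hM1 t (Ioo_subset_Icc_self htT)) (by positivity)
    · gcongr
      exact hM2 τ hτT
  have hRb := hR ε hε0
  have hsplit : ∫ t in (0 : ℝ)..τ, (K * tot V (relEnergy γ r v) t + (c * C + c * M * ‖ξ t‖) * D t) =
      K * (∫ t in (0 : ℝ)..τ, tot V (relEnergy γ r v) t) + c * C * (∫ t in (0 : ℝ)..τ, D t)
        + c * M * ∫ t in (0 : ℝ)..τ, ‖ξ t‖ * D t := by
    rw [← intervalIntegral.integral_const_mul, ← intervalIntegral.integral_const_mul,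
      ← intervalIntegral.integral_const_mul,
      ← intervalIntegral.integral_add ((II hIrel).const_mul K) ((II hDi).const_mul (c * C)),
      ← intervalIntegral.integral_add
        (((II hIrel).const_mul K).add ((II hDi).const_mul (c * C))) ((II hξD).const_mul (c * M))]
    refine intervalIntegral.integral_congr fun t _ => ?_
    ring
  rw [hsplit, hrel]
  have hRle' : tot V (fun q => (1 / 2) * ‖q.2.2.1‖ ^ 2 + E γ q.2.1) τ
      + (∫ t in (0 : ℝ)..τ, tot V (fun q => ‖q.2.2.2‖ ^ 2) t) + D τ
      ≤ (∫ x, avg₀ V₀ (fun z => (1 / 2) * ‖z.2‖ ^ 2 + E γ z.1) x)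
          + (∫ t in (0 : ℝ)..τ, tot V (fun q => inner ℝ q.2.2.1 q.2.2.2) t)
          + R (Ioo 0 τ ×ˢ univ) := hRle
  have hR1 := (le_abs_self _).trans hRb
  have hm1 := (neg_le_abs m).trans hmbound
  have hεD : ε * D τ + ε * M * D τ = 1 / 2 * D τ := by
    linear_combination D τ * hεM
  have hCc : C * c * (∫ t in (0 : ℝ)..τ, D t) = c * C * ∫ t in (0 : ℝ)..τ, D t := by ring
  rw [hCc] at hR1
  linarith

end RelativeEnergyInequality

/-! ### A Grönwall lemma with an integrable kernel. -/

section Gronwall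

/-- Grönwall's inequality with an integrable kernel, in the homogeneous case. -/
theorem ae_eq_zero_of_le_integral {a : ℝ} {h k : ℝ → ℝ} (hk : ∀ t, 0 ≤ k t)
    (hkI : IntegrableOn k (Ioo 0 a)) (hh : ∀ᵐ t ∂volume.restrict (Ioo 0 a), 0 ≤ h t)
    (hkh : IntegrableOn (fun t => k t * h t) (Ioo 0 a))
    (hle : ∀ᵐ τ ∂volume.restrict (Ioo 0 a), h τ ≤ ∫ t in (0 : ℝ)..τ, k t * h t) :
    ∀ᵐ t ∂volume.restrict (Ioo 0 a), h t = 0 := by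
  rcases le_or_gt a 0 with ha | ha
  · simp [Ioo_eq_empty (not_lt.2 ha)]
  have hII : ∀ {f : ℝ → ℝ}, IntegrableOn f (Ioo 0 a) → ∀ {s τ : ℝ}, 0 ≤ s → s ≤ τ → τ ≤ a →
      IntervalIntegrable f volume s τ := by
    intro f hf s τ hs hsτ hτ
    rw [intervalIntegrable_iff_integrableOn_Ioo_of_le hsτ]
    exact hf.mono_set (Ioo_subset_Ioo hs hτ)
  have hmono : ∀ {f g : ℝ → ℝ}, IntegrableOn f (Ioo 0 a) → IntegrableOn g (Ioo 0 a) →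
      (∀ᵐ t ∂volume.restrict (Ioo 0 a), f t ≤ g t) → ∀ {s τ : ℝ}, 0 ≤ s → s ≤ τ → τ ≤ a →
      ∫ t in s..τ, f t ≤ ∫ t in s..τ, g t := by
    intro f g hf hg hfg s τ hs hsτ hτ
    rw [intervalIntegral.integral_of_le hsτ, intervalIntegral.integral_of_le hsτ,
      integral_Ioc_eq_integral_Ioo, integral_Ioc_eq_integral_Ioo]
    exact integral_mono_ae (hf.mono_set (Ioo_subset_Ioo hs hτ)) (hg.mono_set (Ioo_subset_Ioo hs hτ))
      (ae_restrict_of_ae_restrict_of_subset (Ioo_subset_Ioo hs hτ) hfg)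
  have hcont : ∀ {f : ℝ → ℝ}, IntegrableOn f (Ioo 0 a) →
      ContinuousOn (fun τ => ∫ t in (0 : ℝ)..τ, f t) (Icc 0 a) := by
    intro f hf
    have h1 : IntegrableOn f (uIcc 0 a) := by
      rwa [uIcc_of_le ha.le, integrableOn_Icc_iff_integrableOn_Ioo]
    simpa only [uIcc_of_le ha.le] using intervalIntegral.continuousOn_primitive_interval h1
  set G : ℝ → ℝ := fun τ => ∫ t in (0 : ℝ)..τ, k t * h t with hG
  have hkh0 : ∀ᵐ t ∂volume.restrict (Ioo 0 a), 0 ≤ k t * h t := by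
    filter_upwards [hh] with t ht
    exact mul_nonneg (hk t) ht
  have hGadd : ∀ {s τ : ℝ}, 0 ≤ s → s ≤ τ → τ ≤ a → G τ = G s + ∫ t in s..τ, k t * h t := by
    intro s τ hs hsτ hτ
    exact (intervalIntegral.integral_add_adjacent_intervals (hII hkh le_rfl hs (hsτ.trans hτ))
      (hII hkh hs hsτ hτ)).symm
  have hGmono : ∀ {s τ : ℝ}, 0 ≤ s → s ≤ τ → τ ≤ a → G s ≤ G τ := by
    intro s τ hs hsτ hτ
    have h1 := hmono (integrableOn_const (C := (0 : ℝ)) (by simp)) hkh hkh0 hs hsτ hτ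
    rw [hGadd hs hsτ hτ]
    simpa using h1
  -- Continuous induction: the zero set of the continuous function G is closed and contains 0, and
  -- it remains to move a little to the right of any of its points.
  have hzero : Icc 0 a ⊆ {τ | G τ = 0} := by
    refine IsClosed.Icc_subset_of_forall_exists_gt ?_ (by simp [hG]) ?_
    · rw [inter_comm]
      exact (hcont hkh).preimage_isClosed_of_isClosed isClosed_Icc isClosed_singleton
    · rintro s ⟨hs0, hs⟩ y hy
      have hKc : ContinuousWithinAt (fun τ => ∫ t in (0 : ℝ)..τ, k t) (Ioc s (min y a)) s :=
        ((hcont hkI) s ⟨hs.1, hs.2.le⟩).mono fun τ hτ =>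
          ⟨hs.1.trans hτ.1.le, hτ.2.trans (min_le_right _ _)⟩
      have hlt : s < min y a := lt_min hy hs.2
      have hev : ∀ᶠ τ in 𝓝[Ioc s (min y a)] s,
          ∫ t in (0 : ℝ)..τ, k t < (∫ t in (0 : ℝ)..s, k t) + 1 :=
        hKc.eventually (Iio_mem_nhds (lt_add_one _))
      have hne : (𝓝[Ioc s (min y a)] s).NeBot := by
        rw [nhdsWithin_Ioc_eq_nhdsGT hlt]
        infer_instance
      obtain ⟨τ, h1, hτ⟩ := (hev.and self_mem_nhdsWithin).exists
      have hτa : τ ≤ a := hτ.2.trans (min_le_right _ _)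
      refine ⟨τ, ?_, hτ.1, hτ.2.trans (min_le_left _ _)⟩
      have hτ0 : 0 ≤ τ := hs.1.trans hτ.1.le
      -- On (s, τ) one has h ≤ G ≤ G(τ) almost everywhere, as G is monotone. Since τ is so close to
      -- s that the integral of k over (s, τ) is below 1, this forces G(τ) = 0.
      have h2 : G τ ≤ (∫ t in s..τ, k t) * G τ := by
        rw [hGadd hs.1 hτ.1.le hτa, show G s = 0 from hs0, zero_add, mul_comm,
          ← intervalIntegral.integral_const_mul]
        have hsub : Ioo s τ ⊆ Ioo 0 a := Ioo_subset_Ioo hs.1 hτa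
        rw [intervalIntegral.integral_of_le hτ.1.le, intervalIntegral.integral_of_le hτ.1.le,
          integral_Ioc_eq_integral_Ioo, integral_Ioc_eq_integral_Ioo]
        refine integral_mono_ae (hkh.mono_set hsub) ((hkI.mono_set hsub).const_mul _) ?_
        filter_upwards [ae_restrict_of_ae_restrict_of_subset hsub hle,
          ae_restrict_mem measurableSet_Ioo] with t ht hts
        have h3 : h t ≤ G τ := ht.trans (hGmono (hs.1.trans hts.1.le) hts.2.le hτa)
        rw [hGadd hs.1 hτ.1.le hτa, show G s = 0 from hs0, zero_add,
          intervalIntegral.integral_of_le hτ.1.le, integral_Ioc_eq_integral_Ioo] at h3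
        rw [mul_comm (k t)]
        exact mul_le_mul_of_nonneg_right h3 (hk t)
      have h4 : ∫ t in s..τ, k t < 1 := by
        have := intervalIntegral.integral_add_adjacent_intervals
          (hII hkI le_rfl hs.1 hs.2.le) (hII hkI hs.1 hτ.1.le hτa)
        linarith
      have h5 : 0 ≤ G τ := by
        have := hGmono le_rfl hτ0 hτa
        simpa [hG] using this
      have : G τ = 0 := by nlinarith
      exact this
  filter_upwards [hh, hle, ae_restrict_mem measurableSet_Ioo] with t h1 h2 ht
  exact le_antisymm (h2.trans_eq (hzero (Ioo_subset_Icc_self ht))) h1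

end Gronwall

/-! ### Vanishing of the relative energy and identification of the Dirac measure. -/

section Uniqueness

variable {d : ℕ} {γ T a : ℝ} {V₀ : Kernel (Torus d) (Phase₀ d)}
  {V : Kernel (ℝ × Torus d) (Phase d)} {D : ℝ → ℝ}
  {r : ℝ → Torus d → ℝ} {v : ℝ → Torus d → Vec d}

theorem tot_relEnergy_nonneg (hγ : 1 ≤ γ) (hB : Background γ T a r v) {t : ℝ} (ht : t ∈ Icc 0 T) :
    0 ≤ tot V (relEnergy γ r v) t :=
  integral_nonneg fun x => integral_nonneg fun z =>
    add_nonneg (by positivity) (relE_nonneg hγ z.1.2 (hB.pos t ht x))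

theorem IsMeasureValuedSolution.relEnergy_eq_zero (hV : IsMeasureValuedSolution γ T V₀ V D)
    (hγ : 1 ≤ γ) (hT : 0 < T) (haT : a ≤ T) (hB : Background γ T a r v)
    (h₀ : ∀ᵐ x ∂(volume : Measure (Torus d)),
      V₀ x = Measure.dirac (Real.toNNReal (r 0 x), √(r 0 x) • v 0 x)) :
    (∀ᵐ t ∂volume.restrict (Ioo 0 a), D t = 0) ∧
    (∀ᵐ t ∂volume.restrict (Ioo 0 a), tot V (relEnergy γ r v) t = 0) ∧
    ∀ᵐ τ ∂volume.restrict (Ioo 0 a),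
      ∫ t in (0 : ℝ)..τ, tot V (fun q => ‖gradFluct γ r q‖ ^ 2) t ≤ 0 := by
  have := hV.markov
  obtain ⟨K, κ, hK, hκ, hκI, hle⟩ := hV.relative_energy_inequality hγ hT haT hB h₀
  have hsub : Ioo 0 a ⊆ Ioo 0 T := Ioo_subset_Ioo_right haT
  have hIrel := (integrableOn_tot (hB.integrable_relEnergy (V := V) hγ hT hV.finite_energy)).mono_set
    hsub
  have hκD := (integrableOn_mul_bounded hκI hV.defect_bounded).mono_set hsub
  have hDi : IntegrableOn D (Ioo 0 a) := by
    have : IsFiniteMeasure (volume.restrict (Ioo 0 T)) := ⟨by simp⟩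
    exact IntegrableOn.mono_set (hV.defect_bounded.integrable (by simp)) hsub
  have hD0 := ae_Ioo_of_le haT hV.defect_nonneg
  have hrel0 : ∀ t ∈ Ioo 0 a, 0 ≤ tot V (relEnergy γ r v) t := fun t ht =>
    tot_relEnergy_nonneg hγ hB (Ioo_subset_Icc_self (hsub ht))
  have hY0 : ∀ t, 0 ≤ tot V (fun q => ‖gradFluct γ r q‖ ^ 2) t := fun t =>
    tot_nonneg (fun q => sq_nonneg _) t
  have hIY0 : ∀ τ, 0 ≤ τ → 0 ≤ ∫ t in (0 : ℝ)..τ, tot V (fun q => ‖gradFluct γ r q‖ ^ 2) t :=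
    fun τ hτ => intervalIntegral.integral_nonneg hτ fun t _ => hY0 t
  set h : ℝ → ℝ := fun t => tot V (relEnergy γ r v) t + 1 / 2 * D t with hh
  -- The factor 2 compensates the ½ in front of D: κ D = 2κ · ½D.
  set k : ℝ → ℝ := fun t => K + 2 * κ t with hk
  have hIh : IntegrableOn h (Ioo 0 a) := hIrel.add (hDi.const_mul _)
  have hkI : IntegrableOn k (Ioo 0 a) :=
    (integrableOn_const (by simp)).add ((hκI.mono_set hsub).const_mul 2)
  have hh0 : ∀ᵐ t ∂volume.restrict (Ioo 0 a), 0 ≤ h t := by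
    filter_upwards [hD0, ae_restrict_mem measurableSet_Ioo] with t h1 h2
    have := hrel0 t h2
    simp only [hh]
    linarith
  have hsrc : IntegrableOn (fun t => K * tot V (relEnergy γ r v) t + κ t * D t) (Ioo 0 a) :=
    (hIrel.const_mul K).add hκD
  have hsrc0 : ∀ᵐ t ∂volume.restrict (Ioo 0 a),
      0 ≤ K * tot V (relEnergy γ r v) t + κ t * D t := by
    filter_upwards [hD0, ae_restrict_mem measurableSet_Ioo] with t h1 h2
    exact add_nonneg (mul_nonneg hK (hrel0 t h2)) (mul_nonneg (hκ t) h1)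
  -- The inequality itself makes h essentially bounded; with k merely integrable, this is what makes
  -- k·h integrable.
  have hbound : ∀ᵐ t ∂volume.restrict (Ioo 0 a), ‖h t‖ ≤
      ∫ s in Ioo 0 a, (K * tot V (relEnergy γ r v) s + κ s * D s) := by
    filter_upwards [hle, hh0, ae_restrict_mem measurableSet_Ioo] with t h1 h2 ht
    rw [Real.norm_of_nonneg h2]
    have h3 : h t ≤ ∫ s in (0 : ℝ)..t, (K * tot V (relEnergy γ r v) s + κ s * D s) := by
      have := hIY0 t ht.1.le
      simp only [hh]
      linarith
    refine h3.trans ?_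
    rw [intervalIntegral.integral_of_le ht.1.le, integral_Ioc_eq_integral_Ioo]
    exact setIntegral_mono_set hsrc hsrc0 (Ioo_subset_Ioo_right ht.2.le).eventuallyLE
  have hkh : IntegrableOn (fun t => k t * h t) (Ioo 0 a) := hkI.mul_bdd hIh.1 hbound
  have hle2 : ∀ᵐ τ ∂volume.restrict (Ioo 0 a), h τ
      + 1 / 2 * (∫ t in (0 : ℝ)..τ, tot V (fun q => ‖gradFluct γ r q‖ ^ 2) t)
        ≤ ∫ t in (0 : ℝ)..τ, k t * h t := by
    filter_upwards [hle, ae_restrict_mem measurableSet_Ioo] with τ h1 hτ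
    refine h1.trans (intervalIntegral_mono_ae_Ioo hτ.1.le hτ.2.le hsrc hkh ?_)
    filter_upwards [hD0, ae_restrict_mem measurableSet_Ioo] with t h2 h3
    have h4 := hrel0 t h3
    have h5 := hκ t
    have h6 := mul_nonneg h5 h4
    have h7 := mul_nonneg hK h2
    simp only [hk, hh]
    nlinarith
  have hzero := ae_eq_zero_of_le_integral (fun t => by have := hκ t; simp only [hk]; positivity)
    hkI hh0 hkh (by
      filter_upwards [hle2, ae_restrict_mem measurableSet_Ioo] with τ h1 hτ
      have := hIY0 τ hτ.1.le
      linarith)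
  refine ⟨?_, ?_, ?_⟩
  · filter_upwards [hzero, hD0, ae_restrict_mem measurableSet_Ioo] with t h1 h2 ht
    have := hrel0 t ht
    simp only [hh] at h1
    linarith
  · filter_upwards [hzero, hD0, ae_restrict_mem measurableSet_Ioo] with t h1 h2 ht
    have := hrel0 t ht
    simp only [hh] at h1
    linarith
  · filter_upwards [hle2, hzero, ae_restrict_mem measurableSet_Ioo] with τ h1 h2 hτ
    have h3 : ∫ t in (0 : ℝ)..τ, k t * h t = ∫ t in (0 : ℝ)..τ, (0 : ℝ) := by
      refine intervalIntegral_congr_ae_Ioo hτ.1.le hτ.2.le ?_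
      filter_upwards [hzero] with t ht
      rw [ht, mul_zero]
    rw [h3, h2] at h1
    simp at h1
    linarith

/-- The bound is known only for almost every τ, so an admissible τ is picked in (a, b); hence the
slightly shorter interval in the conclusion. -/
theorem ae_eq_zero_of_integral_le_zero {f : ℝ → ℝ} {a b : ℝ} (hab : a < b) (ha : 0 < a)
    (hf : ∀ t, 0 ≤ f t)
    (hfi : IntegrableOn f (Ioo 0 b))
    (h : ∀ᵐ τ ∂volume.restrict (Ioo 0 b), ∫ t in (0 : ℝ)..τ, f t ≤ 0) :
    ∀ᵐ t ∂volume.restrict (Ioo 0 a), f t = 0 := by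
  have h1 : ∀ᵐ τ ∂volume.restrict (Ioo a b), τ ∈ Ioo a b ∧ ∫ t in (0 : ℝ)..τ, f t ≤ 0 := by
    filter_upwards [ae_restrict_mem measurableSet_Ioo,
      ae_restrict_of_ae_restrict_of_subset (Ioo_subset_Ioo_left ha.le) h] with τ h2 h3
    exact ⟨h2, h3⟩
  have hne : (ae (volume.restrict (Ioo a b))).NeBot := by
    rw [ae_neBot, Ne, Measure.restrict_eq_zero]
    simp [hab]
  obtain ⟨τ, hτ, h2⟩ := h1.exists
  rw [intervalIntegral.integral_of_le (ha.trans hτ.1).le, integral_Ioc_eq_integral_Ioo] at h2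
  have h3 := (setIntegral_eq_zero_iff_of_nonneg_ae (ae_of_all _ hf)
    (hfi.mono_set (Ioo_subset_Ioo_right hτ.2.le))).1
    (le_antisymm h2 (integral_nonneg hf))
  exact ae_restrict_of_ae_restrict_of_subset (Ioo_subset_Ioo_right hτ.1.le) h3

theorem eq_dirac_of_ae_eq {α : Type*} [MeasurableSpace α] {μ : Measure α} [IsProbabilityMeasure μ]
    {c : α} (h : ∀ᵐ z ∂μ, z = c) : μ = Measure.dirac c := by
  have h1 : μ.map id = μ.map fun _ => c := Measure.map_congr h
  rwa [Measure.map_id, Measure.map_const, measure_univ, one_smul] at h1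

/-- Q' = √r p'. A vanishing gradient fluctuation thus means that q is the gradient of Q of the
strong density. -/
theorem grad_Q_comp (hγ : 1 ≤ γ) {f : Torus d → ℝ} (hf : ContDiff ℝ 1 (lift f)) (x : Torus d) :
    grad (fun y => Q γ (f y)) x = √(f x) • grad (fun y => p γ (f y)) x := by
  ext j
  have h1 := (HasPd.scomp (hasDerivAt_Q hγ (f x)) (hasPd hf j x)).pd_eq
  have h2 := (HasPd.scomp (hasDerivAt_p hγ (f x)) (hasPd hf j x)).pd_eq
  simp only [grad, PiLp.smul_apply, smul_eq_mul] at h1 h2 ⊢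
  rw [h1, h2]
  ring

/-- Vanishing totals of the non-negative densities determine the phase variables almost surely: E(r
| ϱ̄) = 0 gives r, the momentum fluctuation gives z, and the gradient fluctuation gives q. -/
theorem IsMeasureValuedSolution.eq_dirac_of_lt (hV : IsMeasureValuedSolution γ T V₀ V D)
    (hγ : 1 ≤ γ) (hT : 0 < T) {ρ : ℝ → Torus d → ℝ} {w : ℝ → Torus d → Vec d}
    (hρw : IsStrongSolution γ T ρ w)
    (h₀ : ∀ᵐ x ∂(volume : Measure (Torus d)),
      V₀ x = Measure.dirac (Real.toNNReal (ρ 0 x), √(ρ 0 x) • w 0 x))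
    {b : ℝ} (hb : 0 < b) (hbT : b < T) :
    (∀ᵐ t ∂volume.restrict (Ioo 0 b), D t = 0) ∧
    ∀ᵐ q ∂slab d b, V q = Measure.dirac (Real.toNNReal (ρ q.1 q.2), √(ρ q.1 q.2) • w q.1 q.2,
        grad (fun y => Q γ (ρ q.1 y)) q.2) := by
  have := hV.markov
  -- Three times b < a < c < T: the background solves the system up to a, its time argument stays
  -- below c, and the step from a to b is the loss in `ae_eq_zero_of_integral_le_zero`.
  obtain ⟨a, hba, haT⟩ := exists_between hbT
  obtain ⟨c, hac, hcT⟩ := exists_between haT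
  have ha : 0 < a := hb.trans hba
  have hB := hρw.background ha hac hcT
  have hθ : ∀ t ≤ a, truncTime a c t = t := fun t ht => truncTime_of_le hac ht
  obtain ⟨h1, h2, h3⟩ := hV.relEnergy_eq_zero hγ hT haT.le hB (by simpa [hθ 0 ha.le] using h₀)
  refine ⟨ae_Ioo_of_le hba.le h1, ?_⟩
  have hFE := hV.finite_energy
  have hY := hB.memLp_gradFluct (V := V) hγ hT hFE
  have hYi := (memLp_two_iff_integrable_sq_norm hY.1).1 hY
  have h4 := ae_eq_zero_of_integral_le_zero hba hb
    (fun t => tot_nonneg (V := V) (fun q => sq_nonneg ‖gradFluct γ _ q‖) t)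
    ((integrableOn_tot hYi).mono_set (Ioo_subset_Ioo_right haT.le)) h3
  have hbT' := hbT.le
  have hpos : ∀ t ∈ Ioo 0 b, ∀ x, 0 < ρ (truncTime a c t) x := fun t ht x =>
    hB.pos t ⟨ht.1.le, ht.2.le.trans hbT'⟩ x
  have h5 := ae_eq_zero_of_tot_eq_zero (hB.integrable_relEnergy (V := V) hγ hT hFE) hbT'
    (fun t ht x z => add_nonneg (by positivity) (relE_nonneg hγ z.1.2 (hpos t ht x)))
    (ae_Ioo_of_le hba.le h2)
  have h6 := ae_eq_zero_of_tot_eq_zero hYi hbT' (fun t ht x z => sq_nonneg _) h4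
  filter_upwards [h5, h6, ae_slab_mem] with q h7 h8 hq
  refine eq_dirac_of_ae_eq ?_
  filter_upwards [h7, h8] with z h9 h10
  have hqθ := hθ q.1 (hq.2.le.trans hba.le)
  have hρpos := hpos q.1 hq q.2
  have hrelE := relE_nonneg hγ z.1.2 hρpos
  simp only [relEnergy] at h9
  have h11 : relE γ z.1 (ρ (truncTime a c q.1) q.2) = 0 := by
    have := sq_nonneg ‖momFluct (fun t => w (truncTime a c t)) (q, z)‖
    simp only [NNReal.val_eq_coe] at hrelE
    linarith
  have h12 : ‖momFluct (fun t => w (truncTime a c t)) (q, z)‖ ^ 2 = 0 := by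
    rw [h11] at h9
    linarith
  have hz1 := eq_of_relE_eq_zero hγ z.1.2 hρpos h11
  have hz2 : momFluct (fun t => w (truncTime a c t)) (q, z) = 0 := by simpa using h12
  have hz3 : gradFluct γ (fun t => ρ (truncTime a c t)) (q, z) = 0 := by simpa using h10
  simp only [momFluct, gradFluct, hqθ, sub_eq_zero, NNReal.val_eq_coe] at hz1 hz2 hz3
  have hsm : ContDiff ℝ 1 (lift (ρ q.1)) := by
    have := hB.contDiff_density (t := q.1) ⟨hq.1.le, hq.2.le.trans hbT'⟩
    simpa only [hqθ] using this
  rw [grad_Q_comp hγ hsm]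
  rw [hz1] at hz2 hz3
  refine Prod.ext ?_ (Prod.ext hz2 hz3)
  rw [← hz1, Real.toNNReal_coe]

theorem Ioo_eq_iUnion {T : ℝ} {u : ℕ → ℝ} (hu : ∀ n, u n < T) (hlim : Tendsto u atTop (𝓝 T)) :
    Ioo 0 T = ⋃ n, Ioo 0 (u n) := by
  ext t
  simp only [mem_iUnion, mem_Ioo]
  constructor
  · rintro ⟨h1, h2⟩
    obtain ⟨n, hn⟩ := (hlim.eventually (Ioi_mem_nhds h2)).exists
    exact ⟨n, h1, hn⟩
  · rintro ⟨n, h1, h2⟩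
    exact ⟨h1, h2.trans (hu n)⟩

end Uniqueness

end AwRascle

end

/-! ### Conclusion by exhausting the time interval. -/

theorem theorem2 (d : ℕ) (hd : d = 2 ∨ d = 3) (γ : ℝ) (hγ : 1 ≤ γ) (T : ℝ) (hT : 0 < T)
    (V₀ : Kernel (AwRascle.Torus d) (AwRascle.Phase₀ d))
    (V : Kernel (ℝ × AwRascle.Torus d) (AwRascle.Phase d)) (D : ℝ → ℝ)
    (hV : AwRascle.IsMeasureValuedSolution γ T V₀ V D)
    (ρ : ℝ → AwRascle.Torus d → ℝ) (w : ℝ → AwRascle.Torus d → AwRascle.Vec d)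
    (hρw : AwRascle.IsStrongSolution γ T ρ w)
    (h₀ : ∀ᵐ x ∂(volume : Measure (AwRascle.Torus d)),
      V₀ x = Measure.dirac (Real.toNNReal (ρ 0 x), √(ρ 0 x) • w 0 x)) :
    (∀ᵐ t ∂(volume : Measure ℝ).restrict (Ioo 0 T), D t = 0) ∧
    (∀ᵐ q ∂(volume : Measure (ℝ × AwRascle.Torus d)).restrict (Ioo 0 T ×ˢ univ),
      V q = Measure.dirac (Real.toNNReal (ρ q.1 q.2), √(ρ q.1 q.2) • w q.1 q.2,
        AwRascle.grad (fun y => AwRascle.Q γ (ρ q.1 y)) q.2)) := by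
  obtain ⟨u, -, hu, hlim⟩ := exists_seq_strictMono_tendsto T
  have hU := AwRascle.Ioo_eq_iUnion hu hlim
  have hmain : ∀ n, (∀ᵐ t ∂(volume : Measure ℝ).restrict (Ioo 0 (u n)), D t = 0) ∧
      ∀ᵐ q ∂AwRascle.slab d (u n),
        V q = Measure.dirac (Real.toNNReal (ρ q.1 q.2), √(ρ q.1 q.2) • w q.1 q.2,
          AwRascle.grad (fun y => AwRascle.Q γ (ρ q.1 y)) q.2) := by
    intro n
    -- Early members of the sequence may be non-positive; their time intervals are empty.
    rcases le_or_gt (u n) 0 with h | h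
    · simp [AwRascle.slab, Ioo_eq_empty (not_lt.2 h)]
    · exact hV.eq_dirac_of_lt hγ hT hρw h₀ h (hu n)
  rw [hU, iUnion_prod_const, ae_restrict_iUnion_iff, ae_restrict_iUnion_iff]
  exact ⟨fun n => (hmain n).1, fun n => (hmain n).2⟩
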